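/- Let $\tau\in\mathbb{C}$, $q=e^{-2i\pi\tau}$ with $|q|>1$, and $q_l=e^{-2i\pi\tau/l}$ for $l\ge 1$. Let $K$ be one of the fields $\mathcal{M}(\mathbb{C})\subset\mathbb{C}(\{z\})\subset\mathbb{C}((z))$ (meromorphic functions on $\mathbb{C}$, convergent Laurent series, formal Laurent series), with the automorphism $\sigma_q:f(z)\mapsto f(qz)$. Let $DiffMod(K,\sigma_q)$ be the category of $q$-difference modules $(M,\Phi)$: $M$ is a finite-dimensional $K$-vector space and $\Phi$ a $\sigma_q$-linear automorphism of $M$; morphisms are the $K$-linear maps commuting with $\Phi$, submodules are the $\Phi^{\pm1}$-stable subspaces, and $\mathbb{C}$ acts on morphisms through $\mathbb{C}\subset K$. For $l\ge1$ let $K_l$ be the corresponding field in the variable $z_l$, $z_l^l=z$, with $\sigma_{q_l}:f(z_l)\mapsto f(q_lz_l)$. The set $S(M)\subset\mathbb{Q}$ of slopes of $M$ is defined as follows: for some $l$ the module $K_l\otimes_K M$ is triangularisable, i.e. it has a flag of submodules whose successive quotients have rank one, isomorphic to $(K_l,a_j\sigma_{q_l})$ with $a_j\in K_l^*$; then $S(M)$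 is the set of the numbers $v_{z_l}(a_j)/l$, where $v_{z_l}$ is the $z_l$-adic valuation. A module is pure of slope $\mu$ if $S(M)=\{\mu\}$, and moderately irregular if it is a (finite) direct sum of pure modules; $DiffMod_{mi}(K,\sigma_q)$ is the full subcategory of moderately irregular modules. For $\mu\in\mathbb{Q}$, every $M$ has a largest submodule $F^{\ge\mu}(M)$ (resp. $F^{>\mu}(M)$) all of whose slopes are $\ge\mu$ (resp. $>\mu$), and every morphism $M\to N$ maps $F^{\ge\mu}(M)$ into $F^{\ge\mu}(N)$ and $F^{>\mu}(M)$ into $F^{>\mu}(N)$. Put $gr(M)=\bigoplus_{\mu\in\mathbb{Q}}F^{\ge\mu}(M)/F^{>\mu}(M)$, and for a morphism $f$ let $gr(f)$ be the induced morphism. Theorem. Each $gr(M)$ is moderately irregular, and $gr$ is a $\mathbb{C}$-linear exact functor from $DiffMod(K,\sigma_q)$ to its full subcategory $DiffMod_{mi}(K,\sigma_q)$ (it sends every exact sequence $M\to N\to P$ to an exact sequence). This functor is a retraction of the inclusion: its restriction to $DiffMod_{mi}(K,\sigma_q)$ is naturally isomorphic to the identity functor. -/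

import Mathlib

universe u

open CategoryTheory

noncomputable section

open Filter Topology LaurentSeries

/-- `g` has Laurent expansion `f` at `0`. -/
def IsLaurentExpansion (g : ℂ → ℂ) (f : ℂ⸨X⸩) : Prop :=
  ∀ᶠ z in 𝓝[≠] (0 : ℂ), HasSum (fun n : ℤ => f.coeff n * z ^ n) (g z)

namespace IsLaurentExpansion

theorem congr {g g' : ℂ → ℂ} {f : ℂ⸨X⸩} (h : IsLaurentExpansion g f)
    (hg : g =ᶠ[𝓝[≠] 0] g') : IsLaurentExpansion g' f := by
  filter_upwards [h, hg] with z h1 h2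
  rwa [← h2]

theorem add {g g' : ℂ → ℂ} {f f' : ℂ⸨X⸩} (h : IsLaurentExpansion g f)
    (h' : IsLaurentExpansion g' f') : IsLaurentExpansion (g + g') (f + f') := by
  filter_upwards [h, h'] with z h1 h2
  simpa [add_mul] using h1.add h2

theorem const (c : ℂ) : IsLaurentExpansion (fun _ => c) (algebraMap ℂ ℂ⸨X⸩ c) := by
  refine Eventually.of_forall fun z => ?_
  have : (fun n : ℤ => (algebraMap ℂ ℂ⸨X⸩ c).coeff n * z ^ n) =
      fun n : ℤ => if n = 0 then c else 0 := by
    funext n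
    by_cases hn : n = 0 <;> simp [HahnSeries.algebraMap_apply', hn]
  rw [this]
  exact hasSum_ite_eq 0 c

theorem mul {g g' : ℂ → ℂ} {f f' : ℂ⸨X⸩} (h : IsLaurentExpansion g f)
    (h' : IsLaurentExpansion g' f') : IsLaurentExpansion (g * g') (f * f') := by
  filter_upwards [h, h', self_mem_nhdsWithin] with z h1 h2 hz
  have hz : z ≠ 0 := hz
  set a : ℤ → ℂ := fun n => f.coeff n * z ^ n
  set b : ℤ → ℂ := fun n => f'.coeff n * z ^ n
  have hs : HasSum (fun x : ℤ × ℤ => a x.1 * b x.2) (g z * g' z) :=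
    h1.mul h2 (summable_mul_of_summable_norm h1.summable.norm h2.summable.norm)
  let e : ℤ × ℤ ≃ ℤ × ℤ :=
    { toFun := fun p => (p.2, p.1 - p.2)
      invFun := fun p => (p.1 + p.2, p.1)
      left_inv := fun p => by simp
      right_inv := fun p => by simp }
  have hs' : HasSum (fun p : ℤ × ℤ => a p.2 * b (p.1 - p.2)) (g z * g' z) :=
    (e.hasSum_iff (f := fun x : ℤ × ℤ => a x.1 * b x.2)).2 hs
  refine hs'.prod_fiberwise fun n => ?_
  rw [HahnSeries.coeff_mul, Finset.sum_mul]
  have key : ∑ ij ∈ Finset.antidiagonal f.isPWO_support f'.isPWO_support n,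
      f.coeff ij.1 * f'.coeff ij.2 * z ^ n
      = ∑ i ∈ (Finset.antidiagonal f.isPWO_support f'.isPWO_support n).image Prod.fst,
        a i * b (n - i) := by
    rw [Finset.sum_image]
    · refine Finset.sum_congr rfl fun ij hij => ?_
      have h3 := (Finset.mem_antidiagonal.1 hij).2.2
      have h4 : n - ij.1 = ij.2 := by omega
      simp only [a, b]
      rw [h4, ← h3, zpow_add₀ hz]
      ring
    · intro x hx y hy hxy
      have h3 := (Finset.mem_antidiagonal.1 hx).2.2
      have h4 := (Finset.mem_antidiagonal.1 hy).2.2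
      ext
      · exact hxy
      · have : x.1 = y.1 := hxy
        omega
  rw [key]
  refine hasSum_sum_of_ne_finset_zero fun i hi => ?_
  by_contra hne
  refine hi (Finset.mem_image.2 ⟨(i, n - i), Finset.mem_antidiagonal.2 ⟨?_, ?_, ?_⟩, rfl⟩)
  · intro h0
    exact hne (by simp [a, h0])
  · intro h0
    exact hne (by simp [b, h0])
  · simp

/-- Reindexing of a Laurent series by `ℕ`, starting at an exponent below the order. -/
theorem hasSum_shift {f : ℂ⸨X⸩} {N : ℤ} (hN : ∀ n < N, f.coeff n = 0) {z s : ℂ} (hz : z ≠ 0) :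
    HasSum (fun n : ℤ => f.coeff n * z ^ n) s ↔
      HasSum (fun k : ℕ => f.coeff (N + k) * z ^ k) (z ^ (-N) * s) := by
  have hinj : Function.Injective fun k : ℕ => N + (k : ℤ) := fun a b h => by
    have : N + (a : ℤ) = N + b := h
    omega
  rw [← hinj.hasSum_iff, ← hasSum_mul_left_iff (zpow_ne_zero (-N) hz)]
  · refine iff_of_eq ?_
    congr 1
    funext k
    simp only [Function.comp]
    rw [zpow_add₀ hz, zpow_neg, zpow_natCast]
    field_simp
  · intro n hn
    rw [hN, zero_mul]
    by_contra hlt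
    exact hn ⟨(n - N).toNat, by simp; omega⟩

theorem exists_of_meromorphicAt {g : ℂ → ℂ} (hg : MeromorphicAt g 0) :
    ∃ f : ℂ⸨X⸩, IsLaurentExpansion g f := by
  obtain ⟨N, h, hh, he⟩ := MeromorphicAt.iff_eventuallyEq_zpow_smul_analyticAt.1 hg
  obtain ⟨p, hp⟩ := hh
  let F : ℂ⸨X⸩ := HahnSeries.single N 1 * HahnSeries.ofPowerSeries ℤ ℂ (PowerSeries.mk p.coeff)
  have hc : ∀ k : ℕ, F.coeff (N + k) = p.coeff k := fun k => by
    simp only [F]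
    rw [add_comm, HahnSeries.coeff_single_mul_add, one_mul, HahnSeries.ofPowerSeries_apply_coeff,
      PowerSeries.coeff_mk]
  have hN : ∀ n < N, F.coeff n = 0 := fun n hn => by
    simp only [F]
    have h1 : n = (n - N) + N := by ring
    rw [h1, HahnSeries.coeff_single_mul_add, one_mul, HahnSeries.ofPowerSeries_apply]
    refine HahnSeries.embDomain_of_notMem_range ?_
    rintro ⟨k, hk⟩
    simp at hk
    omega
  refine ⟨F, ?_⟩
  have h0 : ∀ᶠ z in 𝓝[≠] (0 : ℂ), HasSum (fun n : ℕ => z ^ n • p.coeff n) (h (0 + z)) :=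
    (hasFPowerSeriesAt_iff.1 hp).filter_mono nhdsWithin_le_nhds
  filter_upwards [he, h0, self_mem_nhdsWithin] with z h1 h2 hz
  have hz : z ≠ 0 := hz
  rw [hasSum_shift hN hz, h1]
  simp only [hc]
  simp only [sub_zero, zero_add, smul_eq_mul] at h2 ⊢
  rw [← mul_assoc, ← zpow_add₀ hz, neg_add_cancel, zpow_zero, one_mul]
  simpa [mul_comm] using h2

/-- A Laurent series summable near `0` is `z ^ N` times a convergent power series. -/
theorem exists_hasFPowerSeriesAt {f : ℂ⸨X⸩}
    (hf : ∀ᶠ z in 𝓝[≠] (0 : ℂ), Summable fun n : ℤ => f.coeff n * z ^ n) :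
    ∃ h : ℂ → ℂ, HasFPowerSeriesAt h
      (FormalMultilinearSeries.ofScalars ℂ fun k : ℕ => f.coeff (f.order + k)) 0 ∧
      IsLaurentExpansion (fun z => z ^ f.order * h z) f := by
  set N := f.order
  have hN : ∀ n < N, f.coeff n = 0 := fun n hn => HahnSeries.coeff_eq_zero_of_lt_order hn
  set p := FormalMultilinearSeries.ofScalars ℂ fun k : ℕ => f.coeff (N + k) with hp
  have hcoeff : ∀ k, p.coeff k = f.coeff (N + k) := fun k => by
    rw [hp, FormalMultilinearSeries.coeff_ofScalars]
  obtain ⟨w, hw, hw0⟩ := (hf.and self_mem_nhdsWithin).exists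
  have hw0 : w ≠ 0 := hw0
  have hrad : 0 < p.radius := by
    obtain ⟨s, hs⟩ := hw
    have h1 := ((hasSum_shift hN hw0).1 hs).summable.norm
    refine lt_of_lt_of_le (b := (‖w‖₊ : ENNReal)) (by simpa using hw0)
      (p.le_radius_of_summable_norm ?_)
    refine h1.congr fun k => ?_
    rw [FormalMultilinearSeries.norm_apply_eq_norm_coef, hcoeff]
    simp
  have hps := p.hasFPowerSeriesOnBall hrad
  refine ⟨p.sum, hps.hasFPowerSeriesAt, ?_⟩
  have h0 := (hasFPowerSeriesAt_iff.1 hps.hasFPowerSeriesAt).filter_mono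
    (nhdsWithin_le_nhds (s := {0}ᶜ))
  filter_upwards [h0, self_mem_nhdsWithin] with z h2 hz
  have hz : z ≠ 0 := hz
  rw [hasSum_shift hN hz, ← mul_assoc, ← zpow_add₀ hz, neg_add_cancel, zpow_zero, one_mul]
  simpa [hcoeff, mul_comm] using h2

theorem summable {g : ℂ → ℂ} {f : ℂ⸨X⸩} (h : IsLaurentExpansion g f) :
    ∀ᶠ z in 𝓝[≠] (0 : ℂ), Summable fun n : ℤ => f.coeff n * z ^ n :=
  Eventually.mono h fun _ hz => hz.summable

theorem meromorphicAt {g : ℂ → ℂ} {f : ℂ⸨X⸩} (h : IsLaurentExpansion g f) :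
    MeromorphicAt g 0 := by
  obtain ⟨k, hk, he⟩ := exists_hasFPowerSeriesAt h.summable
  have h1 : MeromorphicAt (fun z => z ^ f.order * k z) 0 :=
    ((MeromorphicAt.id 0).zpow f.order).mul hk.analyticAt.meromorphicAt
  refine h1.congr ?_
  filter_upwards [he, h] with z h2 h3
  exact h2.unique h3

theorem eq_zero {f : ℂ⸨X⸩} (h : IsLaurentExpansion 0 f) : f = 0 := by
  obtain ⟨k, hk, he⟩ := exists_hasFPowerSeriesAt h.summable
  have h1 : ∀ᶠ z in 𝓝[≠] (0 : ℂ), k z = 0 := by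
    filter_upwards [he, h, self_mem_nhdsWithin] with z h2 h3 hz
    have hz : z ≠ 0 := hz
    simpa [hz, zpow_ne_zero] using h2.unique h3
  have h2 : ∀ᶠ z in 𝓝 (0 : ℂ), k z = 0 :=
    (hk.analyticAt.frequently_zero_iff_eventually_zero).1 h1.frequently
  have h3 := (hk.congr h2).eq_zero
  rw [FormalMultilinearSeries.ofScalars_series_eq_zero] at h3
  have h4 : f.coeff f.order = 0 := by simpa using congrFun h3 0
  by_contra hne
  exact HahnSeries.coeff_order_eq_zero.not.2 hne h4

theorem inv {g : ℂ → ℂ} {f : ℂ⸨X⸩} (h : IsLaurentExpansion g f) :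
    IsLaurentExpansion g⁻¹ f⁻¹ := by
  obtain ⟨f', hf'⟩ := exists_of_meromorphicAt h.meromorphicAt.inv
  rcases h.meromorphicAt.eventually_eq_zero_or_eventually_ne_zero with h0 | h0
  · have hf : f = 0 := eq_zero (h.congr h0)
    subst hf
    rw [inv_zero]
    refine Eventually.mono h0 fun z hz => ?_
    simp [hz, hasSum_zero]
  · have h1 : IsLaurentExpansion 0 (f * f' + algebraMap ℂ ℂ⸨X⸩ (-1)) := by
      refine ((h.mul hf').add (IsLaurentExpansion.const (-1))).congr ?_
      filter_upwards [h0] with z hz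
      simp [hz]
    have h2 := eq_zero h1
    rw [map_neg, map_one, ← sub_eq_add_neg, sub_eq_zero] at h2
    rwa [inv_eq_of_mul_eq_one_right h2]

end IsLaurentExpansion

/-- The field `ℂ({z})` of convergent Laurent series (germs at `0` of meromorphic functions). -/
def convergentField : IntermediateField ℂ ℂ⸨X⸩ where
  carrier := {f | ∃ g : ℂ → ℂ, IsLaurentExpansion g f}
  mul_mem' := fun ⟨g, hg⟩ ⟨g', hg'⟩ => ⟨g * g', hg.mul hg'⟩
  add_mem' := fun ⟨g, hg⟩ ⟨g', hg'⟩ => ⟨g + g', hg.add hg'⟩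
  algebraMap_mem' c := ⟨_, .const c⟩
  inv_mem' := fun _ ⟨g, hg⟩ => ⟨g⁻¹, hg.inv⟩

/-- The field `ℳ(ℂ)` of meromorphic functions on `ℂ`, embedded in `ℂ((z))` by Laurent expansion
at `0`. -/
def meromorphicField : IntermediateField ℂ ℂ⸨X⸩ where
  carrier := {f | ∃ g : ℂ → ℂ, (∀ z, MeromorphicAt g z) ∧ IsLaurentExpansion g f}
  mul_mem' := fun ⟨g, hm, hg⟩ ⟨g', hm', hg'⟩ => ⟨g * g', fun z => (hm z).mul (hm' z), hg.mul hg'⟩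
  add_mem' := fun ⟨g, hm, hg⟩ ⟨g', hm', hg'⟩ => ⟨g + g', fun z => (hm z).add (hm' z), hg.add hg'⟩
  algebraMap_mem' c := ⟨_, fun z => .const c z, .const c⟩
  inv_mem' := fun _ ⟨g, hm, hg⟩ => ⟨g⁻¹, fun z => (hm z).inv, hg.inv⟩

/-- The formal substitution `f(z) ↦ f(q z)`. -/
def dilationHom (q : ℂˣ) : ℂ⸨X⸩ →+* ℂ⸨X⸩ where
  toFun f := ⟨fun n => ((q ^ n : ℂˣ) : ℂ) * f.coeff n, f.isPWO_support.mono fun n hn => by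
    simp only [Function.mem_support] at hn
    exact right_ne_zero_of_mul hn⟩
  map_zero' := by ext; simp
  map_one' := by
    ext n
    by_cases hn : n = 0 <;> simp [hn, HahnSeries.coeff_one]
  map_add' f g := by ext; simp [mul_add]
  map_mul' f g := by
    ext n
    rw [HahnSeries.coeff_mul]
    simp only [HahnSeries.coeff_mul, Finset.mul_sum]
    have hs : ∀ f : ℂ⸨X⸩, ∀ h : (Function.support fun n : ℤ =>
        ((q ^ n : ℂˣ) : ℂ) * f.coeff n).IsPWO,
        (⟨fun n => ((q ^ n : ℂˣ) : ℂ) * f.coeff n, h⟩ : ℂ⸨X⸩).support = f.support := by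
      intro f h
      ext n
      simp [zpow_ne_zero n q.ne_zero]
    refine Finset.sum_congr ?_ ?_
    · ext ij
      simp only [Finset.mem_antidiagonal, hs]
    · intro ij hij
      have h3 := (Finset.mem_antidiagonal.1 hij).2.2
      rw [← h3, zpow_add]
      push_cast
      ring

@[simp]
theorem dilationHom_coeff (q : ℂˣ) (f : ℂ⸨X⸩) (n : ℤ) :
    (dilationHom q f).coeff n = ((q ^ n : ℂˣ) : ℂ) * f.coeff n := rfl

/-- The formal substitution `f(z) ↦ f(z ^ l)`. -/
def ramificationHom (l : ℕ+) : ℂ⸨X⸩ →+* ℂ⸨X⸩ :=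
  HahnSeries.embDomainRingHom (AddMonoidHom.mulLeft (l : ℤ))
    (fun a b h => by simpa using h) (fun a b => by simp)

theorem IsLaurentExpansion.dilation {g : ℂ → ℂ} {f : ℂ⸨X⸩} (h : IsLaurentExpansion g f) (q : ℂˣ) :
    IsLaurentExpansion (fun z => g (q * z)) (dilationHom q f) := by
  have ht : Tendsto (fun z : ℂ => (q : ℂ) * z) (𝓝[≠] 0) (𝓝[≠] 0) := by
    refine tendsto_nhdsWithin_iff.2 ⟨?_, ?_⟩
    · have : Tendsto (fun z : ℂ => (q : ℂ) * z) (𝓝 0) (𝓝 ((q : ℂ) * 0)) :=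
        (continuous_const.mul continuous_id).tendsto 0
      rw [mul_zero] at this
      exact this.mono_left nhdsWithin_le_nhds
    · filter_upwards [self_mem_nhdsWithin] with z hz
      exact mul_ne_zero q.ne_zero hz
  filter_upwards [ht.eventually h] with z hz
  refine hz.congr_fun ?_
  intro n
  simp [mul_zpow]
  ring

theorem IsLaurentExpansion.ramification {g : ℂ → ℂ} {f : ℂ⸨X⸩} (h : IsLaurentExpansion g f)
    (l : ℕ+) : IsLaurentExpansion (fun z => g (z ^ (l : ℕ))) (ramificationHom l f) := by
  have ht : Tendsto (fun z : ℂ => z ^ (l : ℕ)) (𝓝[≠] 0) (𝓝[≠] 0) := by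
    refine tendsto_nhdsWithin_iff.2 ⟨?_, ?_⟩
    · have : Tendsto (fun z : ℂ => z ^ (l : ℕ)) (𝓝 0) (𝓝 (0 ^ (l : ℕ))) :=
        (continuous_pow _).tendsto 0
      rw [zero_pow l.ne_zero] at this
      exact this.mono_left nhdsWithin_le_nhds
    · filter_upwards [self_mem_nhdsWithin] with z hz
      exact pow_ne_zero _ hz
  filter_upwards [ht.eventually h] with z hz
  have hinj : Function.Injective fun n : ℤ => (l : ℤ) * n := fun a b hab => by simpa using hab
  refine (hinj.hasSum_iff ?_).1 (hz.congr_fun ?_)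
  · intro n hn
    have : (ramificationHom l f).coeff n = 0 :=
      HahnSeries.embDomain_of_notMem_range hn
    rw [this, zero_mul]
  · intro n
    have : (ramificationHom l f).coeff ((l : ℤ) * n) = f.coeff n :=
      HahnSeries.embDomain_coeff (f := ⟨⟨fun n : ℤ => (l : ℤ) * n, hinj⟩, by simp⟩) (a := n)
    simp only [Function.comp, this]
    rw [zpow_mul, zpow_natCast]

/-- The three base fields of the theory. -/
inductive BaseField
  /-- `ℳ(ℂ)` -/
  | meromorphic
  /-- `ℂ({z})` -/
  | convergent
  /-- `ℂ((z))` -/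
  | formal

namespace BaseField

/-- `ℳ(ℂ) ⊆ ℂ({z}) ⊆ ℂ((z))`. -/
def field : BaseField → IntermediateField ℂ ℂ⸨X⸩
  | meromorphic => meromorphicField
  | convergent => convergentField
  | formal => ⊤

theorem dilation_mem (B : BaseField) (q : ℂˣ) {f : ℂ⸨X⸩} (hf : f ∈ B.field) :
    dilationHom q f ∈ B.field := by
  cases B with
  | meromorphic =>
    obtain ⟨g, hm, hg⟩ := hf
    refine ⟨_, fun z => ?_, hg.dilation q⟩
    exact (hm _).comp_analyticAt (analyticAt_const.mul analyticAt_id)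
  | convergent =>
    obtain ⟨g, hg⟩ := hf
    exact ⟨_, hg.dilation q⟩
  | formal => exact IntermediateField.mem_top

theorem ramification_mem (B : BaseField) (l : ℕ+) {f : ℂ⸨X⸩} (hf : f ∈ B.field) :
    ramificationHom l f ∈ B.field := by
  cases B with
  | meromorphic =>
    obtain ⟨g, hm, hg⟩ := hf
    refine ⟨_, fun z => ?_, hg.ramification l⟩
    exact (hm _).comp_analyticAt (analyticAt_id.pow _)
  | convergent =>
    obtain ⟨g, hg⟩ := hf
    exact ⟨_, hg.ramification l⟩
  | formal => exact IntermediateField.mem_top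

/-- The automorphism `σ_q : f(z) ↦ f(q z)` of the base field. -/
def sigma (B : BaseField) (q : ℂˣ) : B.field ≃ₐ[ℂ] B.field where
  toFun f := ⟨dilationHom q f, B.dilation_mem q f.2⟩
  invFun f := ⟨dilationHom q⁻¹ f, B.dilation_mem q⁻¹ f.2⟩
  left_inv f := by
    ext n
    simp [zpow_ne_zero n q.ne_zero]
  right_inv f := by
    ext n
    simp [zpow_ne_zero n q.ne_zero]
  map_mul' f g := Subtype.ext (map_mul (dilationHom q) _ _)
  map_add' f g := Subtype.ext (map_add (dilationHom q) _ _)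
  commutes' c := by
    ext n
    change (dilationHom q (algebraMap ℂ ℂ⸨X⸩ c)).coeff n = (algebraMap ℂ ℂ⸨X⸩ c).coeff n
    by_cases hn : n = 0 <;> simp [HahnSeries.algebraMap_apply', hn]

/-- The ramified extension `K_l` of `K`: the same field of series, in the variable `z_l` with
`z_l ^ l = z`. -/
def Ramified (B : BaseField) (_l : ℕ+) : Type := B.field

instance (B : BaseField) (l : ℕ+) : Field (B.Ramified l) := inferInstanceAs (Field B.field)

instance (B : BaseField) (l : ℕ+) : Algebra ℂ (B.Ramified l) :=
  inferInstanceAs (Algebra ℂ B.field)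

/-- The embedding `K → K_l`, `f(z) ↦ f(z_l ^ l)`. -/
instance (B : BaseField) (l : ℕ+) : Algebra B.field (B.Ramified l) :=
  RingHom.toAlgebra (S := B.Ramified l)
    (((ramificationHom l).comp B.field.val.toRingHom).codRestrict B.field
      fun f => B.ramification_mem l f.2)

/-- The `z_l`-adic valuation on `K_l` (with value `0` at `0`). -/
def Ramified.val {B : BaseField} {l : ℕ+} (a : B.Ramified l) : ℤ :=
  (show B.field from a : ℂ⸨X⸩).order

/-- The automorphism `f(z_l) ↦ f(r z_l)` of `K_l`. -/
def sigmaRamified (B : BaseField) (l : ℕ+) (r : ℂˣ) : B.Ramified l ≃ₐ[ℂ] B.Ramified l :=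
  B.sigma r

theorem sigmaRamified_algebraMap (B : BaseField) (l : ℕ+) {q r : ℂˣ} (h : r ^ (l : ℕ) = q)
    (a : B.field) :
    B.sigmaRamified l r (algebraMap B.field (B.Ramified l) a) =
      algebraMap B.field (B.Ramified l) (B.sigma q a) := by
  have hinj : Function.Injective fun n : ℤ => (l : ℤ) * n := fun a b hab => by simpa using hab
  refine Subtype.ext ?_
  change dilationHom r (ramificationHom l a) = ramificationHom l (dilationHom q a)
  ext n
  rw [dilationHom_coeff]
  by_cases hn : n ∈ Set.range fun n : ℤ => (l : ℤ) * n
  · obtain ⟨m, rfl⟩ := hn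
    have key : ∀ f : ℂ⸨X⸩, (ramificationHom l f).coeff ((l : ℤ) * m) = f.coeff m := fun f =>
      HahnSeries.embDomain_coeff (f := ⟨⟨fun n : ℤ => (l : ℤ) * n, hinj⟩, by simp⟩) (a := m)
    simp only [key, dilationHom_coeff]
    rw [zpow_mul, zpow_natCast, h]
  · have key : ∀ f : ℂ⸨X⸩, (ramificationHom l f).coeff n = 0 := fun f =>
      HahnSeries.embDomain_of_notMem_range hn
    rw [key, key, mul_zero]

end BaseField

/-- The compatible family `q_l = exp (-2 π i τ / l)` of roots of `q = q_1 = exp (-2 π i τ)`. -/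
def qRoot (τ : ℂ) (l : ℕ+) : ℂˣ :=
  Units.mk0 (Complex.exp (-2 * Real.pi * Complex.I * τ / l)) (Complex.exp_ne_zero _)

theorem qRoot_pow (τ : ℂ) (l : ℕ+) : qRoot τ l ^ (l : ℕ) = qRoot τ 1 := by
  have hl : ((l : ℕ) : ℂ) ≠ 0 := by exact_mod_cast l.ne_zero
  ext
  simp only [qRoot, Units.val_pow_eq_pow_val, Units.val_mk0]
  rw [← Complex.exp_nat_mul]
  congr 1
  simp
  field_simp

open TensorProduct DirectSum

/-- A `q`-difference module over `(K, σ)`: a finite-dimensional `K`-vector space with a `σ`-linear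
automorphism `Φ`. -/
structure DiffMod (K : Type) [Field K] [Algebra ℂ K] (σ : K ≃ₐ[ℂ] K) where
  carrier : Type u
  [addCommGroup : AddCommGroup carrier]
  [module : Module K carrier]
  [finite : FiniteDimensional K carrier]
  Φ : carrier ≃+ carrier
  Φ_smul : ∀ (a : K) (x : carrier), Φ (a • x) = σ a • Φ x

namespace DiffMod

attribute [instance] addCommGroup module finite

section twist

variable {K : Type} [Field K] (M : Type u) [AddCommGroup M] [Module K M] {K' : Type} [Field K']
  [Algebra K K'] (s : K' →+* K') (t : K →+* K) (φ : M →+ M)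

/-- The additive map `a ⊗ x ↦ s a ⊗ φ x` on `K' ⊗ M`, for `φ` semilinear over `t = s|_K`. -/
def twist (hφ : ∀ (a : K) (x : M), φ (a • x) = t a • φ x)
    (h : ∀ a, s (algebraMap K K' a) = algebraMap K K' (t a)) : K' ⊗[K] M →+ K' ⊗[K] M :=
  TensorProduct.liftAddHom
    (AddMonoidHom.mk' (fun a => ((TensorProduct.mk K K' M (s a)).toAddMonoidHom.comp φ))
      fun a b => by ext x; simp)
    fun r a x => by
      change s (r • a) ⊗ₜ[K] φ x = s a ⊗ₜ[K] φ (r • x)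
      rw [hφ, Algebra.smul_def, map_mul, h, ← Algebra.smul_def, TensorProduct.smul_tmul]

theorem twist_tmul (hφ : ∀ (a : K) (x : M), φ (a • x) = t a • φ x)
    (h : ∀ a, s (algebraMap K K' a) = algebraMap K K' (t a)) (a : K') (x : M) :
    twist M s t φ hφ h (a ⊗ₜ x) = s a ⊗ₜ φ x := rfl

theorem twist_smul (hφ : ∀ (a : K) (x : M), φ (a • x) = t a • φ x)
    (h : ∀ a, s (algebraMap K K' a) = algebraMap K K' (t a)) (a : K') (x : K' ⊗[K] M) :
    twist M s t φ hφ h (a • x) = s a • twist M s t φ hφ h x := by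
  induction x with
  | zero => simp
  | add x y hx hy => simp only [smul_add, map_add, hx, hy]
  | tmul b x => simp [twist_tmul, TensorProduct.smul_tmul']

end twist

section general

variable {K : Type} [Field K] [Algebra ℂ K] {σ : K ≃ₐ[ℂ] K}

instance : CoeSort (DiffMod.{u} K σ) (Type u) := ⟨carrier⟩

/-- Morphisms are the `K`-linear maps commuting with `Φ`. -/
@[ext]
structure Hom (M N : DiffMod.{u} K σ) where
  lin : M →ₗ[K] N
  comm : ∀ x, lin (M.Φ x) = N.Φ (lin x)

instance : Category (DiffMod.{u} K σ) where
  Hom := Hom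
  id M := ⟨LinearMap.id, fun _ => rfl⟩
  comp f g := ⟨g.lin ∘ₗ f.lin, fun x => by simp [f.comm, g.comm]⟩

@[ext]
theorem hom_ext {M N : DiffMod.{u} K σ} {f g : M ⟶ N} (h : Hom.lin f = Hom.lin g) : f = g :=
  Hom.ext h

@[simp] theorem id_lin (M : DiffMod.{u} K σ) : Hom.lin (𝟙 M) = LinearMap.id := rfl

@[simp] theorem comp_lin {M N P : DiffMod.{u} K σ} (f : M ⟶ N) (g : N ⟶ P) :
    Hom.lin (f ≫ g) = Hom.lin g ∘ₗ Hom.lin f := rfl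

variable {M N P : DiffMod.{u} K σ}

instance : Add (M ⟶ N) := ⟨fun f g => ⟨Hom.lin f + Hom.lin g, fun x => by
  simp [f.comm, g.comm]⟩⟩
instance : Zero (M ⟶ N) := ⟨⟨0, fun x => by simp⟩⟩
instance : Neg (M ⟶ N) := ⟨fun f => ⟨-Hom.lin f, fun x => by simp [f.comm]⟩⟩
instance : Sub (M ⟶ N) := ⟨fun f g => ⟨Hom.lin f - Hom.lin g, fun x => by
  simp [f.comm, g.comm]⟩⟩

/-- The constants `ℂ ⊆ K` are fixed by `σ`, so they act on morphisms. -/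
instance : SMul ℂ (M ⟶ N) := ⟨fun c f => ⟨algebraMap ℂ K c • Hom.lin f, fun x => by
  simp [f.comm, N.Φ_smul]⟩⟩
instance : SMul ℕ (M ⟶ N) := ⟨fun c f => ⟨c • Hom.lin f, fun x => by simp [f.comm]⟩⟩
instance : SMul ℤ (M ⟶ N) := ⟨fun c f => ⟨c • Hom.lin f, fun x => by simp [f.comm]⟩⟩

@[simp] theorem add_lin (f g : M ⟶ N) : Hom.lin (f + g) = Hom.lin f + Hom.lin g := rfl
@[simp] theorem zero_lin : Hom.lin (0 : M ⟶ N) = 0 := rfl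
@[simp] theorem smul_lin (c : ℂ) (f : M ⟶ N) :
    Hom.lin (c • f) = algebraMap ℂ K c • Hom.lin f := rfl

theorem lin_injective : Function.Injective (fun f : M ⟶ N => Hom.lin f) := fun _ _ h => hom_ext h

instance : AddCommGroup (M ⟶ N) :=
  lin_injective.addCommGroup _ rfl (fun _ _ => rfl) (fun _ => rfl) (fun _ _ => rfl)
    (fun _ _ => rfl) (fun _ _ => rfl)

instance : Module ℂ (M ⟶ N) where
  one_smul f := by ext; simp
  mul_smul a b f := by ext; simp [mul_smul]
  smul_zero a := by ext; simp
  smul_add a f g := by ext; simp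
  add_smul a b f := by ext; simp [add_smul]
  zero_smul f := by ext; simp

instance : Preadditive (DiffMod.{u} K σ) where
  add_comp _ _ _ f g h := by ext; simp
  comp_add _ _ _ f g h := by ext; simp

instance : Linear ℂ (DiffMod.{u} K σ) where
  homModule _ _ := inferInstance
  smul_comp _ _ _ c f g := by ext; simp
  comp_smul _ _ _ f c g := by ext; simp

/-- A subspace which is a submodule over `K⟨σ, σ⁻¹⟩`: stable under `Φ` and `Φ⁻¹`. -/
def IsStable (M : DiffMod.{u} K σ) (N : Submodule K M) : Prop :=
  ∀ x, M.Φ x ∈ N ↔ x ∈ N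

/-- The `q`-difference module structure on a stable subspace. -/
def sub (M : DiffMod.{u} K σ) (N : Submodule K M) (h : M.IsStable N) : DiffMod.{u} K σ where
  carrier := N
  Φ :=
    { toFun := fun x => ⟨M.Φ x, (h x).2 x.2⟩
      invFun := fun x => ⟨M.Φ.symm x, (h _).1 (by simp)⟩
      left_inv := fun x => by ext; simp
      right_inv := fun x => by ext; simp
      map_add' := fun x y => by ext; simp }
  Φ_smul a x := by ext; exact M.Φ_smul a x

/-- The `q`-difference module structure on the quotient by a stable subspace. -/
def quot (M : DiffMod.{u} K σ) (N : Submodule K M) (h : M.IsStable N) : DiffMod.{u} K σ where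
  carrier := M ⧸ N
  Φ :=
    { toFun := Quotient.map' M.Φ fun x y hxy => by
        rw [Submodule.quotientRel_def] at hxy ⊢
        rw [← map_sub]
        exact (h _).2 hxy
      invFun := Quotient.map' M.Φ.symm fun x y hxy => by
        rw [Submodule.quotientRel_def] at hxy ⊢
        refine (h _).1 ?_
        rwa [map_sub, AddEquiv.apply_symm_apply, AddEquiv.apply_symm_apply]
      left_inv := by
        rintro ⟨x⟩
        exact congrArg N.mkQ (M.Φ.symm_apply_apply x)
      right_inv := by
        rintro ⟨x⟩
        exact congrArg N.mkQ (M.Φ.apply_symm_apply x)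
      map_add' := by
        rintro ⟨x⟩ ⟨y⟩
        exact congrArg N.mkQ (map_add M.Φ x y) }
  Φ_smul a := by
    rintro ⟨x⟩
    exact congrArg N.mkQ (M.Φ_smul a x)

theorem quot_Φ_mk (M : DiffMod.{u} K σ) (N : Submodule K M) (h : M.IsStable N) (x : M) :
    (M.quot N h).Φ (N.mkQ x) = N.mkQ (M.Φ x) := rfl

/-- The direct sum of a family of `q`-difference modules, when it is finite-dimensional. -/
def directSum {ι : Type} (M : ι → DiffMod.{u} K σ) (h : FiniteDimensional K (⨁ i, M i)) :
    DiffMod.{u} K σ where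
  carrier := ⨁ i, M i
  finite := h
  Φ := DFinsupp.mapRange.addEquiv fun i => (M i).Φ
  Φ_smul a x := by
    refine DFinsupp.ext fun i => ?_
    exact (M i).Φ_smul a (x i)

/-- Extension of scalars along an extension `(K', σ')` of `(K, σ)`: `K' ⊗ M` with
`Φ (a ⊗ x) = σ' a ⊗ Φ x`. -/
def baseChange (M : DiffMod.{u} K σ) {K' : Type} [Field K'] [Algebra ℂ K'] [Algebra K K']
    {σ' : K' ≃ₐ[ℂ] K'} (h : ∀ a, σ' (algebraMap K K' a) = algebraMap K K' (σ a)) :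
    DiffMod.{u} K' σ' where
  carrier := K' ⊗[K] M
  Φ := AddMonoidHom.toAddEquiv
    (twist M σ'.toRingEquiv.toRingHom σ.toRingEquiv.toRingHom M.Φ.toAddMonoidHom M.Φ_smul h)
    (twist M σ'.symm.toRingEquiv.toRingHom σ.symm.toRingEquiv.toRingHom M.Φ.symm.toAddMonoidHom
      (fun a x => M.Φ.injective (by
        change M.Φ (M.Φ.symm (a • x)) = M.Φ (σ.symm a • M.Φ.symm x)
        simp [M.Φ_smul]))
      (fun a => σ'.injective (by
        change σ' (σ'.symm (algebraMap K K' a)) = σ' (algebraMap K K' (σ.symm a))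
        simp [h])))
    (by
      ext x
      induction x with
      | zero => simp
      | add x y hx hy => simpa using congrArg₂ (· + ·) hx hy
      | tmul a x => simp [twist_tmul])
    (by
      ext x
      induction x with
      | zero => simp
      | add x y hx hy => simpa using congrArg₂ (· + ·) hx hy
      | tmul a x => simp [twist_tmul])
  Φ_smul a x := twist_smul M σ'.toRingEquiv.toRingHom σ.toRingEquiv.toRingHom
    M.Φ.toAddMonoidHom M.Φ_smul h a x

theorem baseChange_Φ_tmul (M : DiffMod.{u} K σ) {K' : Type} [Field K'] [Algebra ℂ K']
    [Algebra K K'] {σ' : K' ≃ₐ[ℂ] K'}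
    (h : ∀ a, σ' (algebraMap K K' a) = algebraMap K K' (σ a)) (a : K') (x : M) :
    (M.baseChange h).Φ (a ⊗ₜ x : K' ⊗[K] M) = (σ' a ⊗ₜ M.Φ x : K' ⊗[K] M) := rfl

/-- The stable subspaces are closed under arbitrary sums. -/
theorem isStable_sSup (M : DiffMod.{u} K σ) {S : Set (Submodule K M)}
    (hS : ∀ N ∈ S, M.IsStable N) : M.IsStable (sSup S) := by
  have key : ∀ (ψ : M →+ M) (τ : K → K), (∀ (a : K) x, ψ (a • x) = τ a • ψ x) →
      (∀ N ∈ S, ∀ x ∈ N, ψ x ∈ N) → ∀ x ∈ sSup S, ψ x ∈ sSup S := by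
    intro ψ τ hψ hN x hx
    rw [sSup_eq_iSup'] at hx ⊢
    induction hx using Submodule.iSup_induction' with
    | mem i x hx => exact Submodule.mem_iSup_of_mem i (hN i i.2 x hx)
    | zero => simp
    | add x y _ _ h1 h2 => rw [map_add]; exact add_mem h1 h2
  intro x
  constructor
  · intro hx
    have := key M.Φ.symm.toAddMonoidHom σ.symm
      (fun a x => M.Φ.injective (by
        change M.Φ (M.Φ.symm (a • x)) = M.Φ (σ.symm a • M.Φ.symm x)
        simp [M.Φ_smul]))
      (fun N hN x hx => (hS N hN _).1 (by simpa using hx)) _ hx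
    simpa using this
  · exact key M.Φ.toAddMonoidHom σ M.Φ_smul (fun N hN x hx => (hS N hN _).2 hx) x

end general

section slopes

/-- `DiffMod(K, σ_q)`, for `K` one of the three base fields and `q = exp (-2 π i τ)`. -/
abbrev QDiffMod (B : BaseField) (τ : ℂ) := DiffMod.{u} B.field (B.sigma (qRoot τ 1))

variable {B : BaseField} {τ : ℂ}

/-- The module `M_l = K_l ⊗ M` over `(K_l, σ_{q_l})` obtained by ramification. -/
def ramify (M : QDiffMod.{u} B τ) (l : ℕ+) :
    DiffMod.{u} (B.Ramified l) (B.sigmaRamified l (qRoot τ l)) :=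
  M.baseChange (B.sigmaRamified_algebraMap l (qRoot_pow τ l))

/-- The set `S(M)` of slopes of `M`. After a ramification making `M` triangularisable, `M_l` has a
flag `M_j = span (b_0, …, b_j)` of submodules with rank one quotients on which
`Φ b_j ≡ a_j b_j`, i.e. the quotients are the modules `K_l⟨σ, σ⁻¹⟩ / (σ - a_j)`; the slopes of `M`
are the valuations of the `a_j`, divided by `l`. -/
def slopes (M : QDiffMod.{u} B τ) : Set ℚ :=
  {μ | ∃ (l : ℕ+) (n : ℕ) (b : Module.Basis (Fin n) (B.Ramified l) (M.ramify l)),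
    (∀ i j, j < i → b.repr ((M.ramify l).Φ (b j)) i = 0) ∧
      ∃ j, μ = ((b.repr ((M.ramify l).Φ (b j)) j).val : ℚ) / (l : ℕ)}

/-- `M` is pure of slope `μ`. -/
def IsPure (M : QDiffMod.{u} B τ) (μ : ℚ) : Prop := M.slopes = {μ}

/-- `M` is moderately irregular: a (finite) direct sum of pure submodules. -/
def IsModeratelyIrregular : ObjectProperty (QDiffMod.{u} B τ) := fun M =>
  ∃ (n : ℕ) (N : Fin n → Submodule B.field M), DirectSum.IsInternal N ∧
    ∀ i, ∃ (h : M.IsStable (N i)) (μ : ℚ), (M.sub (N i) h).IsPure μ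

/-- The submodules of `M` all of whose slopes are `≥ μ`. -/
def submodulesGE (M : QDiffMod.{u} B τ) (μ : ℚ) : Set (Submodule B.field M) :=
  {N | ∃ h : M.IsStable N, ∀ ν ∈ (M.sub N h).slopes, μ ≤ ν}

/-- The submodules of `M` all of whose slopes are `> μ`. -/
def submodulesGT (M : QDiffMod.{u} B τ) (μ : ℚ) : Set (Submodule B.field M) :=
  {N | ∃ h : M.IsStable N, ∀ ν ∈ (M.sub N h).slopes, μ < ν}

/-- `F^{≥ μ}(M)`, the largest submodule of `M` all of whose slopes are `≥ μ`. -/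
def filGE (M : QDiffMod.{u} B τ) (μ : ℚ) : Submodule B.field M := sSup (M.submodulesGE μ)

/-- `F^{> μ}(M)`, the largest submodule of `M` all of whose slopes are `> μ`. -/
def filGT (M : QDiffMod.{u} B τ) (μ : ℚ) : Submodule B.field M := sSup (M.submodulesGT μ)

theorem isStable_filGE (M : QDiffMod.{u} B τ) (μ : ℚ) : M.IsStable (M.filGE μ) :=
  M.isStable_sSup fun _ h => h.1

theorem isStable_filGT (M : QDiffMod.{u} B τ) (μ : ℚ) : M.IsStable (M.filGT μ) :=
  M.isStable_sSup fun _ h => h.1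

theorem filGT_le_filGE (M : QDiffMod.{u} B τ) (μ : ℚ) : M.filGT μ ≤ M.filGE μ :=
  sSup_le_sSup fun _ ⟨h, hN⟩ => ⟨h, fun ν hν => (hN ν hν).le⟩

theorem filGE_le_filGT (M : QDiffMod.{u} B τ) {μ ν : ℚ} (hμ : μ < ν) : M.filGE ν ≤ M.filGT μ :=
  sSup_le_sSup fun _ ⟨h, hN⟩ => ⟨h, fun κ hκ => hμ.trans_le (hN κ hκ)⟩

/-- The graded piece `M^{(μ)} = F^{≥ μ}(M) / F^{> μ}(M)`. -/
def grPiece (M : QDiffMod.{u} B τ) (μ : ℚ) : QDiffMod.{u} B τ :=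
  (M.sub (M.filGE μ) (M.isStable_filGE μ)).quot ((M.filGT μ).submoduleOf (M.filGE μ))
    fun x => M.isStable_filGT μ x.1

/-- The filtration has finitely many jumps. -/
theorem finite_jumps (M : QDiffMod.{u} B τ) : {μ : ℚ | M.filGT μ ≠ M.filGE μ}.Finite := by
  by_contra hinf
  obtain ⟨s, hs, hcard⟩ := Set.Infinite.exists_subset_card_eq hinf
    (Module.finrank B.field M + 1)
  have key : ∀ t : Finset ℚ, (∀ μ ∈ t, M.filGT μ ≠ M.filGE μ) →
      ∀ κ : ℚ, (∀ μ ∈ t, κ ≤ μ) → t.card ≤ Module.finrank B.field (M.filGE κ) := by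
    intro t
    induction t using Finset.induction_on_min with
    | empty => intros; simp
    | insert μ t hμ ih =>
      intro hj κ hκ
      have hnot : μ ∉ t := fun h => lt_irrefl _ (hμ μ h)
      rw [Finset.card_insert_of_notMem hnot]
      have h1 : t.card ≤ Module.finrank B.field (M.filGT μ) := by
        rcases t.eq_empty_or_nonempty with rfl | hne
        · simp
        · refine (ih (fun ν hν => hj ν (Finset.mem_insert_of_mem hν)) (t.min' hne)
            fun ν hν => t.min'_le ν hν).trans ?_
          exact Submodule.finrank_mono (M.filGE_le_filGT (hμ _ (t.min'_mem hne)))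
      have h2 : Module.finrank B.field (M.filGT μ) < Module.finrank B.field (M.filGE μ) :=
        Submodule.finrank_lt_finrank_of_lt
          ((M.filGT_le_filGE μ).lt_of_ne (hj μ (Finset.mem_insert_self _ _)))
      have h3 : M.filGE μ ≤ M.filGE κ := by
        rcases (hκ μ (Finset.mem_insert_self _ _)).eq_or_lt with rfl | h
        · exact le_rfl
        · exact (M.filGE_le_filGT h).trans (M.filGT_le_filGE κ)
      have := Submodule.finrank_mono h3
      omega
  obtain ⟨κ, hκ⟩ : ∃ κ : ℚ, ∀ μ ∈ s, κ ≤ μ := by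
    obtain ⟨κ, hκ⟩ := s.bddBelow
    exact ⟨κ, fun μ hμ => hκ hμ⟩
  have h1 := key s (fun μ hμ => hs hμ) κ hκ
  have h2 := Submodule.finrank_le (M.filGE κ)
  omega

theorem finite_gr (M : QDiffMod.{u} B τ) : FiniteDimensional B.field (⨁ μ : ℚ, M.grPiece μ) := by
  have : Finite {μ : ℚ | M.filGT μ ≠ M.filGE μ} := M.finite_jumps
  let φ : (⨁ μ : ℚ, M.grPiece μ) →ₗ[B.field]
      ((μ : {μ : ℚ | M.filGT μ ≠ M.filGE μ}) → M.grPiece μ) :=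
    LinearMap.pi fun μ => DirectSum.component B.field ℚ (fun μ => M.grPiece μ) μ
  refine Module.Finite.of_injective φ ?_
  rw [injective_iff_map_eq_zero]
  intro x hx
  refine DFinsupp.ext fun μ => ?_
  by_cases hμ : M.filGT μ = M.filGE μ
  · have : (M.filGT μ).submoduleOf (M.filGE μ) = ⊤ := by
      rw [hμ]; exact Submodule.submoduleOf_self _
    have hsub : Subsingleton (M.filGE μ ⧸ (M.filGT μ).submoduleOf (M.filGE μ)) :=
      Submodule.Quotient.subsingleton_iff.2 this
    exact hsub.elim _ _
  · exact congrFun hx ⟨μ, hμ⟩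

/-- The associated graded module `gr(M) = ⨁_μ M^{(μ)}`. -/
def gr (M : QDiffMod.{u} B τ) : QDiffMod.{u} B τ := directSum M.grPiece M.finite_gr

/-- All morphisms of `q`-difference modules respect the canonical filtrations. -/
def RespectsFiltration (B : BaseField) (τ : ℂ) : Prop :=
  ∀ (M N : QDiffMod.{u} B τ) (f : M ⟶ N) (μ : ℚ),
    (∀ x ∈ M.filGE μ, Hom.lin f x ∈ N.filGE μ) ∧ (∀ x ∈ M.filGT μ, Hom.lin f x ∈ N.filGT μ)

/-- The map `f^{(μ)} : M^{(μ)} → N^{(μ)}` induced by `f : M → N`. -/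
def grPieceMap (hF : RespectsFiltration.{u} B τ) {M N : QDiffMod.{u} B τ} (f : M ⟶ N) (μ : ℚ) :
    M.grPiece μ →ₗ[B.field] N.grPiece μ :=
  Submodule.mapQ ((M.filGT μ).submoduleOf (M.filGE μ)) ((N.filGT μ).submoduleOf (N.filGE μ))
    ((Hom.lin f).restrict (hF M N f μ).1) fun x hx => (hF M N f μ).2 x hx

/-- The functor `gr`, sending `f` to `⨁_μ f^{(μ)}`. -/
def grFunctor (hF : RespectsFiltration.{u} B τ) : QDiffMod.{u} B τ ⥤ QDiffMod.{u} B τ where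
  obj M := M.gr
  map {M N} f :=
    { lin := DirectSum.lmap fun μ => grPieceMap hF f μ
      comm := fun x => by
        refine DFinsupp.ext fun μ => ?_
        change DFinsupp (fun μ => M.grPiece μ) at x
        change grPieceMap hF f μ ((M.grPiece μ).Φ (x μ)) =
          (N.grPiece μ).Φ (grPieceMap hF f μ (x μ))
        obtain ⟨y, hy⟩ := Submodule.mkQ_surjective _ (x μ)
        rw [← hy]
        exact congrArg (Submodule.mkQ _) (Subtype.ext (f.comm y.1)) }
  map_id M := by
    ext x
    refine DFinsupp.ext fun μ => ?_
    change DFinsupp (fun μ => M.grPiece μ) at x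
    change grPieceMap hF (𝟙 M) μ (x μ) = x μ
    obtain ⟨y, hy⟩ := Submodule.mkQ_surjective _ (x μ)
    rw [← hy]
    rfl
  map_comp {M N P} f g := by
    ext x
    refine DFinsupp.ext fun μ => ?_
    change DFinsupp (fun μ => M.grPiece μ) at x
    change grPieceMap hF (f ≫ g) μ (x μ) = grPieceMap hF g μ (grPieceMap hF f μ (x μ))
    obtain ⟨y, hy⟩ := Submodule.mkQ_surjective _ (x μ)
    rw [← hy]
    rfl

end slopes

end DiffMod

end

/-! Slopes are rates of growth. Normalise the absolute value by |z| = 1/2, so that valuation `μ` has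
radius `rad μ` = 2^(-μ). Inside `M` consider the vectors with Φ^n x = O(2^(-nμ)) (`growthGE`) and
those with Φ^(-n) x = O(2^(nμ)) (`growthLE`). These are stable subspaces, defined without any choice
and preserved by morphisms; that one of them is everything can be tested after ramification. The
ultrametric inequality keeps polynomial factors out of successive extensions (`isBdd_of_quotient`,
`isBdd_of_eigenvector_mod`), so diagonal entries of a triangular matrix of Φ are read off from
growth: all slopes are ≥ μ exactly when `growthGE` at `μ` is the whole module (`le_slopes_iff`), and
F^{≥μ} is `growthGE` (`filGE_eq`). A vector of slopes both ≥ μ and ≤ ν < μ vanishes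
(`eq_zero_of_growth`). Functoriality of the filtration is then immediate.

The analytic input is that the greatest slope of a nonzero module is carried by a submodule. A
cyclic vector gives a scalar equation; its Newton polygon gives the greatest slope, and a right-hand
factor Φ - c z^k is found by solving a dual equation (`exists_formal_solution`). When c is the root
of least modulus of the characteristic polynomial of the relevant edge, |q| > 1 excludes resonances
and small divisors, so the solution converges; for meromorphic coefficients the equation itself
continues it to all of ℂ (`exists_meromorphic_continuation`). A fractional slope is handled over K
by replacing Φ with a power (`exists_eigenvector_iterate`), and over K_l by ramification, which also
yields triangularisability (`exists_triangular_basis`).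

Consequently M / F^{≥μ}(M), which has no part of slopes ≥ μ, has all slopes bounded by some ν < μ.
The same bound passes to any quotient of it, which makes surjections strict for the filtration
(`Hom.exists_mem_growthGE`). Strictness, applied once to N → N / ker g and once to M → ker g, gives
exactness of each graded piece (`grPieceMap_exact`).

For the retraction, let `slopePart` be the intersection of the two growth conditions at the same
`μ`. These parts are independent and functorial, and their sum is M exactly when M is moderately
irregular. Each maps injectively to the corresponding graded piece, and bijectively in the
moderately irregular case, which gives a natural isomorphism M ≅ gr(M) (`linGr`). -/

noncomputable section

open scoped NNReal

/-! ### Growth of orbits of semilinear maps over an ultrametric field. -/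

namespace Growth

variable {K K' : Type} [Field K] [Field K'] (v : Valuation K ℝ≥0) (v' : Valuation K' ℝ≥0)
  {M M' M'' : Type*} [AddCommGroup M] [Module K M] [AddCommGroup M'] [Module K' M']
  [AddCommGroup M''] [Module K M'']

/-- The sup norm on a finite-dimensional space, with respect to the standard basis. -/
def nrm [FiniteDimensional K M] (x : M) : ℝ≥0 :=
  Finset.univ.sup fun i => v ((Module.finBasis K M).repr x i)

/-- Additive maps which are semilinear over a map of fields preserving valuations. -/
structure IsSemi (f : M → M') : Prop where
  add : ∀ x y, f (x + y) = f x + f y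
  smul : ∃ τ : K → K', (∀ a, v' (τ a) = v a) ∧ ∀ a x, f (a • x) = τ a • f x

variable {v v'}

theorem IsSemi.sum {f : M → M'} (h : IsSemi v v' f) {ι : Type*} (s : Finset ι) (g : ι → M) :
    f (∑ i ∈ s, g i) = ∑ i ∈ s, f (g i) :=
  map_sum (AddMonoidHom.mk' f h.add) g s

theorem isSemi_linear (f : M →ₗ[K] M'') : IsSemi v v f :=
  ⟨map_add f, id, fun _ => rfl, fun a x => map_smul f a x⟩

theorem IsSemi.comp {L : Type} [Field L] {w : Valuation L ℝ≥0} {N : Type*} [AddCommGroup N]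
    [Module L N] {g : M' → N} {f : M → M'} (hg : IsSemi v' w g) (hf : IsSemi v v' f) :
    IsSemi v w (g ∘ f) := by
  obtain ⟨τ, hτ, hs⟩ := hf.smul
  obtain ⟨τ', hτ', hs'⟩ := hg.smul
  exact ⟨fun x y => by simp [hf.add, hg.add], τ' ∘ τ, fun a => by simp [hτ, hτ'],
    fun a x => by simp [hs, hs']⟩

theorem IsSemi.id : IsSemi v v (id : M → M) :=
  ⟨fun _ _ => rfl, _root_.id, fun _ => rfl, fun _ _ => rfl⟩

theorem IsSemi.zero {f : M → M'} (h : IsSemi v v' f) : f 0 = 0 := map_zero (AddMonoidHom.mk' f h.add)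

theorem IsSemi.sub {f : M → M'} (h : IsSemi v v' f) (x y : M) : f (x - y) = f x - f y :=
  map_sub (AddMonoidHom.mk' f h.add) x y

theorem IsSemi.iterate {ψ : M → M} (h : IsSemi v v ψ) (n : ℕ) : IsSemi v v ψ^[n] := by
  induction n with
  | zero => exact IsSemi.id
  | succ n ih => rw [Function.iterate_succ]; exact ih.comp h

theorem exists_forall_of_mono {ι : Type*} [Fintype ι] (P : ι → ℝ≥0 → Prop)
    (hP : ∀ i C C', C ≤ C' → P i C → P i C') (h : ∀ i, ∃ C, P i C) : ∃ C, ∀ i, P i C := by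
  choose C hC using h
  exact ⟨Finset.univ.sup C, fun i => hP i _ _ (Finset.le_sup (Finset.mem_univ i)) (hC i)⟩

section norm

variable [FiniteDimensional K M] [FiniteDimensional K' M'] [FiniteDimensional K M'']

theorem nrm_add_le (x y : M) : nrm v (x + y) ≤ max (nrm v x) (nrm v y) := by
  refine Finset.sup_le fun i _ => ?_
  rw [map_add, Finsupp.add_apply]
  refine (v.map_add _ _).trans (max_le_max ?_ ?_)
  · exact Finset.le_sup (f := fun i => v ((Module.finBasis K M).repr x i)) (Finset.mem_univ i)
  · exact Finset.le_sup (f := fun i => v ((Module.finBasis K M).repr y i)) (Finset.mem_univ i)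

theorem nrm_smul (a : K) (x : M) : nrm v (a • x) = v a * nrm v x := by
  simp [nrm, NNReal.mul_finset_sup]

@[simp] theorem nrm_zero : nrm v (0 : M) = 0 := by
  have := nrm_smul (v := v) (0 : K) (0 : M)
  simpa using this

theorem nrm_neg (x : M) : nrm v (-x) = nrm v x := by
  rw [← neg_one_smul K x, nrm_smul, Valuation.map_neg, map_one, one_mul]

theorem nrm_sub_le (x y : M) : nrm v (x - y) ≤ max (nrm v x) (nrm v y) := by
  rw [sub_eq_add_neg, ← nrm_neg (v := v) y]; exact nrm_add_le _ _

theorem eq_zero_of_nrm {x : M} (h : nrm v x = 0) : x = 0 := by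
  refine (Module.finBasis K M).repr.map_eq_zero_iff.1 (Finsupp.ext fun i => ?_)
  have : v ((Module.finBasis K M).repr x i) ≤ nrm v x :=
    Finset.le_sup (f := fun i => v ((Module.finBasis K M).repr x i)) (Finset.mem_univ i)
  rw [h] at this
  simpa using le_antisymm this zero_le

theorem nrm_sum_le {ι : Type*} (s : Finset ι) (f : ι → M) {C : ℝ≥0}
    (h : ∀ i ∈ s, nrm v (f i) ≤ C) : nrm v (∑ i ∈ s, f i) ≤ C := by
  classical
  induction s using Finset.induction_on with
  | empty => simp
  | insert a s ha ih =>
    rw [Finset.sum_insert ha]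
    exact (nrm_add_le _ _).trans (max_le (h _ (Finset.mem_insert_self _ _))
      (ih fun i hi => h i (Finset.mem_insert_of_mem hi)))

/-- The images of the basis vectors supply the constant. In particular the arbitrary basis chosen in
`nrm` does not influence which growth rates hold. -/
theorem IsSemi.bound {f : M → M'} (h : IsSemi v v' f) :
    ∃ C, ∀ x, nrm v' (f x) ≤ C * nrm v x := by
  obtain ⟨τ, hτ, hs⟩ := h.smul
  let b := Module.finBasis K M
  refine ⟨Finset.univ.sup fun i => nrm v' (f (b i)), fun x => ?_⟩
  conv_lhs => rw [← b.sum_repr x, h.sum]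
  refine nrm_sum_le _ _ fun i _ => ?_
  rw [hs, nrm_smul, hτ, mul_comm]
  exact mul_le_mul' (Finset.le_sup (f := fun i => nrm v' (f (b i))) (Finset.mem_univ i))
    (Finset.le_sup (f := fun i => v (b.repr x i)) (Finset.mem_univ i))

theorem functional_bound (f : M →ₗ[K] K) : ∃ C : ℝ≥0, ∀ x, v (f x) ≤ C * nrm v x := by
  let b := Module.finBasis K M
  refine ⟨Finset.univ.sup fun i => v (f (b i)), fun x => ?_⟩
  conv_lhs => rw [← b.sum_repr x, map_sum]
  refine v.map_sum_le fun i _ => ?_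
  rw [map_smul, smul_eq_mul, map_mul, mul_comm]
  exact mul_le_mul' (Finset.le_sup (f := fun i => v (f (b i))) (Finset.mem_univ i))
    (Finset.le_sup (f := fun i => v (b.repr x i)) (Finset.mem_univ i))

/-- The orbit of `x` under `ψ` grows at most like `ρ ^ n`. -/
def IsBdd (v : Valuation K ℝ≥0) (ψ : M → M) (ρ : ℝ≥0) (x : M) : Prop :=
  ∃ C, ∀ n : ℕ, nrm v (ψ^[n] x) ≤ C * ρ ^ n

theorem IsBdd.map {ψ : M → M} {ψ' : M' → M'} {f : M → M'} (hf : IsSemi v v' f)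
    (hc : ∀ x, f (ψ x) = ψ' (f x)) {ρ : ℝ≥0} {x : M} (h : IsBdd v ψ ρ x) : IsBdd v' ψ' ρ (f x) := by
  obtain ⟨C, hC⟩ := h
  obtain ⟨D, hD⟩ := hf.bound
  refine ⟨D * C, fun n => ?_⟩
  have : ψ'^[n] (f x) = f (ψ^[n] x) := ((Function.Semiconj.iterate_right (f := f) hc n) x).symm
  rw [this, mul_assoc]
  exact (hD _).trans (mul_le_mul_right (hC n) D)

/-- A linear left inverse of `f` need not commute with the dynamics; its boundedness suffices,
because it is applied only after the iteration. -/
theorem IsBdd.of_map {ψ : M → M} {ψ' : M'' → M''} (f : M →ₗ[K] M'') (hf : Function.Injective f)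
    (hc : ∀ x, f (ψ x) = ψ' (f x)) {ρ : ℝ≥0} {x : M} (h : IsBdd v ψ' ρ (f x)) : IsBdd v ψ ρ x := by
  obtain ⟨g, hg⟩ := f.exists_leftInverse_of_injective (LinearMap.ker_eq_bot.2 hf)
  obtain ⟨C, hC⟩ := h
  obtain ⟨D, hD⟩ := (isSemi_linear (v := v) g).bound
  refine ⟨D * C, fun n => ?_⟩
  have h1 : ψ'^[n] (f x) = f (ψ^[n] x) := ((Function.Semiconj.iterate_right (f := f) hc n) x).symm
  have h2 : ψ^[n] x = g (ψ'^[n] (f x)) := by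
    rw [h1]; exact (LinearMap.congr_fun hg _).symm
  rw [h2, mul_assoc]
  exact (hD _).trans (mul_le_mul_right (hC n) D)

theorem IsBdd.mono {ψ : M → M} {ρ ρ' : ℝ≥0} (hρ : ρ ≤ ρ') {x : M} (h : IsBdd v ψ ρ x) :
    IsBdd v ψ ρ' x := by
  obtain ⟨C, hC⟩ := h
  exact ⟨C, fun n => (hC n).trans (mul_le_mul_right (pow_le_pow_left' hρ n) C)⟩

/-- The subspace of vectors whose orbit grows at most like `ρ ^ n`. -/
def bdd {ψ : M → M} (h : IsSemi v v ψ) (ρ : ℝ≥0) : Submodule K M where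
  carrier := {x | IsBdd v ψ ρ x}
  zero_mem' := ⟨0, fun n => by rw [(h.iterate n).zero]; simp⟩
  add_mem' := by
    rintro x y ⟨C, hC⟩ ⟨D, hD⟩
    refine ⟨max C D, fun n => ?_⟩
    rw [(h.iterate n).add]
    refine (nrm_add_le _ _).trans (max_le ((hC n).trans ?_) ((hD n).trans ?_))
    · exact mul_le_mul_left (le_max_left _ _) _
    · exact mul_le_mul_left (le_max_right _ _) _
  smul_mem' := by
    rintro a x ⟨C, hC⟩
    refine ⟨v a * C, fun n => ?_⟩
    obtain ⟨τ, hτ, hs⟩ := (h.iterate n).smul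
    rw [hs, nrm_smul, hτ, mul_assoc]
    exact mul_le_mul_right (hC n) _

theorem IsBdd.apply {ψ : M → M} {ρ : ℝ≥0} {x : M} (h : IsBdd v ψ ρ x) :
    IsBdd v ψ ρ (ψ x) := by
  obtain ⟨C, hC⟩ := h
  refine ⟨C * ρ, fun n => ?_⟩
  rw [← Function.iterate_succ_apply]
  refine (hC (n + 1)).trans (le_of_eq ?_)
  ring

theorem IsBdd.of_iterate {ψ : M → M} {ρ : ℝ≥0} (hρ : ρ ≠ 0) {x : M} (k : ℕ)
    (h : IsBdd v ψ ρ (ψ^[k] x)) : IsBdd v ψ ρ x := by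
  induction k with
  | zero => exact h
  | succ k ih =>
    refine ih ?_
    obtain ⟨C, hC⟩ := h
    -- The quotient by `ρ` pays for the index shift; the second term covers index 0, which the
    -- shifted orbit misses.
    refine ⟨max (C / ρ) (nrm v (ψ^[k] x)), fun n => ?_⟩
    cases n with
    | zero => simp
    | succ n =>
      rw [Function.iterate_succ_apply, ← Function.iterate_succ_apply' ψ k]
      refine (hC n).trans ?_
      calc C * ρ ^ n = C / ρ * ρ ^ (n + 1) := by field_simp; ring
        _ ≤ _ := mul_le_mul_left (le_max_left _ _) _

/-- A uniform constant on a subspace of vectors of bounded growth. -/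
theorem uniform {ψ : M → M} (h : IsSemi v v ψ) {ρ : ℝ≥0} {N : Submodule K M} (hN : N ≤ bdd h ρ) :
    ∃ C, ∀ (n : ℕ), ∀ x ∈ N, nrm v (ψ^[n] x) ≤ C * ρ ^ n * nrm v x := by
  let b := Module.finBasis K N
  obtain ⟨p, hp⟩ := N.subtype.exists_leftInverse_of_injective N.ker_subtype
  obtain ⟨C, hC⟩ := exists_forall_of_mono (fun i C => ∀ n : ℕ, nrm v (ψ^[n] (b i)) ≤ C * ρ ^ n)
    (fun i C C' hCC' hi n => (hi n).trans (mul_le_mul_left hCC' _)) (fun i => hN (b i).2)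
  obtain ⟨D, hD⟩ := exists_forall_of_mono
    (fun i D => ∀ x : M, v ((b.coord i ∘ₗ p) x) ≤ D * nrm v x)
    (fun i C C' hCC' hi n => (hi n).trans (mul_le_mul_left hCC' _))
    (fun i => functional_bound (b.coord i ∘ₗ p))
  refine ⟨D * C, fun n x hx => ?_⟩
  -- The projection `p` extends the coordinates on `N` to bounded functionals on `M`, so they are
  -- controlled by the norm of `M`.
  have hpx : p x = ⟨x, hx⟩ := LinearMap.congr_fun hp ⟨x, hx⟩
  have hsum : ∑ i, (b.coord i ∘ₗ p) x • (b i : M) = x := by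
    have := congrArg N.subtype (b.sum_repr ⟨x, hx⟩)
    rw [map_sum] at this
    simpa [hpx] using this
  obtain ⟨τ, hτ, hs⟩ := (h.iterate n).smul
  conv_lhs => rw [← hsum, (h.iterate n).sum]
  refine nrm_sum_le _ _ fun i _ => ?_
  rw [hs, nrm_smul, hτ]
  calc _ ≤ (D * nrm v x) * (C * ρ ^ n) := mul_le_mul' (hD i x) (hC i n)
    _ = _ := by ring

/-- Vectors which grow at most like `ρ ^ n` modulo vectors which do so, do so themselves. -/
theorem isBdd_of_quotient {ψ : M → M} (h : IsSemi v v ψ) {ψ' : M'' → M''} (h' : IsSemi v v ψ')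
    (π : M →ₗ[K] M'') (hπ : Function.Surjective π) (hc : ∀ x, π (ψ x) = ψ' (π x)) {ρ : ℝ≥0}
    (hρ : ρ ≠ 0) (hker : LinearMap.ker π ≤ bdd h ρ) {x : M} (hx : IsBdd v ψ' ρ (π x)) :
    IsBdd v ψ ρ x := by
  obtain ⟨s, hs⟩ := π.exists_rightInverse_of_surjective (LinearMap.range_eq_top.2 hπ)
  have hs : ∀ y, π (s y) = y := fun y => LinearMap.congr_fun hs y
  obtain ⟨C₁, h₁⟩ := (h.comp (isSemi_linear (v := v) s)).bound
  obtain ⟨C₂, h₂⟩ := ((isSemi_linear (v := v) s).comp h').bound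
  obtain ⟨C₃, h₃⟩ := (isSemi_linear (v := v) s).bound
  obtain ⟨D, hD⟩ := hx
  obtain ⟨E, hE⟩ := uniform h hker
  -- The section `s` is linear but not equivariant. The defect `t` between the orbit of `x` and the
  -- lifted orbit lies in the kernel and satisfies t(n+1) = ψ(t n) + d n with `d n` of size at most
  -- ρ^n.
  let t : ℕ → M := fun n => ψ^[n] x - s (ψ'^[n] (π x))
  have hsemi : ∀ n, ψ'^[n] (π x) = π (ψ^[n] x) := fun n =>
    ((Function.Semiconj.iterate_right (f := π) hc n) x).symm
  have ht : ∀ n, t n ∈ LinearMap.ker π := fun n => by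
    simp [t, hs, hsemi]
  let d : ℕ → M := fun n => ψ (s (ψ'^[n] (π x))) - s (ψ' (ψ'^[n] (π x)))
  have hd : ∀ n, d n ∈ LinearMap.ker π := fun n => by
    simp [d, hs, hc]
  have htd : ∀ n, t (n + 1) = ψ (t n) + d n := fun n => by
    simp only [t, d, h.sub, Function.iterate_succ_apply']
    abel
  have hdn : ∀ n, nrm v (d n) ≤ max C₁ C₂ * D * ρ ^ n := fun n => by
    refine (nrm_sub_le _ _).trans (max_le ((h₁ _).trans ?_) ((h₂ _).trans ?_))
    · rw [mul_assoc]; exact mul_le_mul' (le_max_left _ _) (hD n)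
    · rw [mul_assoc]; exact mul_le_mul' (le_max_right _ _) (hD n)
  -- All future iterates of `t n` are bounded at once, with a constant free of `n`: each new `d n`
  -- enters through a maximum, not a sum. Only `k = 0` is used afterwards.
  have key : ∀ n k, nrm v (ψ^[k] (t n)) ≤
      max (E * nrm v (t 0)) (E * (max C₁ C₂ * D) / ρ) * ρ ^ (n + k) := by
    intro n
    induction n with
    | zero =>
      intro k
      refine (hE k _ (ht 0)).trans ?_
      rw [zero_add]
      calc E * ρ ^ k * nrm v (t 0) = E * nrm v (t 0) * ρ ^ k := by ring
        _ ≤ _ := mul_le_mul_left (le_max_left _ _) _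
    | succ n ih =>
      intro k
      rw [htd, (h.iterate k).add]
      refine (nrm_add_le _ _).trans (max_le ?_ ?_)
      · rw [← Function.iterate_succ_apply]
        refine (ih (k + 1)).trans (le_of_eq ?_)
        ring
      · refine (hE k _ (hd n)).trans ?_
        calc _ ≤ E * ρ ^ k * (max C₁ C₂ * D * ρ ^ n) := mul_le_mul_right (hdn n) _
          _ = E * (max C₁ C₂ * D) / ρ * ρ ^ (n + 1 + k) := by field_simp; ring
          _ ≤ _ := mul_le_mul_left (le_max_right _ _) _
  refine ⟨max (max (E * nrm v (t 0)) (E * (max C₁ C₂ * D) / ρ)) (C₃ * D), fun n => ?_⟩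
  have h4 : ψ^[n] x = t n + s (ψ'^[n] (π x)) := by simp [t]
  rw [h4]
  refine (nrm_add_le _ _).trans (max_le ?_ ?_)
  · exact (key n 0).trans (mul_le_mul_left (le_max_left _ _) _)
  · refine (h₃ _).trans ?_
    calc _ ≤ C₃ * (D * ρ ^ n) := mul_le_mul_right (hD n) _
      _ = C₃ * D * ρ ^ n := by ring
      _ ≤ _ := mul_le_mul_left (le_max_right _ _) _

/-- A nonzero vector cannot decay faster under `ψ` than it can grow under `ψ⁻¹`. -/
theorem eq_zero_of_isBdd {ψ χ : M → M} (hχ : IsSemi v v χ) (hinv : ∀ x, χ (ψ x) = x) {ρ ρ' : ℝ≥0} (hρ : ρ * ρ' < 1) (hρ' : ρ' ≠ 0) {x : M} (h : IsBdd v ψ ρ x)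
    (h' : IsBdd v χ ρ' x) : x = 0 := by
  obtain ⟨C, hC⟩ := h
  obtain ⟨D, hD⟩ := uniform hχ (le_refl (bdd hχ ρ'))
  -- Since x = χ^n(ψ^n x), the uniform constant for χ must be available at every point of the
  -- ψ-orbit; then the norm of `x` is O((ρρ')^n).
  have hmem : ∀ n, ψ^[n] x ∈ bdd hχ ρ' := fun n =>
    IsBdd.of_iterate hρ' n (by rwa [(show Function.LeftInverse χ ψ from hinv).iterate n])
  have key : ∀ n, nrm v x ≤ D * C * (ρ * ρ') ^ n := fun n => by
    have h1 := hD n _ (hmem n)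
    rw [(show Function.LeftInverse χ ψ from hinv).iterate n] at h1
    calc _ ≤ _ := h1
      _ ≤ D * ρ' ^ n * (C * ρ ^ n) := mul_le_mul_right (hC n) _
      _ = _ := by rw [mul_pow]; ring
  refine eq_zero_of_nrm (v := v) (le_antisymm ?_ zero_le)
  have hlim := (NNReal.tendsto_pow_atTop_nhds_zero_of_lt_one hρ).const_mul (D * C)
  rw [mul_zero] at hlim
  exact ge_of_tendsto' hlim key

/-- Growth under `ψ` can be measured on the iterates of `ψ^[s]`. -/
theorem isBdd_iterate {ψ : M → M} (h : IsSemi v v ψ) {ρ : ℝ≥0} (hρ : ρ ≠ 0) {s : ℕ} (hs : 0 < s)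
    {x : M} : IsBdd v ψ^[s] (ρ ^ s) x ↔ IsBdd v ψ ρ x := by
  constructor
  · rintro ⟨C, hC⟩
    obtain ⟨D, hD⟩ := exists_forall_of_mono
      (fun (i : Fin s) D => ∀ x : M, nrm v (ψ^[i] x) ≤ D * nrm v x)
      (fun i C C' hCC' hi n => (hi n).trans (mul_le_mul_left hCC' _))
      (fun i => (h.iterate i).bound)
    -- `ρ` may be less than 1, so the power of `ρ` belonging to the remainder modulo `s` is absorbed
    -- in the constant, remainder by remainder.
    obtain ⟨R, hR⟩ := exists_forall_of_mono (fun (i : Fin s) R => D * C ≤ R * ρ ^ (i : ℕ))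
      (fun i C C' hCC' hi => hi.trans (mul_le_mul_left hCC' _))
      (fun i => ⟨D * C / ρ ^ (i : ℕ), by field_simp; exact le_rfl⟩)
    refine ⟨R, fun n => ?_⟩
    have hn : n = n % s + s * (n / s) := (Nat.mod_add_div n s).symm
    rw [hn, Function.iterate_add_apply, Function.iterate_mul]
    calc _ ≤ D * nrm v ((ψ^[s])^[n / s] x) := hD ⟨n % s, Nat.mod_lt _ hs⟩ _
      _ ≤ D * (C * (ρ ^ s) ^ (n / s)) := mul_le_mul_right (hC _) _
      _ = D * C * (ρ ^ s) ^ (n / s) := by ring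
      _ ≤ R * ρ ^ (n % s) * (ρ ^ s) ^ (n / s) :=
        mul_le_mul_left (hR ⟨n % s, Nat.mod_lt _ hs⟩) _
      _ = _ := by rw [pow_add, pow_mul]; ring
  · rintro ⟨C, hC⟩
    refine ⟨C, fun n => ?_⟩
    rw [← Function.iterate_mul, ← pow_mul]
    exact hC _

end norm

end Growth

end

noncomputable section

open scoped NNReal

namespace Growth

/-! ### Growth rates and diagonal entries in a triangular basis. -/

section triangular

variable {K : Type} [Field K] {v : Valuation K ℝ≥0} {M : Type*} [AddCommGroup M] [Module K M] {ψ : M → M}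

theorem IsSemi.repr_apply {n : ℕ} (b : Module.Basis (Fin n) K M) (h : IsSemi v v ψ) : ∃ τ : K → K, (∀ a, v (τ a) = v a) ∧ τ 0 = 0 ∧
    ∀ x i, b.repr (ψ x) i = ∑ k, τ (b.repr x k) * b.repr (ψ (b k)) i := by
  obtain ⟨τ, hτ, hs⟩ := h.smul
  refine ⟨τ, hτ, ?_, fun x i => ?_⟩
  -- `τ` is a bare function; that it fixes 0 follows from its preserving the absolute value.
  · rw [← v.zero_iff, hτ, map_zero]
  · conv_lhs => rw [← b.sum_repr x, h.sum]
    simp [hs, Finsupp.finsetSum_apply]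

variable [FiniteDimensional K M]

/-- By induction ψ^n x is a multiple α x with |α| ≤ ρ^n plus a combination of iterates of `y`. The
ultrametric inequality bounds this combination by its largest term, so no factor `n` appears even
when |a| = ρ. -/
theorem isBdd_of_eigenvector_mod (h : IsSemi v v ψ) {ρ : ℝ≥0} (hρ : ρ ≠ 0) {x y : M} {a : K}
    (ha : v a ≤ ρ) (hxy : ψ x = a • x + y) (hy : IsBdd v ψ ρ y) : IsBdd v ψ ρ x := by
  obtain ⟨C, hC⟩ := hy
  have key : ∀ n : ℕ, ∃ (α : K) (t : M), ψ^[n] x = α • x + t ∧ v α ≤ ρ ^ n ∧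
      ∀ k, nrm v (ψ^[k] t) ≤ C / ρ * ρ ^ (n + k) := by
    intro n
    induction n with
    | zero => exact ⟨1, 0, by simp, by simp, fun k => by simp [(h.iterate k).zero]⟩
    | succ n ih =>
      obtain ⟨α, t, h1, h2, h3⟩ := ih
      obtain ⟨τ, hτ, hs⟩ := h.smul
      refine ⟨τ α * a, τ α • y + ψ t, ?_, ?_, fun k => ?_⟩
      · rw [Function.iterate_succ_apply', h1, h.add, hs, hxy, smul_add, mul_smul, add_assoc]
      · rw [map_mul, hτ, pow_succ]; exact mul_le_mul' h2 ha
      · obtain ⟨τk, hτk, hsk⟩ := (h.iterate k).smul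
        rw [(h.iterate k).add, hsk, ← Function.iterate_succ_apply]
        refine (nrm_add_le _ _).trans (max_le ?_ ((h3 (k + 1)).trans (le_of_eq (by ring))))
        rw [nrm_smul, hτk, hτ]
        calc _ ≤ ρ ^ n * (C * ρ ^ k) := mul_le_mul' h2 (hC k)
          _ = _ := by field_simp; ring
  refine ⟨max (nrm v x) (C / ρ), fun n => ?_⟩
  obtain ⟨α, t, h1, h2, h3⟩ := key n
  rw [h1]
  refine (nrm_add_le _ _).trans (max_le ?_ ?_)
  · rw [nrm_smul, mul_comm]
    exact mul_le_mul' (le_max_left _ _) h2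
  · exact (h3 0).trans (mul_le_mul_left (le_max_right _ _) _)

variable {n : ℕ} (b : Module.Basis (Fin n) K M)

theorem isBdd_of_triangular (h : IsSemi v v ψ) {ρ : ℝ≥0} (hρ : ρ ≠ 0)
    (ht : ∀ i j, j < i → b.repr (ψ (b j)) i = 0) (hd : ∀ j, v (b.repr (ψ (b j)) j) ≤ ρ) (x : M) :
    IsBdd v ψ ρ x := by
  have key : ∀ j, b j ∈ bdd h ρ := by
    intro j
    induction j using WellFoundedLT.induction with
    | ind j ih =>
      refine isBdd_of_eigenvector_mod h hρ (hd j)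
        (y := ∑ i ∈ Finset.univ.erase j, b.repr (ψ (b j)) i • b i) ?_ ?_
      · rw [Finset.add_sum_erase _ (fun i => b.repr (ψ (b j)) i • b i) (Finset.mem_univ j),
          b.sum_repr]
      · refine Submodule.sum_mem (bdd h ρ) fun i hi => ?_
        rcases lt_or_gt_of_ne (Finset.ne_of_mem_erase hi) with hij | hij
        · exact Submodule.smul_mem _ _ (ih i hij)
        · rw [ht i j hij, zero_smul]; exact Submodule.zero_mem _
  rw [← b.sum_repr x]
  exact Submodule.sum_mem (bdd h ρ) fun i _ => Submodule.smul_mem _ _ (key i)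

/-- By triangularity the `j`-th coordinate of ψ^m (b j) has absolute value exactly the `m`-th power
of that of the diagonal entry; if this exceeded `ρ`, the powers of the ratio would be unbounded. -/
theorem le_of_isBdd_triangular (h : IsSemi v v ψ) {ρ : ℝ≥0} (hρ : ρ ≠ 0)
    (ht : ∀ i j, j < i → b.repr (ψ (b j)) i = 0) {j : Fin n} (hj : IsBdd v ψ ρ (b j)) :
    v (b.repr (ψ (b j)) j) ≤ ρ := by
  obtain ⟨τ, hτ, hτ0, hrepr⟩ := h.repr_apply b
  have key : ∀ m, (∀ i, j < i → b.repr (ψ^[m] (b j)) i = 0) ∧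
      v (b.repr (ψ^[m] (b j)) j) = v (b.repr (ψ (b j)) j) ^ m := by
    intro m
    induction m with
    | zero => exact ⟨fun i hi => by simp [hi.ne], by simp⟩
    | succ m ih =>
      obtain ⟨h1, h2⟩ := ih
      rw [Function.iterate_succ_apply']
      refine ⟨fun i hi => ?_, ?_⟩
      · rw [hrepr]
        refine Finset.sum_eq_zero fun k _ => ?_
        rcases lt_or_ge j k with hk | hk
        · rw [h1 k hk, hτ0, zero_mul]
        · rw [ht i k (hk.trans_lt hi), mul_zero]
      · rw [hrepr, Finset.sum_eq_single j, map_mul, hτ, h2, pow_succ]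
        · intro k _ hkj
          rcases lt_or_gt_of_ne hkj with hk | hk
          · rw [ht j k hk, mul_zero]
          · rw [h1 k hk, hτ0, zero_mul]
        · simp
  obtain ⟨C, hC⟩ := hj
  obtain ⟨D, hD⟩ := functional_bound (v := v) (b.coord j)
  by_contra hlt
  rw [not_le] at hlt
  have h1 : ∀ m : ℕ, (v (b.repr (ψ (b j)) j) / ρ) ^ m ≤ D * C := fun m => by
    rw [div_pow, ← (key m).2, div_le_iff₀ (pow_pos (pos_iff_ne_zero.2 hρ) m), mul_assoc]
    exact (hD _).trans (mul_le_mul_right (hC m) D)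
  obtain ⟨m, hm⟩ := pow_unbounded_of_one_lt (D * C)
    ((one_lt_div (pos_iff_ne_zero.2 hρ)).2 hlt)
  exact absurd (h1 m) (not_le.2 hm)

end triangular

end Growth

/-! ### The inverse of a triangular automorphism. -/

namespace DiffMod

open Growth

variable {K : Type} [Field K] [Algebra ℂ K] {σ : K ≃ₐ[ℂ] K}

/-- In a triangular basis the diagonal coefficients are nonzero, and `Φ⁻¹` is triangular too. -/
theorem triangular_symm (M : DiffMod.{u} K σ) {n : ℕ} (b : Module.Basis (Fin n) K M)
    (ht : ∀ i j, j < i → b.repr (M.Φ (b j)) i = 0) :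
    (∀ i j, j < i → b.repr (M.Φ.symm (b j)) i = 0) ∧
      ∀ j, b.repr (M.Φ (b j)) j * σ (b.repr (M.Φ.symm (b j)) j) = 1 := by
  let A : Matrix (Fin n) (Fin n) K := fun i j => b.repr (M.Φ (b j)) i
  -- Twisting by `σ` turns the composition of semilinear maps into an ordinary matrix product, so
  -- triangularity of the inverse matrix can be quoted.
  let C : Matrix (Fin n) (Fin n) K := fun i j => σ (b.repr (M.Φ.symm (b j)) i)
  have hAC : A * C = 1 := by
    ext k j
    have h1 : b.repr (M.Φ (M.Φ.symm (b j))) k = (A * C) k j := by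
      conv_lhs => rw [← b.sum_repr (M.Φ.symm (b j)), map_sum]
      rw [Matrix.mul_apply, map_sum, Finsupp.finsetSum_apply]
      refine Finset.sum_congr rfl fun i _ => ?_
      rw [M.Φ_smul, map_smul, Finsupp.smul_apply, smul_eq_mul, mul_comm]
    rw [← h1, AddEquiv.apply_symm_apply, Matrix.one_apply, b.repr_self, Finsupp.single_apply]
    simp [eq_comm]
  have hA : A.BlockTriangular id := fun i j hij => ht i j hij
  have hdet : IsUnit A.det := by
    refine IsUnit.of_mul_eq_one C.det ?_
    rw [← Matrix.det_mul, hAC, Matrix.det_one]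
  have : Invertible A := A.invertibleOfIsUnitDet hdet
  have hC : C.BlockTriangular id := by
    rw [← Matrix.inv_eq_right_inv hAC]
    exact Matrix.blockTriangular_inv_of_blockTriangular hA
  refine ⟨fun i j hij => ?_, fun j => ?_⟩
  · have := hC hij
    simpa [C] using this
  · have h1 : (A * C) j j = 1 := by rw [hAC, Matrix.one_apply_eq]
    rw [Matrix.mul_apply, Finset.sum_eq_single j] at h1
    · exact h1
    · intro k _ hk
      rcases lt_or_gt_of_ne hk with hk | hk
      · rw [hA hk, zero_mul]
      · rw [hC hk, mul_zero]
    · simp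

end DiffMod

end

/-! ### Absolute values on the base fields and their ramifications. -/

noncomputable section

open scoped NNReal

/-- The radius `2 ^ (-μ)`: the absolute value of an element of valuation `μ`. -/
def rad (μ : ℚ) : ℝ≥0 := (2 : ℝ≥0) ^ (-(μ : ℝ))

theorem rad_ne_zero (μ : ℚ) : rad μ ≠ 0 := (NNReal.rpow_pos (by norm_num)).ne'

theorem rad_add (μ ν : ℚ) : rad (μ + ν) = rad μ * rad ν := by
  rw [rad, rad, rad, ← NNReal.rpow_add (by norm_num)]
  congr 1; push_cast; ring

@[simp] theorem rad_zero : rad 0 = 1 := by simp [rad]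

theorem rad_neg (μ : ℚ) : rad (-μ) = (rad μ)⁻¹ := by
  refine eq_inv_of_mul_eq_one_left ?_
  rw [← rad_add, neg_add_cancel, rad_zero]

theorem rad_le_rad {μ ν : ℚ} : rad μ ≤ rad ν ↔ ν ≤ μ := by
  rw [rad, rad, ← NNReal.coe_le_coe, NNReal.coe_rpow, NNReal.coe_rpow,
    Real.rpow_le_rpow_left_iff (by norm_num), neg_le_neg_iff, Rat.cast_le]

theorem rad_lt_one {μ : ℚ} (h : 0 < μ) : rad μ < 1 := by
  rw [← rad_zero, ← not_le, rad_le_rad, not_le]; exact h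

theorem rad_mul_nat (μ : ℚ) (n : ℕ) : rad (n * μ) = rad μ ^ n := by
  induction n with
  | zero => simp
  | succ n ih => rw [pow_succ, ← ih, ← rad_add]; congr 1; push_cast; ring

open LaurentSeries

theorem HahnSeries.order_eq_of_coeff {f : ℂ⸨X⸩} {N : ℤ} (h : f.coeff N ≠ 0)
    (h' : ∀ n < N, f.coeff n = 0) : f.order = N := by
  refine le_antisymm (HahnSeries.order_le_of_coeff_ne_zero h) ?_
  by_contra hlt
  rw [not_le] at hlt
  have hf : f ≠ 0 := by rintro rfl; simp at h
  exact HahnSeries.coeff_order_eq_zero.not.2 hf (h' _ hlt)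

open scoped Classical in
/-- The `z`-adic absolute value on Laurent series, normalised so that `z ^ l` has radius
`2 ^ (-1)`. -/
def seriesVal (l : ℕ+) : Valuation ℂ⸨X⸩ ℝ≥0 where
  toFun f := if f = 0 then 0 else rad (f.order / (l : ℕ))
  map_zero' := by simp
  map_one' := by simp
  map_mul' f g := by
    by_cases hf : f = 0
    · simp [hf]
    by_cases hg : g = 0
    · simp [hg]
    rw [if_neg hf, if_neg hg, if_neg (mul_ne_zero hf hg), HahnSeries.order_mul hf hg, ← rad_add]
    congr 1; push_cast; ring
  map_add_le_max' f g := by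
    by_cases hf : f = 0
    · simp [hf]
    by_cases hg : g = 0
    · simp [hg]
    by_cases hfg : f + g = 0
    · simp [hfg]
    rw [if_neg hf, if_neg hg, if_neg hfg, le_max_iff, rad_le_rad, rad_le_rad]
    have hl : (0 : ℚ) < (l : ℕ) := by exact_mod_cast l.pos
    rw [div_le_div_iff_of_pos_right hl, div_le_div_iff_of_pos_right hl]
    have := HahnSeries.min_order_le_order_add hfg
    rw [min_le_iff] at this
    exact_mod_cast this

theorem seriesVal_apply (l : ℕ+) {f : ℂ⸨X⸩} (hf : f ≠ 0) :
    seriesVal l f = rad (f.order / (l : ℕ)) := if_neg hf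

theorem dilationHom_order (q : ℂˣ) (f : ℂ⸨X⸩) : (dilationHom q f).order = f.order := by
  by_cases hf : f = 0
  · simp [hf]
  refine HahnSeries.order_eq_of_coeff ?_ fun n hn => ?_
  · rw [dilationHom_coeff]
    exact mul_ne_zero (Units.ne_zero _) (HahnSeries.coeff_order_eq_zero.not.2 hf)
  · rw [dilationHom_coeff, HahnSeries.coeff_eq_zero_of_lt_order hn, mul_zero]

theorem ramificationHom_coeff_mul (l : ℕ+) (f : ℂ⸨X⸩) (m : ℤ) :
    (ramificationHom l f).coeff ((l : ℤ) * m) = f.coeff m := by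
  have hinj : Function.Injective fun n : ℤ => (l : ℤ) * n := fun a b hab => by simpa using hab
  exact HahnSeries.embDomain_coeff (f := ⟨⟨fun n : ℤ => (l : ℤ) * n, hinj⟩, by simp⟩) (a := m)

theorem ramificationHom_coeff_of_not_dvd (l : ℕ+) (f : ℂ⸨X⸩) {n : ℤ} (hn : ¬ (l : ℤ) ∣ n) :
    (ramificationHom l f).coeff n = 0 := by
  refine HahnSeries.embDomain_of_notMem_range ?_
  rintro ⟨m, rfl⟩
  exact hn ⟨m, rfl⟩

theorem ramificationHom_order (l : ℕ+) {f : ℂ⸨X⸩} (hf : f ≠ 0) :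
    (ramificationHom l f).order = l * f.order := by
  refine HahnSeries.order_eq_of_coeff ?_ fun n hn => ?_
  · rw [ramificationHom_coeff_mul]
    exact HahnSeries.coeff_order_eq_zero.not.2 hf
  · by_cases hd : (l : ℤ) ∣ n
    · obtain ⟨m, rfl⟩ := hd
      rw [ramificationHom_coeff_mul]
      refine HahnSeries.coeff_eq_zero_of_lt_order (lt_of_mul_lt_mul_left hn ?_)
      positivity
    · exact ramificationHom_coeff_of_not_dvd l f hd

/-- An automorphism preserving an absolute value. -/
class IsometricAut {K : Type} [Field K] [Algebra ℂ K] (v : Valuation K ℝ≥0) (σ : K ≃ₐ[ℂ] K) :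
    Prop where
  map_eq : ∀ a, v (σ a) = v a

namespace BaseField

/-- The absolute value on `K`. -/
def absVal (B : BaseField) : Valuation B.field ℝ≥0 := (seriesVal 1).comap B.field.val.toRingHom

/-- The absolute value on `K_l` extending that of `K`. -/
def absValRamified (B : BaseField) (l : ℕ+) : Valuation (B.Ramified l) ℝ≥0 :=
  Valuation.comap (S := B.Ramified l) (R := ℂ⸨X⸩) B.field.val.toRingHom (seriesVal l)

theorem absVal_apply (B : BaseField) {a : B.field} (ha : a ≠ 0) :
    B.absVal a = rad ((a : ℂ⸨X⸩).order) := by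
  have h : (a : ℂ⸨X⸩) ≠ 0 := fun h => ha (Subtype.ext h)
  have := seriesVal_apply 1 h
  rw [PNat.one_coe, Nat.cast_one, div_one] at this
  exact this

theorem absValRamified_apply (B : BaseField) (l : ℕ+) {a : B.Ramified l} (ha : a ≠ 0) :
    B.absValRamified l a = rad (a.val / (l : ℕ)) :=
  seriesVal_apply l (f := (show B.field from a : ℂ⸨X⸩)) fun h => ha (Subtype.ext h)

instance (B : BaseField) (q : ℂˣ) : IsometricAut B.absVal (B.sigma q) where
  map_eq a := by
    by_cases ha : a = 0
    · simp [ha]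
    rw [absVal_apply B ha, absVal_apply B ((map_ne_zero _).2 ha)]
    congr 2
    exact dilationHom_order q a

instance (B : BaseField) (l : ℕ+) (q : ℂˣ) :
    IsometricAut (B.absValRamified l) (B.sigmaRamified l q) where
  map_eq a := by
    by_cases ha : a = 0
    · simp [ha]
    rw [absValRamified_apply B l ha, absValRamified_apply B l ((map_ne_zero _).2 ha)]
    congr 3
    exact dilationHom_order q _

/-- Ramification multiplies orders by `l`, and the normalisation of the absolute value on K_l
divides by `l`. This is what makes growth comparable before and after ramification. -/
theorem absValRamified_algebraMap (B : BaseField) (l : ℕ+) (a : B.field) :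
    B.absValRamified l (algebraMap B.field (B.Ramified l) a) = B.absVal a := by
  by_cases ha : a = 0
  · simp [ha]
  rw [absVal_apply B ha, absValRamified_apply B l ((map_ne_zero _).2 ha)]
  have h : (a : ℂ⸨X⸩) ≠ 0 := fun h => ha (Subtype.ext h)
  congr 1
  have h1 : (algebraMap B.field (B.Ramified l) a).val = l * (a : ℂ⸨X⸩).order :=
    ramificationHom_order l h
  rw [h1]
  have hl : ((l : ℕ) : ℚ) ≠ 0 := by exact_mod_cast l.ne_zero
  push_cast
  field_simp

end BaseField

namespace DiffMod

open Growth

/-! ### The two growth filtrations of a difference module. -/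

section filtration

variable {K : Type} [Field K] [Algebra ℂ K] {σ : K ≃ₐ[ℂ] K} (v : Valuation K ℝ≥0)
  [hv : IsometricAut v σ]

theorem Φ_symm_smul (M : DiffMod.{u} K σ) (a : K) (x : M) :
    M.Φ.symm (a • x) = σ.symm a • M.Φ.symm x :=
  M.Φ.injective (by simp [M.Φ_smul])

theorem isSemi_Φ (M : DiffMod.{u} K σ) : IsSemi v v M.Φ :=
  ⟨map_add _, σ, hv.map_eq, M.Φ_smul⟩

theorem isSemi_Φ_symm (M : DiffMod.{u} K σ) : IsSemi v v M.Φ.symm :=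
  ⟨map_add _, σ.symm, fun a => by rw [← hv.map_eq, AlgEquiv.apply_symm_apply], M.Φ_symm_smul⟩

/-- The part of `M` where `Φ` has slopes `≥ μ`, in terms of growth. -/
def growthGE (M : DiffMod.{u} K σ) (μ : ℚ) : Submodule K M := bdd (M.isSemi_Φ v) (rad μ)

/-- The part of `M` where `Φ` has slopes `≤ μ`, in terms of growth. -/
def growthLE (M : DiffMod.{u} K σ) (μ : ℚ) : Submodule K M := bdd (M.isSemi_Φ_symm v) (rad (-μ))

variable {v} {M N : DiffMod.{u} K σ} {μ ν : ℚ}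

theorem mem_growthLE {x : M} : x ∈ M.growthLE v μ ↔ IsBdd v M.Φ.symm (rad (-μ)) x := Iff.rfl

theorem isStable_growthGE (M : DiffMod.{u} K σ) (μ : ℚ) : M.IsStable (M.growthGE v μ) :=
  fun _ => ⟨fun h => IsBdd.of_iterate (rad_ne_zero _) 1 h, fun h => IsBdd.apply h⟩

theorem isStable_growthLE (M : DiffMod.{u} K σ) (μ : ℚ) : M.IsStable (M.growthLE v μ) :=
  fun x => ⟨fun h => by rw [← M.Φ.symm_apply_apply x]; exact IsBdd.apply h,
    fun h => IsBdd.of_iterate (rad_ne_zero _) 1 (by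
      rw [Function.iterate_one, AddEquiv.symm_apply_apply]; exact h)⟩

theorem growthGE_anti (M : DiffMod.{u} K σ) (h : μ ≤ ν) : M.growthGE v ν ≤ M.growthGE v μ :=
  fun _ hx => IsBdd.mono (rad_le_rad.2 h) hx

theorem growthLE_mono (M : DiffMod.{u} K σ) (h : μ ≤ ν) : M.growthLE v μ ≤ M.growthLE v ν :=
  fun _ hx => IsBdd.mono (rad_le_rad.2 (neg_le_neg h)) hx

theorem Hom.comm_symm (f : M ⟶ N) (x : M) : Hom.lin f (M.Φ.symm x) = N.Φ.symm (Hom.lin f x) :=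
  N.Φ.injective (by rw [← f.comm]; simp)

theorem Hom.map_growthGE (f : M ⟶ N) {x : M} (hx : x ∈ M.growthGE v μ) :
    Hom.lin f x ∈ N.growthGE v μ :=
  IsBdd.map (isSemi_linear _) f.comm hx

theorem Hom.map_growthLE (f : M ⟶ N) {x : M} (hx : x ∈ M.growthLE v μ) :
    Hom.lin f x ∈ N.growthLE v μ :=
  IsBdd.map (isSemi_linear _) (Hom.comm_symm f) hx

theorem Hom.mem_growthGE_of_injective (f : M ⟶ N) (hf : Function.Injective (Hom.lin f)) {x : M}
    (hx : Hom.lin f x ∈ N.growthGE v μ) : x ∈ M.growthGE v μ :=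
  IsBdd.of_map _ hf f.comm hx

theorem Hom.mem_growthLE_of_injective (f : M ⟶ N) (hf : Function.Injective (Hom.lin f)) {x : M}
    (hx : Hom.lin f x ∈ N.growthLE v μ) : x ∈ M.growthLE v μ :=
  IsBdd.of_map _ hf (Hom.comm_symm f) hx

theorem Hom.mem_growthGE_of_ker_le (f : M ⟶ N) (hf : Function.Surjective (Hom.lin f))
    (hker : LinearMap.ker (Hom.lin f) ≤ M.growthGE v μ) {x : M}
    (hx : Hom.lin f x ∈ N.growthGE v μ) : x ∈ M.growthGE v μ :=
  isBdd_of_quotient (M.isSemi_Φ v) (N.isSemi_Φ v) _ hf f.comm (rad_ne_zero _) hker hx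

/-- The product of the two rates is `rad (μ - ν)`, which is less than 1. All separation of slopes
below rests on this. -/
theorem eq_zero_of_growth {x : M} (h : x ∈ M.growthGE v μ) (h' : x ∈ M.growthLE v ν)
    (hν : ν < μ) : x = 0 := by
  refine eq_zero_of_isBdd (M.isSemi_Φ_symm v) M.Φ.symm_apply_apply (ρ := rad μ) (ρ' := rad (-ν))
    ?_ (rad_ne_zero _) h h'
  rw [← rad_add]
  exact rad_lt_one (by linarith)

/-- The inclusion of a stable subspace. -/
def subHom (M : DiffMod.{u} K σ) (N : Submodule K M) (h : M.IsStable N) : M.sub N h ⟶ M :=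
  ⟨N.subtype, fun _ => rfl⟩

/-- The projection to the quotient by a stable subspace. -/
def quotHom (M : DiffMod.{u} K σ) (N : Submodule K M) (h : M.IsStable N) : M ⟶ M.quot N h :=
  ⟨N.mkQ, fun _ => rfl⟩

theorem mem_growthGE_sub (N : Submodule K M) (h : M.IsStable N) (x : N) :
    (x : M.sub N h) ∈ (M.sub N h).growthGE v μ ↔ x.1 ∈ M.growthGE v μ :=
  ⟨fun hx => Hom.map_growthGE (M.subHom N h) hx,
    fun hx => Hom.mem_growthGE_of_injective (M.subHom N h) N.subtype_injective hx⟩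

theorem mem_growthLE_sub (N : Submodule K M) (h : M.IsStable N) (x : N) :
    (x : M.sub N h) ∈ (M.sub N h).growthLE v μ ↔ x.1 ∈ M.growthLE v μ :=
  ⟨fun hx => Hom.map_growthLE (M.subHom N h) hx,
    fun hx => Hom.mem_growthLE_of_injective (M.subHom N h) N.subtype_injective hx⟩

/-- The quotient by the part of slopes `≥ μ` has no part of slopes `≥ μ`. -/
theorem growthGE_quot (M : DiffMod.{u} K σ) (μ : ℚ) :
    (M.quot _ (M.isStable_growthGE (v := v) μ)).growthGE v μ = ⊥ := by
  rw [Submodule.eq_bot_iff]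
  intro y hy
  obtain ⟨x, rfl⟩ := (M.growthGE v μ).mkQ_surjective y
  have := Hom.mem_growthGE_of_ker_le (M.quotHom _ (M.isStable_growthGE (v := v) μ))
    (Submodule.mkQ_surjective _) (Submodule.ker_mkQ _).le (x := x) hy
  exact (Submodule.Quotient.mk_eq_zero _).2 this

end filtration

end DiffMod

end

noncomputable section

open Filter Topology LaurentSeries

/-! ### Triangular recursions and a majorant for their solutions. -/

section recursion

/-- The solution with `W 0 = 1` of the recursion `∑ γ N a * W b = 0`, sum over `a + b = N`. -/
def recSolution (γ : ℕ → ℕ → ℂ) : ℕ → ℂ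
  | N => if N = 0 then 1 else -(γ N 0)⁻¹ * ∑ j : Fin N, γ N (N - j) * recSolution γ j
  decreasing_by exact j.2

theorem recSolution_zero (γ : ℕ → ℕ → ℂ) : recSolution γ 0 = 1 := by
  rw [recSolution, if_pos rfl]

theorem recSolution_of_ne_zero (γ : ℕ → ℕ → ℂ) {N : ℕ} (hN : N ≠ 0) :
    recSolution γ N = -(γ N 0)⁻¹ * ∑ j ∈ Finset.range N, γ N (N - j) * recSolution γ j := by
  rw [recSolution, if_neg hN, Finset.sum_range]

theorem recSolution_spec (γ : ℕ → ℕ → ℂ) (h0 : γ 0 0 = 0) (h : ∀ N, N ≠ 0 → γ N 0 ≠ 0) (N : ℕ) :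
    ∑ ab ∈ Finset.HasAntidiagonal.antidiagonal N, γ N ab.1 * recSolution γ ab.2 = 0 := by
  rw [← Finset.Nat.sum_antidiagonal_swap]
  simp only [Prod.fst_swap, Prod.snd_swap]
  rw [Finset.Nat.sum_antidiagonal_eq_sum_range_succ (fun j a => γ N a * recSolution γ j),
    Finset.sum_range_succ, Nat.sub_self]
  rcases eq_or_ne N 0 with rfl | hN
  · simp [h0]
  · have h1 := recSolution_of_ne_zero γ hN
    rw [h1]
    have := h N hN
    field_simp
    ring

/-- The ratio R(1 + DA) is chosen so that the induction closes: the geometric sum of the (1 + DA)^j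
over j < N, multiplied by DA, is (1 + DA)^N - 1. -/
theorem recSolution_bound (γ : ℕ → ℕ → ℂ) {A D R : ℝ} (hA : 0 ≤ A) (hD : 0 ≤ D) (hR : 0 ≤ R)
    (h0 : ∀ N, ‖(γ N 0)⁻¹‖ ≤ D) (h : ∀ N a, ‖γ N a‖ ≤ A * R ^ a) (N : ℕ) :
    ‖recSolution γ N‖ ≤ (R * (1 + D * A)) ^ N := by
  induction N using Nat.strong_induction_on with
  | _ N ih =>
    rcases eq_or_ne N 0 with rfl | hN
    · simp [recSolution_zero]
    rw [recSolution_of_ne_zero γ hN, norm_mul, norm_neg]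
    calc _ ≤ D * ∑ j ∈ Finset.range N, A * R ^ (N - j) * (R * (1 + D * A)) ^ j := by
          refine mul_le_mul (h0 N) ((norm_sum_le _ _).trans (Finset.sum_le_sum fun j hj => ?_))
            (norm_nonneg _) hD
          rw [norm_mul]
          exact mul_le_mul (h N _) (ih j (Finset.mem_range.1 hj)) (norm_nonneg _) (by positivity)
      _ = R ^ N * ((∑ j ∈ Finset.range N, (1 + D * A) ^ j) * (D * A)) := by
          rw [Finset.mul_sum, Finset.sum_mul, Finset.mul_sum]
          refine Finset.sum_congr rfl fun j hj => ?_
          have : N = (N - j) + j := by have := Finset.mem_range.1 hj; omega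
          conv_rhs => rw [this, pow_add]
          rw [mul_pow]; ring
      _ ≤ R ^ N * (1 + D * A) ^ N := by
          refine mul_le_mul_of_nonneg_left ?_ (by positivity)
          have := geom_sum_mul (1 + D * A) N
          rw [add_sub_cancel_left] at this
          rw [this]; linarith
      _ = _ := (mul_pow _ _ _).symm

/-- A vanishing term is harmless because its inverse is 0 by convention; the application has such a
term at index 0. -/
theorem exists_norm_inv_le {u : ℕ → ℂ} {L : ℂ} (hL : L ≠ 0) (h : Tendsto u atTop (𝓝 L)) :
    ∃ D, 0 ≤ D ∧ ∀ N, ‖(u N)⁻¹‖ ≤ D := by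
  obtain ⟨D, hD⟩ := (Metric.isBounded_range_of_tendsto _ (h.inv₀ hL)).exists_norm_le
  exact ⟨D, (norm_nonneg _).trans (hD _ ⟨0, rfl⟩), fun N => hD _ ⟨N, rfl⟩⟩

end recursion

/-! ### Convergence in terms of bounds on coefficients. -/

section convergence

theorem exists_bound_of_mem_convergentField {f : ℂ⸨X⸩} (hf : f ∈ convergentField) :
    ∃ A R : ℝ, 0 ≤ A ∧ 0 < R ∧ ∀ n : ℤ, ‖f.coeff n‖ ≤ A * R ^ n := by
  obtain ⟨g, hg⟩ := hf
  obtain ⟨w, hw, hw0⟩ := (hg.summable.and self_mem_nhdsWithin).exists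
  have hw0 : w ≠ 0 := hw0
  obtain ⟨A, hA⟩ := (hw.norm.tendsto_cofinite_zero.bddAbove_range_of_cofinite)
  refine ⟨A, ‖w‖⁻¹, (norm_nonneg _).trans (hA ⟨0, rfl⟩), by positivity, fun n => ?_⟩
  have h1 : ‖f.coeff n * w ^ n‖ ≤ A := hA ⟨n, rfl⟩
  rw [norm_mul, norm_zpow] at h1
  rw [inv_zpow, ← div_eq_mul_inv, le_div_iff₀ (zpow_pos (norm_pos_iff.2 hw0) n)]
  exact h1

theorem mem_convergentField_of_bound {f : ℂ⸨X⸩} (h0 : ∀ n < 0, f.coeff n = 0) {R : ℝ} (hR : 0 ≤ R)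
    (h : ∀ n : ℕ, ‖f.coeff n‖ ≤ R ^ n) : f ∈ convergentField := by
  refine ⟨fun z => ∑' n : ℤ, f.coeff n * z ^ n, ?_⟩
  have h1 : ∀ᶠ z in 𝓝[≠] (0 : ℂ), R * ‖z‖ < 1 := by
    have : Tendsto (fun z : ℂ => R * ‖z‖) (𝓝 0) (𝓝 (R * ‖(0 : ℂ)‖)) :=
      (continuous_const.mul continuous_norm).tendsto 0
    rw [norm_zero, mul_zero] at this
    exact (this.mono_left nhdsWithin_le_nhds).eventually_lt_const one_pos
  filter_upwards [h1, self_mem_nhdsWithin] with z hz hz0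
  have hz0 : z ≠ 0 := hz0
  have h2 : Summable fun n : ℕ => f.coeff (0 + n) * z ^ n := by
    refine Summable.of_norm_bounded (g := fun n => (R * ‖z‖) ^ n)
      (summable_geometric_of_lt_one (by positivity) hz) fun n => ?_
    rw [zero_add, norm_mul, norm_pow, mul_pow]
    exact mul_le_mul_of_nonneg_right (h n) (by positivity)
  obtain ⟨s, hs⟩ := h2
  have h3 := (IsLaurentExpansion.hasSum_shift (f := f) (N := 0) h0 hz0 (s := s)).2
    (by simpa using hs)
  exact h3.summable.hasSum

theorem meromorphicField_le : meromorphicField ≤ convergentField :=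
  fun _ ⟨g, _, hg⟩ => ⟨g, hg⟩

end convergence

/-! ### Formal and convergent solutions along an edge of the Newton polygon. -/

section formal

theorem ofPowerSeries_coeff_neg (W : PowerSeries ℂ) {n : ℤ} (hn : n < 0) :
    (HahnSeries.ofPowerSeries ℤ ℂ W).coeff n = 0 := by
  rw [HahnSeries.ofPowerSeries_apply]
  refine HahnSeries.embDomain_of_notMem_range ?_
  rintro ⟨k, hk⟩
  simp at hk
  omega

theorem eq_single_mul_ofPowerSeries {f : ℂ⸨X⸩} {a : ℤ} (h : ∀ n < a, f.coeff n = 0) :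
    f = HahnSeries.single a 1 *
      HahnSeries.ofPowerSeries ℤ ℂ (PowerSeries.mk fun j => f.coeff (a + j)) := by
  ext n
  obtain ⟨d, rfl⟩ : ∃ d, n = d + a := ⟨n - a, by ring⟩
  rw [HahnSeries.coeff_single_mul_add, one_mul]
  rcases lt_or_ge d 0 with hd | hd
  · rw [ofPowerSeries_coeff_neg _ hd, h _ (by omega)]
  · obtain ⟨j, rfl⟩ := Int.eq_ofNat_of_zero_le hd
    rw [HahnSeries.ofPowerSeries_apply_coeff, PowerSeries.coeff_mk, add_comm]

theorem coeff_mul_ofPowerSeries {f : ℂ⸨X⸩} {a : ℤ} (h : ∀ n < a, f.coeff n = 0)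
    (W : PowerSeries ℂ) (N : ℕ) : (f * HahnSeries.ofPowerSeries ℤ ℂ W).coeff (N + a) =
      ∑ ij ∈ Finset.HasAntidiagonal.antidiagonal N, f.coeff (a + (ij.1 : ℕ)) * PowerSeries.coeff ij.2 W := by
  conv_lhs => rw [eq_single_mul_ofPowerSeries h, mul_assoc, ← map_mul]
  rw [HahnSeries.coeff_single_mul_add, one_mul, HahnSeries.ofPowerSeries_apply_coeff,
    PowerSeries.coeff_mul]
  simp

theorem coeff_mul_ofPowerSeries_neg {f : ℂ⸨X⸩} {a : ℤ} (h : ∀ n < a, f.coeff n = 0)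
    (W : PowerSeries ℂ) {n : ℤ} (hn : n < 0) :
    (f * HahnSeries.ofPowerSeries ℤ ℂ W).coeff (n + a) = 0 := by
  rw [eq_single_mul_ofPowerSeries h, mul_assoc, ← map_mul, HahnSeries.coeff_single_mul_add,
    ofPowerSeries_coeff_neg _ hn, mul_zero]

/-- The operator `f ↦ σ⁻¹ (c z ^ k f)`. -/
def monomialTwist (r : ℂˣ) (c : ℂ) (k : ℤ) (f : ℂ⸨X⸩) : ℂ⸨X⸩ :=
  dilationHom r⁻¹ (HahnSeries.single k c * f)

/-- The successive dilations act at exponents n, n - k, …, n - (i-1)k; the sum of these shifts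
produces the binomial coefficient. -/
theorem monomialTwist_iterate_coeff (r : ℂˣ) (c : ℂ) (k : ℤ) (f : ℂ⸨X⸩) (i : ℕ) (n : ℤ) :
    ((monomialTwist r c k)^[i] f).coeff n =
      c ^ i * (r : ℂ) ^ (-(i * n) + k * (i.choose 2 : ℕ)) * f.coeff (n - i * k) := by
  induction i generalizing n with
  | zero => simp
  | succ i ih =>
    have h1 : (HahnSeries.single k c * (monomialTwist r c k)^[i] f).coeff n =
        c * ((monomialTwist r c k)^[i] f).coeff (n - k) := by
      conv_lhs => rw [← sub_add_cancel n k]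
      rw [HahnSeries.coeff_single_mul_add]
    rw [Function.iterate_succ_apply']
    conv_lhs => rw [monomialTwist, dilationHom_coeff, h1, ih]
    have hc : (i + 1).choose 2 = i + i.choose 2 := by
      rw [Nat.choose_succ_succ' i 1, Nat.choose_one_right]
    have h2 : (-(((i + 1 : ℕ) : ℤ) * n) + k * ((i + 1).choose 2 : ℕ)) =
        -n + (-(i * (n - k)) + k * (i.choose 2 : ℕ)) := by
      rw [hc]; push_cast; ring
    have h4 : (r : ℂ) ^ (-(((i + 1 : ℕ) : ℤ) * n) + k * ((i + 1).choose 2 : ℕ)) =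
        (r : ℂ) ^ (-n) * (r : ℂ) ^ (-(i * (n - k)) + k * (i.choose 2 : ℕ)) := by
      rw [h2, zpow_add₀ r.ne_zero]
    rw [h4, pow_succ]
    have h3 : n - k - i * k = n - ((i + 1 : ℕ) : ℤ) * k := by push_cast; ring
    rw [h3]
    simp only [inv_zpow', Units.val_zpow_eq_zpow_val]
    ring

open Polynomial in
/-- A polynomial with nonzero constant coefficient has a root of least absolute value. -/
theorem exists_minimal_root {Q : ℂ[X]} (h0 : Q.coeff 0 ≠ 0) {i : ℕ} (hi : i ≠ 0)
    (hQi : Q.coeff i ≠ 0) : ∃ c : ℂ, c ≠ 0 ∧ Q.eval c = 0 ∧ ∀ x, ‖x‖ < ‖c‖ → Q.eval x ≠ 0 := by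
  have hQ : Q ≠ 0 := by rintro rfl; simp at h0
  have hdeg : Q.degree ≠ 0 := by
    intro h
    rw [Polynomial.eq_C_of_degree_eq_zero h, Polynomial.coeff_C, if_neg hi] at hQi
    exact hQi rfl
  obtain ⟨x, hx⟩ := IsAlgClosed.exists_root Q hdeg
  obtain ⟨c, hc, hmin⟩ := Q.roots.toFinset.exists_min_image (fun x => ‖x‖)
    ⟨x, by simpa [hQ] using hx⟩
  have hc : Q.eval c = 0 := by simpa [hQ] using hc
  refine ⟨c, ?_, hc, fun y hy hy0 => ?_⟩
  · rintro rfl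
    rw [← Polynomial.coeff_zero_eq_eval_zero] at hc
    exact h0 hc
  · exact absurd (hmin y (by simpa [hQ] using hy0)) (not_le.2 hy)

/-- The hypotheses on `k` describe an edge of the Newton polygon issuing from the vertex of `p 0`. A
power series `w` with constant term 1 is determined coefficient by coefficient, once `c` is a
suitable root of the characteristic polynomial of that edge. -/
theorem exists_formal_solution (r : ℂˣ) (hr : 1 < ‖(r : ℂ)‖) (m : ℕ) (p : ℕ → ℂ⸨X⸩) (k : ℤ)
    (hp0 : p 0 ≠ 0)
    (hk : ∀ i ≤ m, p i ≠ 0 → (p 0).order ≤ k * i + (p i).order)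
    (hex : ∃ i ≤ m, i ≠ 0 ∧ p i ≠ 0 ∧ (p 0).order = k * i + (p i).order) :
    ∃ c : ℂ, c ≠ 0 ∧ ∃ w : ℂ⸨X⸩, w ≠ 0 ∧
      ∑ i ∈ Finset.range (m + 1), (monomialTwist r c k)^[i] (p i * w) = 0 ∧
      ((∀ i, p i ∈ convergentField) → w ∈ convergentField) := by
  set v₀ := (p 0).order with hv₀
  have hsupp : ∀ i ∈ Finset.range (m + 1), ∀ n < v₀ - i * k, (p i).coeff n = 0 := by
    intro i hi n hn
    by_cases hpi : p i = 0
    · simp [hpi]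
    · refine HahnSeries.coeff_eq_zero_of_lt_order (hn.trans_le ?_)
      have := hk i (Nat.lt_succ_iff.1 (Finset.mem_range.1 hi)) hpi
      linarith
  let e : ℕ → ℂ := fun i => (r : ℂ) ^ (-(i * v₀) + k * (i.choose 2 : ℕ))
  -- The value of `Q` at `c` is the coefficient of z^v₀, the lowest one possible, in the equation
  -- for w = 1 + ⋯. The vertex `p 0` and the other point of the edge make it nonconstant with
  -- nonzero constant term.
  let Q : Polynomial ℂ := ∑ i ∈ Finset.range (m + 1),
    Polynomial.monomial i (e i * (p i).coeff (v₀ - i * k))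
  have hQc : ∀ i ≤ m, Q.coeff i = e i * (p i).coeff (v₀ - i * k) := by
    intro i hi
    simp only [Q, Polynomial.finsetSum_coeff, Polynomial.coeff_monomial]
    rw [Finset.sum_ite_eq' , if_pos (Finset.mem_range.2 (Nat.lt_succ_of_le hi))]
  have he : ∀ i, e i ≠ 0 := fun i => zpow_ne_zero _ r.ne_zero
  have hQ0 : Q.coeff 0 ≠ 0 := by
    rw [hQc 0 (Nat.zero_le _)]
    refine mul_ne_zero (he 0) ?_
    simpa [hv₀] using hp0
  obtain ⟨i₀, hi₀, hi₀0, hpi₀, hord⟩ := hex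
  have hQi : Q.coeff i₀ ≠ 0 := by
    rw [hQc i₀ hi₀]
    refine mul_ne_zero (he _) ?_
    have : v₀ - i₀ * k = (p i₀).order := by linarith
    rw [this]
    exact HahnSeries.coeff_order_eq_zero.not.2 hpi₀
  obtain ⟨c, hc0, hc, hmin⟩ := exists_minimal_root hQ0 hi₀0 hQi
  -- `γ N a` is the factor of the (N - a)-th coefficient of `w` in the coefficient of z^(N + v₀) of
  -- the equation.
  let γ : ℕ → ℕ → ℂ := fun N a => ∑ i ∈ Finset.range (m + 1),
    c ^ i * (r : ℂ) ^ (-(i * (N + v₀)) + k * (i.choose 2 : ℕ)) *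
      (p i).coeff (v₀ - i * k + (a : ℕ))
  have hγ0 : ∀ N, γ N 0 = Q.eval (c * ((r : ℂ)⁻¹) ^ N) := by
    intro N
    simp only [γ, Q, Polynomial.eval_finsetSum, Polynomial.eval_monomial, e]
    refine Finset.sum_congr rfl fun i _ => ?_
    have : (-((i : ℤ) * (N + v₀)) + k * (i.choose 2 : ℕ)) =
      (-(i * v₀) + k * (i.choose 2 : ℕ)) + -((N * i : ℕ) : ℤ) := by push_cast; ring
    rw [this, zpow_add₀ r.ne_zero, zpow_neg _ ((N * i : ℕ) : ℤ), zpow_natCast, mul_pow, ← pow_mul,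
      inv_pow]
    simp
    ring
  have hrinv : ‖((r : ℂ)⁻¹)‖ < 1 := by
    rw [norm_inv]; exact inv_lt_one_of_one_lt₀ hr
  have h00 : γ 0 0 = 0 := by rw [hγ0]; simpa using hc
  -- No resonance: |r| > 1 makes c r^(-N) strictly smaller than the least root `c`.
  have hN0 : ∀ N, N ≠ 0 → γ N 0 ≠ 0 := by
    intro N hN
    rw [hγ0]
    refine hmin _ ?_
    rw [norm_mul, norm_pow]
    exact mul_lt_of_lt_one_right (norm_pos_iff.2 hc0) (pow_lt_one₀ (norm_nonneg _) hrinv hN)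
  let W : PowerSeries ℂ := PowerSeries.mk (recSolution γ)
  let w := HahnSeries.ofPowerSeries ℤ ℂ W
  have hwN : ∀ N : ℕ, w.coeff N = recSolution γ N := fun N => by
    simp only [w, W, HahnSeries.ofPowerSeries_apply_coeff, PowerSeries.coeff_mk]
  refine ⟨c, hc0, w, ?_, ?_, ?_⟩
  · intro hw
    have := hwN 0
    rw [hw, recSolution_zero] at this
    simp at this
  · ext n
    rw [HahnSeries.coeff_zero, HahnSeries.coeff_sum]
    obtain ⟨d, rfl⟩ : ∃ d, n = d + v₀ := ⟨n - v₀, by ring⟩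
    simp only [monomialTwist_iterate_coeff]
    rcases lt_or_ge d 0 with hd | hd
    · refine Finset.sum_eq_zero fun i hi => ?_
      rw [add_sub_assoc, coeff_mul_ofPowerSeries_neg (hsupp i hi) W hd, mul_zero]
    · obtain ⟨N, rfl⟩ := Int.eq_ofNat_of_zero_le hd
      rw [← recSolution_spec γ h00 hN0 N]
      simp only [γ, Finset.sum_mul]
      rw [Finset.sum_comm]
      refine Finset.sum_congr rfl fun i hi => ?_
      rw [add_sub_assoc, coeff_mul_ofPowerSeries (hsupp i hi) W N, Finset.mul_sum]
      refine Finset.sum_congr rfl fun ab _ => ?_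
      simp only [W, PowerSeries.coeff_mk]
      ring
  · intro hconv
    choose A R hA hR hAR using fun i => exists_bound_of_mem_convergentField (hconv i)
    -- No small divisors: c r^(-N) tends to 0 and Q(0) ≠ 0, so the inverses of the `γ N 0` stay
    -- bounded and the majorant applies.
    have hlim : Tendsto (fun N => γ N 0) atTop (𝓝 (Q.eval (c * 0))) := by
      simp only [hγ0]
      exact (Q.continuous.tendsto _).comp
        ((tendsto_pow_atTop_nhds_zero_of_norm_lt_one hrinv).const_mul c)
    rw [mul_zero, ← Polynomial.coeff_zero_eq_eval_zero] at hlim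
    obtain ⟨D, hD0, hD⟩ := exists_norm_inv_le hQ0 hlim
    let T : ℝ := ∑ i ∈ Finset.range (m + 1), R i
    have hT : 0 ≤ T := Finset.sum_nonneg fun i _ => (hR i).le
    let Z : ℕ → ℝ := fun i => ‖c‖ ^ i * ‖e i‖ * (A i * R i ^ (v₀ - i * k))
    have hZ : ∀ i, 0 ≤ Z i := fun i => by
      have := hA i; have := hR i; positivity
    have hbound : ∀ N a, ‖γ N a‖ ≤ (∑ i ∈ Finset.range (m + 1), Z i) * T ^ a := by
      intro N a
      refine (norm_sum_le _ _).trans ?_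
      rw [Finset.sum_mul]
      refine Finset.sum_le_sum fun i hi => ?_
      have h1 : ‖(r : ℂ) ^ (-(i * (N + v₀)) + k * (i.choose 2 : ℕ))‖ ≤ ‖e i‖ := by
        have : (-((i : ℤ) * (N + v₀)) + k * (i.choose 2 : ℕ)) =
          (-(i * v₀) + k * (i.choose 2 : ℕ)) + -((N * i : ℕ) : ℤ) := by push_cast; ring
        rw [this, zpow_add₀ r.ne_zero, zpow_neg _ ((N * i : ℕ) : ℤ), zpow_natCast, norm_mul,
          ← inv_pow, norm_pow]
        exact mul_le_of_le_one_right (norm_nonneg _) (pow_le_one₀ (norm_nonneg _) hrinv.le)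
      have h2 : ‖(p i).coeff (v₀ - i * k + (a : ℕ))‖ ≤ A i * R i ^ (v₀ - i * k) * T ^ a := by
        refine (hAR i _).trans ?_
        rw [zpow_add₀ (hR i).ne', zpow_natCast, ← mul_assoc]
        refine mul_le_mul_of_nonneg_left (pow_le_pow_left₀ (hR i).le ?_ a)
          (mul_nonneg (hA i) (zpow_nonneg (hR i).le _))
        exact Finset.single_le_sum (f := R) (fun i _ => (hR i).le) hi
      rw [norm_mul, norm_mul, norm_pow]
      calc _ ≤ ‖c‖ ^ i * ‖e i‖ * (A i * R i ^ (v₀ - i * k) * T ^ a) :=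
            mul_le_mul (mul_le_mul_of_nonneg_left h1 (by positivity)) h2 (norm_nonneg _)
              (by positivity)
        _ = _ := by simp only [Z]; ring
    refine mem_convergentField_of_bound (fun n hn => ofPowerSeries_coeff_neg W hn)
      (R := T * (1 + D * ∑ i ∈ Finset.range (m + 1), Z i))
      (mul_nonneg hT (by have := Finset.sum_nonneg (s := Finset.range (m + 1)) fun i _ => hZ i
                         positivity)) fun N => ?_
    have := recSolution_bound γ (Finset.sum_nonneg fun i _ => hZ i) hD0 hT hD hbound N
    rw [← hwN] at this
    exact this

end formal

end

noncomputable section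

open Filter Topology LaurentSeries

/-! ### Continuation of a germ by its own functional equation. -/

section continuation

/-- The right-hand side `T` of the equation evaluates its argument only at points nearer to 0 by a
factor at least |r|. Hence each application of `T` multiplies the radius of the punctured disc of
meromorphy by |r|, and on each disc the iterates become stationary. -/
theorem exists_meromorphic_continuation (r : ℂˣ) (hr : 1 < ‖(r : ℂ)‖) (m : ℕ) (C : ℕ → ℂ → ℂ)
    (hC : ∀ i z, MeromorphicAt (C i) z) {g₀ : ℂ → ℂ} (hg₀ : MeromorphicAt g₀ 0)
    (heq : ∀ᶠ z in 𝓝[≠] (0 : ℂ),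
      g₀ z = ∑ i ∈ Finset.range m, C i z * g₀ (((r⁻¹ ^ (i + 1) : ℂˣ) : ℂ) * z)) :
    ∃ g : ℂ → ℂ, (∀ z, MeromorphicAt g z) ∧ g =ᶠ[𝓝[≠] 0] g₀ := by
  obtain ⟨ρ, hρ, hball⟩ := Metric.mem_nhdsWithin_iff.1 (heq.and hg₀.eventually_analyticAt)
  have hb : ∀ z, z ≠ 0 → ‖z‖ < ρ →
      g₀ z = ∑ i ∈ Finset.range m, C i z * g₀ (((r⁻¹ ^ (i + 1) : ℂˣ) : ℂ) * z) ∧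
        AnalyticAt ℂ g₀ z := fun z hz hzρ => hball ⟨by simpa using hzρ, hz⟩
  let T : (ℂ → ℂ) → ℂ → ℂ := fun h z =>
    ∑ i ∈ Finset.range m, C i z * h (((r⁻¹ ^ (i + 1) : ℂˣ) : ℂ) * z)
  have hr0 : 0 < ‖(r : ℂ)‖ := one_pos.trans hr
  have hscale : ∀ (i N : ℕ) (z : ℂ), z ≠ 0 → ‖z‖ < ‖(r : ℂ)‖ ^ (N + 1) * ρ →
      ((r⁻¹ ^ (i + 1) : ℂˣ) : ℂ) * z ≠ 0 ∧
        ‖((r⁻¹ ^ (i + 1) : ℂˣ) : ℂ) * z‖ < ‖(r : ℂ)‖ ^ N * ρ := by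
    intro i N z hz hzN
    refine ⟨mul_ne_zero (Units.ne_zero _) hz, ?_⟩
    rw [norm_mul, Units.val_pow_eq_pow_val, norm_pow, Units.val_inv_eq_inv_val, norm_inv, inv_pow,
      inv_mul_lt_iff₀ (by positivity)]
    refine hzN.trans_le ?_
    rw [pow_succ', pow_succ', mul_assoc, mul_assoc]
    refine mul_le_mul_of_nonneg_left ?_ hr0.le
    exact le_mul_of_one_le_left (by positivity) (one_le_pow₀ hr.le)
  have hstep : ∀ N z, z ≠ 0 → ‖z‖ < ‖(r : ℂ)‖ ^ N * ρ → T^[N + 1] g₀ z = T^[N] g₀ z := by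
    intro N
    induction N with
    | zero => intro z hz hzρ; exact ((hb z hz (by simpa using hzρ)).1).symm
    | succ N ih =>
      intro z hz hzN
      obtain h3 := fun i => hscale i N z hz hzN
      rw [Function.iterate_succ_apply']
      conv_rhs => rw [Function.iterate_succ_apply']
      exact Finset.sum_congr rfl fun i _ => congrArg (C i z * ·) (ih _ (h3 i).1 (h3 i).2)
  have hmono : ∀ N M z, N ≤ M → z ≠ 0 → ‖z‖ < ‖(r : ℂ)‖ ^ N * ρ → T^[M] g₀ z = T^[N] g₀ z := by
    intro N M z hNM hz hzN
    induction M, hNM using Nat.le_induction with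
    | base => rfl
    | succ M hNM ih =>
      rw [hstep M z hz (hzN.trans_le ?_), ih]
      exact mul_le_mul_of_nonneg_right (pow_le_pow_right₀ hr.le hNM) hρ.le
  have hmer : ∀ N z, z ≠ 0 → ‖z‖ < ‖(r : ℂ)‖ ^ N * ρ → MeromorphicAt (T^[N] g₀) z := by
    intro N
    induction N with
    | zero => intro z hz hzρ; exact (hb z hz (by simpa using hzρ)).2.meromorphicAt
    | succ N ih =>
      intro z hz hzN
      rw [Function.iterate_succ_apply']
      refine MeromorphicAt.fun_sum fun i _ => ?_
      obtain ⟨h1, h2⟩ := hscale i N z hz hzN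
      exact (hC i z).mul ((ih _ h1 h2).comp_analyticAt (analyticAt_const.mul analyticAt_id))
  have hex : ∀ z : ℂ, ∃ N : ℕ, ‖z‖ < ‖(r : ℂ)‖ ^ N * ρ := fun z => by
    obtain ⟨N, hN⟩ := pow_unbounded_of_one_lt (‖z‖ / ρ) hr
    exact ⟨N, (div_lt_iff₀ hρ).1 hN⟩
  -- The continuation takes at `z` the value of an iterate that is already stationary there; near a
  -- given nonzero point a single iterate serves.
  choose n hn using hex
  have hg : ∀ N z, z ≠ 0 → ‖z‖ < ‖(r : ℂ)‖ ^ N * ρ → T^[n z] g₀ z = T^[N] g₀ z := by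
    intro N z hz hzN
    rcases le_total (n z) N with h | h
    · exact (hmono _ _ z h hz (hn z)).symm
    · exact hmono _ _ z h hz hzN
  have h0 : (fun z => T^[n z] g₀ z) =ᶠ[𝓝[≠] 0] g₀ := by
    filter_upwards [self_mem_nhdsWithin,
      mem_nhdsWithin_of_mem_nhds (Metric.ball_mem_nhds (0 : ℂ) hρ)] with z hz hzρ
    exact hg 0 z hz (by simpa using hzρ)
  refine ⟨fun z => T^[n z] g₀ z, fun z => ?_, h0⟩
  rcases eq_or_ne z 0 with rfl | hz
  · exact hg₀.congr h0.symm
  · refine (hmer (n z) z hz (hn z)).congr (Filter.EventuallyEq.filter_mono ?_ nhdsWithin_le_nhds)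
    have h1 : ∀ᶠ y in 𝓝 z, ‖y‖ < ‖(r : ℂ)‖ ^ (n z) * ρ :=
      continuous_norm.continuousAt.eventually_lt continuousAt_const (hn z)
    filter_upwards [h1, isOpen_ne.mem_nhds hz] with y hy hy0
    exact (hg _ y hy0 hy).symm

theorem IsLaurentExpansion.eventually_eq_zero {g : ℂ → ℂ} (h : IsLaurentExpansion g 0) :
    g =ᶠ[𝓝[≠] 0] 0 := by
  filter_upwards [h] with z hz
  simpa using hz.unique (by simp)

theorem IsLaurentExpansion.sum (m : ℕ) {g : ℕ → ℂ → ℂ} {f : ℕ → ℂ⸨X⸩}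
    (h : ∀ i, IsLaurentExpansion (g i) (f i)) :
    IsLaurentExpansion (∑ i ∈ Finset.range m, g i) (∑ i ∈ Finset.range m, f i) := by
  induction m with
  | zero =>
    have h0 := IsLaurentExpansion.const 0
    rw [map_zero] at h0
    exact h0
  | succ m ih => rw [Finset.sum_range_succ, Finset.sum_range_succ]; exact ih.add (h m)

theorem mem_meromorphicField_of_equation (r : ℂˣ) (hr : 1 < ‖(r : ℂ)‖) (m : ℕ) {c : ℕ → ℂ⸨X⸩}
    (hc : ∀ i, c i ∈ meromorphicField) {w : ℂ⸨X⸩} (hw : w ∈ convergentField)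
    (h : w = ∑ i ∈ Finset.range m, c i * dilationHom (r⁻¹ ^ (i + 1)) w) : w ∈ meromorphicField := by
  choose C hC hCc using hc
  obtain ⟨g₀, hg₀⟩ := hw
  have h1 : IsLaurentExpansion (∑ i ∈ Finset.range m,
      (C i * fun z => g₀ (((r⁻¹ ^ (i + 1) : ℂˣ) : ℂ) * z)) + (fun _ => -1) * g₀) 0 := by
    have h2 := (IsLaurentExpansion.sum m fun i => (hCc i).mul (hg₀.dilation (r⁻¹ ^ (i + 1)))).add
      ((IsLaurentExpansion.const (-1)).mul hg₀)
    have h3 : w + -1 * w = 0 := by ring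
    rw [← h, map_neg, map_one, h3] at h2
    exact h2
  obtain ⟨g, hg, hgg⟩ := exists_meromorphic_continuation r hr m C hC hg₀.meromorphicAt (by
    filter_upwards [h1.eventually_eq_zero] with z hz
    simp only [Pi.add_apply, Finset.sum_apply, Pi.mul_apply, Pi.zero_apply] at hz
    linear_combination -hz)
  exact ⟨g, hg, hg₀.congr hgg.symm⟩

end continuation

theorem dilationHom_dilationHom (a b : ℂˣ) (f : ℂ⸨X⸩) :
    dilationHom a (dilationHom b f) = dilationHom (a * b) f := by
  ext n
  simp [mul_zpow, mul_assoc]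

theorem dilationHom_one (f : ℂ⸨X⸩) : dilationHom 1 f = f := by
  ext n; simp

/-! ### Solutions in each of the three base fields. -/

namespace BaseField

theorem single_mem (B : BaseField) (k : ℤ) (c : ℂ) :
    (HahnSeries.single k c : ℂ⸨X⸩) ∈ B.field := by
  have h : IsLaurentExpansion (fun z => c * z ^ k) (HahnSeries.single k c : ℂ⸨X⸩) := by
    refine Eventually.of_forall fun z => ?_
    have h1 : (fun n : ℤ => (HahnSeries.single k c : ℂ⸨X⸩).coeff n * z ^ n) =
        fun n : ℤ => if n = k then c * z ^ k else 0 := by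
      funext n
      by_cases hn : n = k
      · subst hn; simp
      · simp [hn, HahnSeries.coeff_single_of_ne hn]
    rw [h1]
    exact hasSum_ite_eq k _
  cases B with
  | meromorphic =>
    exact ⟨_, fun z => (MeromorphicAt.const c z).mul ((MeromorphicAt.id z).zpow k), h⟩
  | convergent => exact ⟨_, h⟩
  | formal => exact IntermediateField.mem_top

/-- The monomial `c z ^ k`, as an element of the base field. -/
def monomial (B : BaseField) (k : ℤ) (c : ℂ) : B.field := ⟨HahnSeries.single k c, B.single_mem k c⟩

theorem monomialTwist_iterate (r : ℂˣ) (c : ℂ) (k : ℤ) (i : ℕ) : ∃ β ∈ meromorphicField,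
    ∀ f, (monomialTwist r c k)^[i] f = β * dilationHom (r⁻¹ ^ i) f := by
  induction i with
  | zero => exact ⟨1, one_mem _, fun f => by simp [dilationHom_one]⟩
  | succ i ih =>
    obtain ⟨β, hβ, h⟩ := ih
    refine ⟨dilationHom r⁻¹ (HahnSeries.single k c * β),
      meromorphic.dilation_mem r⁻¹ (mul_mem (meromorphic.single_mem k c) hβ), fun f => ?_⟩
    rw [Function.iterate_succ_apply', h, monomialTwist, ← mul_assoc, map_mul,
      dilationHom_dilationHom, pow_succ']

theorem eq_sum_of_sum_add_mul_eq_zero {F : Type*} [Field F] {m : ℕ} {p w : F} {x y : ℕ → F}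
    (hp : p ≠ 0) (h : ∑ i ∈ Finset.range m, x i * y i + p * w = 0) :
    w = ∑ i ∈ Finset.range m, -p⁻¹ * x i * y i := by
  simp only [mul_assoc]
  rw [← Finset.mul_sum]
  have : ∑ i ∈ Finset.range m, x i * y i = -(p * w) := eq_neg_of_add_eq_zero_left h
  rw [this]
  field_simp

/-- The formal solution stays in the field of the coefficients. For meromorphic coefficients,
dividing by `p 0` expresses `w` through its dilates by r^(-1), …, r^(-m), which is the form needed
for continuation. -/
theorem exists_solution (B : BaseField) (r : ℂˣ) (hr : 1 < ‖(r : ℂ)‖) (m : ℕ) (p : ℕ → B.field)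
    (k : ℤ) (hp0 : p 0 ≠ 0)
    (hk : ∀ i ≤ m, p i ≠ 0 → (p 0 : ℂ⸨X⸩).order ≤ k * i + (p i : ℂ⸨X⸩).order)
    (hex : ∃ i ≤ m, i ≠ 0 ∧ p i ≠ 0 ∧ (p 0 : ℂ⸨X⸩).order = k * i + (p i : ℂ⸨X⸩).order) :
    ∃ c : ℂ, c ≠ 0 ∧ ∃ w : B.field, w ≠ 0 ∧ ∑ i ∈ Finset.range (m + 1),
      (fun f => (B.sigma r).symm (B.monomial k c * f))^[i] (p i * w) = 0 := by
  have hne : ∀ i, p i ≠ 0 ↔ (p i : ℂ⸨X⸩) ≠ 0 := fun i => (Subtype.coe_ne_coe (b := (0 : B.field))).symm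
  obtain ⟨c, hc, w, hw0, hw, hconv⟩ := exists_formal_solution r hr m (fun i => (p i : ℂ⸨X⸩)) k
    ((hne 0).1 hp0) (fun i hi hpi => hk i hi ((hne i).2 hpi)) (by simpa only [hne] using hex)
  have hmem : w ∈ B.field := by
    cases B with
    | formal => exact IntermediateField.mem_top
    | convergent => exact hconv fun i => (p i).2
    | meromorphic =>
      choose β hβ hβf using monomialTwist_iterate r c k
      have hp0' : (p 0 : ℂ⸨X⸩) ≠ 0 := (hne 0).1 hp0
      refine mem_meromorphicField_of_equation r hr m
        (c := fun i => -(p 0 : ℂ⸨X⸩)⁻¹ * (β (i + 1) * dilationHom (r⁻¹ ^ (i + 1)) (p (i + 1))))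
        (fun i => ?_) (hconv fun i => meromorphicField_le (p i).2) ?_
      · exact mul_mem (neg_mem (inv_mem (p 0).2))
          (mul_mem (hβ _) (meromorphic.dilation_mem _ (p (i + 1)).2))
      · rw [Finset.sum_range_succ'] at hw
        simp only [hβf, map_mul] at hw
        have h2 := hβf 0 ((p 0 : ℂ⸨X⸩) * w)
        simp only [Function.iterate_zero, id, map_mul] at h2
        rw [← h2] at hw
        simp only [← mul_assoc] at hw
        exact eq_sum_of_sum_add_mul_eq_zero hp0' hw
  refine ⟨c, hc, ⟨w, hmem⟩, fun h => hw0 (congrArg Subtype.val h), Subtype.ext ?_⟩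
  have hit : ∀ (i : ℕ) (f : B.field),
      (((fun f => (B.sigma r).symm (B.monomial k c * f))^[i] f : B.field) : ℂ⸨X⸩) =
        (monomialTwist r c k)^[i] f := by
    intro i
    induction i with
    | zero => intro f; rfl
    | succ i ih => intro f; rw [Function.iterate_succ_apply, ih]; rfl
  rw [AddSubmonoidClass.coe_finsetSum]
  simp only [hit]
  exact hw

end BaseField

end

noncomputable section

open scoped NNReal
open LaurentSeries

namespace DiffMod

open Growth

/-! ### Cyclic vectors, factorisation of the relation, and upper bounds for slopes. -/

section cyclic

variable {K : Type} [Field K] [Algebra ℂ K] {σ : K ≃ₐ[ℂ] K}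

/-- The relation of minimal length between the iterates `Φ^i x` of a nonzero vector. -/
theorem exists_minimal_relation (M : DiffMod.{u} K σ) {x : M} (hx : x ≠ 0) :
    ∃ (m : ℕ) (p : ℕ → K), 0 < m ∧ p m = 1 ∧ p 0 ≠ 0 ∧
      LinearIndependent K (fun i : Fin m => M.Φ^[i] x) ∧
      ∑ i ∈ Finset.range (m + 1), p i • M.Φ^[i] x = 0 := by
  classical
  have hex : ∃ n : ℕ, ¬ LinearIndependent K (fun i : Fin (n + 1) => M.Φ^[i] x) := by
    refine ⟨Module.finrank K M, fun h => ?_⟩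
    have := h.fintype_card_le_finrank
    simp at this
  set m := Nat.find hex
  have hm : ¬ LinearIndependent K (fun i : Fin (m + 1) => M.Φ^[i] x) := Nat.find_spec hex
  have hm0 : 0 < m := by
    rw [Nat.pos_iff_ne_zero]
    intro h
    rw [h] at hm
    have : Subsingleton (Fin (0 + 1)) := inferInstanceAs (Subsingleton (Fin 1))
    exact hm (LinearIndependent.of_subsingleton (0 : Fin 1) hx)
  have hli : LinearIndependent K (fun i : Fin m => M.Φ^[i] x) := by
    obtain ⟨n, hn⟩ : ∃ n, m = n + 1 := ⟨m - 1, by omega⟩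
    have := Nat.find_min hex (m := n) (by change n < m; omega)
    rw [not_not] at this
    rw [hn]; exact this
  have hmem : M.Φ^[m] x ∈ Submodule.span K (Set.range fun i : Fin m => M.Φ^[i] x) := by
    by_contra h
    exact hm (linearIndependent_finSucc'.2 ⟨hli, h⟩)
  obtain ⟨c, hc⟩ := (Submodule.mem_span_range_iff_exists_fun K).1 hmem
  let p : ℕ → K := fun i => if h : i < m then -c ⟨i, h⟩ else 1
  have hpm : p m = 1 := by simp [p]
  have hrel : ∑ i ∈ Finset.range (m + 1), p i • M.Φ^[i] x = 0 := by
    rw [Finset.sum_range_succ, hpm, one_smul, ← hc, Finset.sum_range]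
    simp [p]
  refine ⟨m, p, hm0, hpm, fun hp0 => ?_, hli, hrel⟩
  -- If `p 0` vanished, Φ could be stripped off the relation, leaving a shorter one whose last
  -- coefficient is still 1.
  have h1 : M.Φ (∑ i : Fin m, σ.symm (p (i + 1)) • M.Φ^[i] x) = 0 := by
    rw [Finset.sum_range_succ', hp0, zero_smul, add_zero, Finset.sum_range] at hrel
    rw [← hrel, map_sum]
    refine Finset.sum_congr rfl fun i _ => ?_
    rw [M.Φ_smul, AlgEquiv.apply_symm_apply, Function.iterate_succ_apply']
  have h2 := Fintype.linearIndependent_iff.1 hli _ ((map_eq_zero_iff _ M.Φ.injective).1 h1)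
    ⟨m - 1, by omega⟩
  have h3 : m - 1 + 1 = m := by omega
  simp [h3, hpm] at h2

/-- The solution `w` makes `a w` times the operator Σ p_i Φ^i factor as (Φ - a) ∘ Σ g_i Φ^i, with i
< m in the second factor. Applied to `x`, this shows that Σ g_i Φ^i x is an eigenvector. -/
theorem exists_eigenvector_of_solution (M : DiffMod.{u} K σ) {x : M} {m : ℕ} {p : ℕ → K}
    (hm : 0 < m) (hp0 : p 0 ≠ 0) (hli : LinearIndependent K (fun i : Fin m => M.Φ^[i] x))
    (hrel : ∑ i ∈ Finset.range (m + 1), p i • M.Φ^[i] x = 0) {a w : K} (ha : a ≠ 0) (hw : w ≠ 0)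
    (heq : ∑ i ∈ Finset.range (m + 1), (fun f => σ.symm (a * f))^[i] (p i * w) = 0) :
    ∃ y : M, y ≠ 0 ∧ M.Φ y = a • y := by
  let S : K →+ K := σ.symm.toRingEquiv.toRingHom.toAddMonoidHom.comp (AddMonoidHom.mulLeft a)
  have hS : ∀ f, S f = σ.symm (a * f) := fun _ => rfl
  let τ : K → K := fun f => a⁻¹ * σ f
  have hSτ : ∀ f, S (τ f) = f := fun f => by simp [hS, τ, ha]
  -- Comparison of coefficients in the factorisation forces this recursion. The division is exact
  -- when `g m = 0`, which is the assumed dual equation after `m` applications of `S`.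
  let g : ℕ → K := fun n => Nat.rec (-(p 0 * w)) (fun j y => τ y - p (j + 1) * w) n
  have hg : ∀ j, g (j + 1) = τ (g j) - p (j + 1) * w := fun _ => rfl
  have key : ∀ j, S^[j] (g j) = -∑ i ∈ Finset.range (j + 1), S^[i] (p i * w) := by
    intro j
    induction j with
    | zero => simp [g]
    | succ j ih =>
      rw [hg, iterate_map_sub, Finset.sum_range_succ, Function.iterate_succ_apply, hSτ, ih]
      ring
  have hSinj : Function.Injective S := fun f f' h => by
    simpa [hS, ha] using h
  have hgm : g m = 0 := by
    refine hSinj.iterate m ?_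
    rw [key, iterate_map_zero, neg_eq_zero]
    exact heq
  have htel : ∀ n, M.Φ (∑ i ∈ Finset.range n, g i • M.Φ^[i] x) -
      a • ∑ i ∈ Finset.range n, g i • M.Φ^[i] x =
      a • (g n • M.Φ^[n] x + w • ∑ i ∈ Finset.range (n + 1), p i • M.Φ^[i] x) := by
    intro n
    induction n with
    | zero => simp [g, smul_smul, mul_comm]
    | succ n ih =>
      have h1 : a • τ (g n) • M.Φ^[n + 1] x = M.Φ (g n • M.Φ^[n] x) := by
        rw [M.Φ_smul, smul_smul, ← Function.iterate_succ_apply' M.Φ]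
        simp [τ, ha]
      rw [Finset.sum_range_succ, map_add, smul_add, add_sub_add_comm, ih, ← h1, hg,
        Finset.sum_range_succ _ (n + 1)]
      module
  refine ⟨∑ i ∈ Finset.range m, g i • M.Φ^[i] x, fun h0 => ?_, ?_⟩
  · rw [Finset.sum_range] at h0
    have := Fintype.linearIndependent_iff.1 hli _ h0 ⟨0, hm⟩
    simp [g, hp0, hw] at this
  · have := htel m
    rw [hgm, hrel, zero_smul, smul_zero, add_zero, smul_zero] at this
    exact sub_eq_zero.1 this

theorem Φ_symm_iterate_smul (M : DiffMod.{u} K σ) (n : ℕ) (a : K) (x : M) :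
    M.Φ.symm^[n] (a • x) = σ.symm^[n] a • M.Φ.symm^[n] x := by
  induction n generalizing a x with
  | zero => rfl
  | succ n ih => rw [Function.iterate_succ_apply, M.Φ_symm_smul, ih]; rfl

/-- Applying Φ^(-n) to the relation and solving for the term of `p 0` expresses Φ^(-n) x through the
Φ^(-(n-i)) x with 1 ≤ i ≤ m, with coefficients of absolute value at most `rad (-lam) ^ i`; strong
induction on `n` follows. -/
theorem mem_growthLE_of_relation (v : Valuation K ℝ≥0) [hv : IsometricAut v σ]
    (M : DiffMod.{u} K σ) {x : M} {m : ℕ} {p : ℕ → K} (hp0 : p 0 ≠ 0)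
    (hrel : ∑ i ∈ Finset.range (m + 1), p i • M.Φ^[i] x = 0) {lam : ℚ}
    (h : ∀ i ≤ m, v (p i) ≤ v (p 0) * rad (-lam) ^ i) : x ∈ M.growthLE v lam := by
  have hρ := rad_ne_zero (-lam)
  rw [mem_growthLE]
  set ρ := rad (-lam)
  obtain ⟨C, hC⟩ := exists_forall_of_mono
    (fun (i : Fin m) C => nrm v (M.Φ.symm^[i] x) ≤ C * ρ ^ (i : ℕ))
    (fun i C C' hCC' hi => hi.trans (mul_le_mul_left hCC' _))
    (fun i => ⟨nrm v (M.Φ.symm^[i] x) / ρ ^ (i : ℕ), by field_simp; exact le_rfl⟩)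
  refine ⟨C, fun n => ?_⟩
  induction n using Nat.strong_induction_on with
  | _ n ih =>
    rcases lt_or_ge n m with hn | hn
    · exact hC ⟨n, hn⟩
    have hτ : ∀ a, v (σ.symm^[n] a) = v a := fun a => by
      have h1 : ∀ a, v (σ.symm a) = v a := fun a => by
        rw [← hv.map_eq, AlgEquiv.apply_symm_apply]
      clear ih hn hrel
      induction n with
      | zero => rfl
      | succ n ih => rw [Function.iterate_succ_apply', h1, ih]
    have h1 : ∑ i ∈ Finset.range (m + 1), σ.symm^[n] (p i) • M.Φ.symm^[n - i] x = 0 := by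
      have h2 := congrArg M.Φ.symm^[n] hrel
      rw [((M.isSemi_Φ_symm v).iterate n).sum, ((M.isSemi_Φ_symm v).iterate n).zero] at h2
      rw [← h2]
      refine Finset.sum_congr rfl fun i hi => ?_
      have hi' := Finset.mem_range.1 hi
      rw [Φ_symm_iterate_smul]
      congr 1
      have hn' : n = (n - i) + i := by omega
      conv_rhs => rw [hn', Function.iterate_add_apply]
      rw [(show Function.LeftInverse M.Φ.symm M.Φ from M.Φ.symm_apply_apply).iterate i]
    rw [Finset.sum_range_succ', add_comm] at h1
    have h3 : σ.symm^[n] (p 0) • M.Φ.symm^[n] x =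
        -∑ i ∈ Finset.range m, σ.symm^[n] (p (i + 1)) • M.Φ.symm^[n - (i + 1)] x :=
      eq_neg_of_add_eq_zero_left h1
    have h4 := congrArg (nrm v) h3
    rw [nrm_smul, nrm_neg, hτ] at h4
    have h5 : v (p 0) * nrm v (M.Φ.symm^[n] x) ≤ v (p 0) * (C * ρ ^ n) := by
      rw [h4]
      refine nrm_sum_le _ _ fun i hi => ?_
      have hi' := Finset.mem_range.1 hi
      rw [nrm_smul, hτ]
      calc _ ≤ v (p 0) * ρ ^ (i + 1) * (C * ρ ^ (n - (i + 1))) :=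
            mul_le_mul' (h _ hi') (ih _ (by omega))
        _ = v (p 0) * (C * (ρ ^ (i + 1) * ρ ^ (n - (i + 1)))) := by ring
        _ = _ := by rw [← pow_add]; congr 4; omega
    exact le_of_mul_le_mul_left h5 (pos_iff_ne_zero.2 ((v.ne_zero_iff).2 hp0))

end cyclic

end DiffMod

namespace BaseField

/-- The monomial `c z_l ^ k` of `K_l`. -/
def monomialRamified (B : BaseField) (l : ℕ+) (k : ℤ) (c : ℂ) : B.Ramified l := B.monomial k c

theorem exists_solution_ramified (B : BaseField) (l : ℕ+) (r : ℂˣ) (hr : 1 < ‖(r : ℂ)‖) (m : ℕ)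
    (p : ℕ → B.Ramified l) (k : ℤ) (hp0 : p 0 ≠ 0)
    (hk : ∀ i ≤ m, p i ≠ 0 → (p 0).val ≤ k * i + (p i).val)
    (hex : ∃ i ≤ m, i ≠ 0 ∧ p i ≠ 0 ∧ (p 0).val = k * i + (p i).val) :
    ∃ c : ℂ, c ≠ 0 ∧ ∃ w : B.Ramified l, w ≠ 0 ∧ ∑ i ∈ Finset.range (m + 1),
      (fun f => (B.sigmaRamified l r).symm (B.monomialRamified l k c * f))^[i] (p i * w) = 0 :=
  B.exists_solution r hr m p k hp0 hk hex

theorem monomial_ne_zero (B : BaseField) (k : ℤ) {c : ℂ} (hc : c ≠ 0) : B.monomial k c ≠ 0 :=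
  fun h => HahnSeries.single_ne_zero (a := k) hc (congrArg Subtype.val h)

theorem monomialRamified_ne_zero (B : BaseField) (l : ℕ+) (k : ℤ) {c : ℂ} (hc : c ≠ 0) :
    B.monomialRamified l k c ≠ 0 := B.monomial_ne_zero k hc

theorem val_algebraMap (B : BaseField) (l : ℕ+) {a : B.field} (ha : a ≠ 0) :
    (algebraMap B.field (B.Ramified l) a).val = l * (a : ℂ⸨X⸩).order :=
  ramificationHom_order l fun h => ha (Subtype.ext h)

end BaseField

namespace DiffMod

open Growth TensorProduct

/-! ### Extension of scalars and the greatest slope of a cyclic submodule. -/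

section ofBase

variable {K : Type} [Field K] [Algebra ℂ K] {σ : K ≃ₐ[ℂ] K} (M : DiffMod.{u} K σ) {K' : Type}
  [Field K'] [Algebra ℂ K'] [Algebra K K'] {σ' : K' ≃ₐ[ℂ] K'}
  (h : ∀ a, σ' (algebraMap K K' a) = algebraMap K K' (σ a))

/-- The map `x ↦ 1 ⊗ x`. -/
def ofBase : M →+ M.baseChange h := (TensorProduct.mk K K' M 1).toAddMonoidHom

theorem ofBase_smul (a : K) (x : M) :
    M.ofBase h (a • x) = algebraMap K K' a • M.ofBase h x :=
  ((TensorProduct.mk K K' M 1).map_smul a x).trans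
    (algebraMap_smul K' a (1 ⊗ₜ x : K' ⊗[K] M)).symm

theorem ofBase_Φ (x : M) : (M.baseChange h).Φ (M.ofBase h x) = M.ofBase h (M.Φ x) := by
  refine (baseChange_Φ_tmul M h 1 x).trans ?_
  rw [map_one]
  rfl

theorem ofBase_Φ_symm (x : M) :
    (M.baseChange h).Φ.symm (M.ofBase h x) = M.ofBase h (M.Φ.symm x) :=
  (M.baseChange h).Φ.injective (by rw [ofBase_Φ]; simp)

theorem ofBase_Φ_iterate (x : M) (n : ℕ) :
    (M.baseChange h).Φ^[n] (M.ofBase h x) = M.ofBase h (M.Φ^[n] x) :=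
  (Function.Semiconj.iterate_right (f := M.ofBase h) (fun x => (ofBase_Φ M h x).symm) n x).symm

theorem linearIndependent_ofBase {ι : Type*} {b : ι → M} (hb : LinearIndependent K b) :
    LinearIndependent K' fun i => M.ofBase h (b i) :=
  Module.Flat.linearIndependent_one_tmul hb

theorem eq_top_of_ofBase_mem {W : Submodule K' (M.baseChange h)}
    (hW : ∀ x, M.ofBase h x ∈ W) : W = ⊤ := by
  rw [Submodule.eq_top_iff']
  intro y
  change K' ⊗[K] M at y
  induction y with
  | zero => exact W.zero_mem
  | add x y hx hy => exact W.add_mem hx hy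
  | tmul a x =>
    have : (a ⊗ₜ x : K' ⊗[K] M) = a • (1 ⊗ₜ x : K' ⊗[K] M) := by
      rw [TensorProduct.smul_tmul', smul_eq_mul, mul_one]
    rw [this]
    exact W.smul_mem a (hW x)

end ofBase

/-- The greatest slope of the module generated by a vector, with the corresponding eigenvectors. -/
theorem exists_cyclic_slope (B : BaseField) {q : ℂˣ} (hq : 1 < ‖(q : ℂ)‖)
    (M : DiffMod.{u} B.field (B.sigma q)) {x : M} (hx : x ≠ 0) :
    ∃ lam : ℚ, x ∈ M.growthLE B.absVal lam ∧
      (∀ k : ℤ, lam = k → ∃ c : ℂ, c ≠ 0 ∧ ∃ y : M, y ≠ 0 ∧ M.Φ y = B.monomial k c • y) ∧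
      ∀ (l : ℕ+) (r : ℂˣ) (h : r ^ (l : ℕ) = q) (k : ℤ), lam * (l : ℕ) = k →
        ∃ c : ℂ, c ≠ 0 ∧ ∃ y : M.baseChange (B.sigmaRamified_algebraMap l h), y ≠ 0 ∧
          (M.baseChange (B.sigmaRamified_algebraMap l h)).Φ y = B.monomialRamified l k c • y := by
  classical
  obtain ⟨m, p, hm, hpm, hp0, hli, hrel⟩ := M.exists_minimal_relation hx
  let d : ℕ → ℤ := fun i => (p i : ℂ⸨X⸩).order
  -- The maximum of (d 0 - d i)/i over i ≥ 1 is the slope of the Newton polygon edge at `p 0`; the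
  -- index `m` shows that there is something to maximise over.
  obtain ⟨i₀, hi₀, hmax⟩ := Finset.exists_max_image
    ((Finset.Icc 1 m).filter fun i => p i ≠ 0) (fun i => ((d 0 - d i : ℤ) : ℚ) / i)
    ⟨m, by simp [hpm]; omega⟩
  simp only [Finset.mem_filter, Finset.mem_Icc] at hi₀ hmax
  set lam : ℚ := ((d 0 - d i₀ : ℤ) : ℚ) / i₀ with hlam
  have hi₀0 : (i₀ : ℚ) ≠ 0 := by exact_mod_cast (by omega : i₀ ≠ 0)
  have heq : (d 0 : ℚ) = lam * i₀ + d i₀ := by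
    rw [hlam]; field_simp; push_cast; ring
  have hle : ∀ i ≤ m, p i ≠ 0 → (d 0 : ℚ) ≤ lam * i + d i := by
    intro i hi hpi
    rcases Nat.eq_zero_or_pos i with rfl | hi0
    · simp
    · have h1 := hmax i ⟨⟨hi0, hi⟩, hpi⟩
      have h2 : (0 : ℚ) < i := by exact_mod_cast hi0
      rw [div_le_iff₀ h2] at h1
      push_cast at h1
      linarith
  refine ⟨lam, ?_, ?_, ?_⟩
  · refine mem_growthLE_of_relation B.absVal M hp0 hrel fun i hi => ?_
    by_cases hpi : p i = 0
    · simp [hpi]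
    · rw [B.absVal_apply hpi, B.absVal_apply hp0, ← rad_mul_nat, ← rad_add, rad_le_rad]
      have := hle i hi hpi
      simp only [d] at this
      linarith
  · intro k hk
    obtain ⟨c, hc, w, hw, hsol⟩ := B.exists_solution q hq m p k hp0
      (fun i hi hpi => by
        have := hle i hi hpi
        rw [hk] at this
        exact_mod_cast this)
      ⟨i₀, hi₀.1.2, by omega, hi₀.2, by
        rw [hk] at heq
        exact_mod_cast heq⟩
    exact ⟨c, hc, M.exists_eigenvector_of_solution hm hp0 hli hrel (B.monomial_ne_zero k hc) hw
      hsol⟩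
  · intro l r h k hk
    have hr : 1 < ‖(r : ℂ)‖ := by
      by_contra hlt
      rw [← h, Units.val_pow_eq_pow_val, norm_pow] at hq
      exact absurd (pow_le_one₀ (norm_nonneg _) (not_lt.1 hlt)) (not_le.2 hq)
    -- The same relation holds over K_l, with all orders multiplied by `l`, so the edge acquires the
    -- integral slope `k`.
    let p' : ℕ → B.Ramified l := fun i => algebraMap B.field (B.Ramified l) (p i)
    have hp' : ∀ i, p' i ≠ 0 ↔ p i ≠ 0 := fun i => map_ne_zero _
    have hl : (0 : ℚ) < (l : ℕ) := by exact_mod_cast l.pos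
    obtain ⟨c, hc, w, hw, hsol⟩ := B.exists_solution_ramified l r hr m p' k ((hp' 0).2 hp0)
      (fun i hi hpi => by
        have h1 := hle i hi ((hp' i).1 hpi)
        rw [B.val_algebraMap l hp0, B.val_algebraMap l ((hp' i).1 hpi)]
        have h2 : ((l : ℕ) : ℚ) * d 0 ≤ k * i + (l : ℕ) * d i := by
          rw [← hk]; nlinarith
        exact_mod_cast h2)
      ⟨i₀, hi₀.1.2, by omega, (hp' _).2 hi₀.2, by
        rw [B.val_algebraMap l hp0, B.val_algebraMap l hi₀.2]
        have h2 : ((l : ℕ) : ℚ) * d 0 = k * i₀ + (l : ℕ) * d i₀ := by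
          rw [← hk, heq]; ring
        exact_mod_cast h2⟩
    let V := M.baseChange (B.sigmaRamified_algebraMap l h)
    have hliV : LinearIndependent (B.Ramified l)
        (fun i : Fin m => V.Φ^[i] (M.ofBase _ x)) := by
      have : (fun i : Fin m => V.Φ^[i] (M.ofBase _ x)) = fun i : Fin m => M.ofBase _ (M.Φ^[i] x) :=
        funext fun i => M.ofBase_Φ_iterate _ x i
      rw [this]
      exact M.linearIndependent_ofBase _ hli
    have hrelV : ∑ i ∈ Finset.range (m + 1), p' i • V.Φ^[i] (M.ofBase _ x) = 0 := by
      have h1 : ∀ i, p' i • V.Φ^[i] (M.ofBase _ x) = M.ofBase _ (p i • M.Φ^[i] x) := fun i => by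
        rw [M.ofBase_Φ_iterate _ x i, ofBase_smul]
      simp only [h1]
      rw [← map_sum, hrel, map_zero]
    exact ⟨c, hc, V.exists_eigenvector_of_solution hm ((hp' 0).2 hp0) hliV hrelV
      (B.monomialRamified_ne_zero l k hc) hw hsol⟩

end DiffMod

end

noncomputable section

open scoped NNReal
open LaurentSeries

namespace DiffMod

open Growth TensorProduct

/-! ### Powers of Φ. -/

section pow

variable {K : Type} [Field K] [Algebra ℂ K] {σ : K ≃ₐ[ℂ] K}

theorem Φ_iterate_smul (M : DiffMod.{u} K σ) (n : ℕ) (a : K) (x : M) :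
    M.Φ^[n] (a • x) = σ^[n] a • M.Φ^[n] x := by
  induction n generalizing a x with
  | zero => rfl
  | succ n ih => rw [Function.iterate_succ_apply, M.Φ_smul, ih]; rfl

/-- The module `(M, Φ ^ s)` over `(K, σ ^ s)`. -/
def iter (M : DiffMod.{u} K σ) (s : ℕ) {σ' : K ≃ₐ[ℂ] K} (h : ∀ a, σ' a = σ^[s] a) :
    DiffMod.{u} K σ' where
  carrier := M
  Φ :=
    { toFun := M.Φ^[s]
      invFun := M.Φ.symm^[s]
      left_inv := (show Function.LeftInverse M.Φ.symm M.Φ from M.Φ.symm_apply_apply).iterate s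
      right_inv := (show Function.LeftInverse M.Φ M.Φ.symm from M.Φ.apply_symm_apply).iterate s
      map_add' := iterate_map_add M.Φ s }
  Φ_smul a x := by
    change M.Φ^[s] (a • x) = σ' a • M.Φ^[s] x
    rw [h, Φ_iterate_smul]

variable {v : Valuation K ℝ≥0} [IsometricAut v σ]

/-- Passing to Φ^s multiplies slopes by `s` and leaves the field unchanged: a substitute for
ramification that stays over K. -/
theorem mem_growthLE_iter (M : DiffMod.{u} K σ) {s : ℕ} (hs : 0 < s) {σ' : K ≃ₐ[ℂ] K}
    [IsometricAut v σ'] (h : ∀ a, σ' a = σ^[s] a) (μ : ℚ) (x : M) :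
    (x : M.iter s h) ∈ (M.iter s h).growthLE v (s * μ) ↔ x ∈ M.growthLE v μ := by
  have := isBdd_iterate (M.isSemi_Φ_symm v) (rad_ne_zero (-μ)) hs (x := x)
  rw [← rad_mul_nat, mul_neg] at this
  exact this

theorem mem_growthGE_iter (M : DiffMod.{u} K σ) {s : ℕ} (hs : 0 < s) {σ' : K ≃ₐ[ℂ] K}
    [IsometricAut v σ'] (h : ∀ a, σ' a = σ^[s] a) (μ : ℚ) (x : M) :
    (x : M.iter s h) ∈ (M.iter s h).growthGE v (s * μ) ↔ x ∈ M.growthGE v μ := by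
  have := isBdd_iterate (M.isSemi_Φ v) (rad_ne_zero μ) hs (x := x)
  rw [← rad_mul_nat] at this
  exact this

theorem mem_growthGE_of_eigenvector (M : DiffMod.{u} K σ) {x : M} {a : K} {μ : ℚ}
    (ha : v a = rad μ) (hx : M.Φ x = a • x) : x ∈ M.growthGE v μ :=
  isBdd_of_eigenvector_mod (M.isSemi_Φ v) (rad_ne_zero μ) ha.le (y := 0) (by rw [hx, add_zero])
    (Submodule.zero_mem (M.growthGE v μ))

end pow

/-! ### Growth under extension of scalars. -/

section ofBase

variable {K : Type} [Field K] [Algebra ℂ K] {σ : K ≃ₐ[ℂ] K} (M : DiffMod.{u} K σ) {K' : Type}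
  [Field K'] [Algebra ℂ K'] [Algebra K K'] {σ' : K' ≃ₐ[ℂ] K'}
  (h : ∀ a, σ' (algebraMap K K' a) = algebraMap K K' (σ a))
  {v : Valuation K ℝ≥0} {v' : Valuation K' ℝ≥0}

theorem isSemi_ofBase (hv : ∀ a, v' (algebraMap K K' a) = v a) :
    IsSemi v v' (M.ofBase h) :=
  ⟨map_add _, algebraMap K K', hv, M.ofBase_smul h⟩

/-- A basis of `M` remains a basis after extension, with the same coordinates; only the comparison
with the basis chosen by `nrm` costs a constant. -/
theorem nrm_le_ofBase (hv : ∀ a, v' (algebraMap K K' a) = v a) :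
    ∃ C, ∀ x, nrm v x ≤ C * nrm v' (M.ofBase h x) := by
  let b := Module.finBasis K M
  let bV : Module.Basis _ K' (M.baseChange h) := Module.Basis.mk
    (M.linearIndependent_ofBase h b.linearIndependent) (by
      rw [top_le_iff]
      refine M.eq_top_of_ofBase_mem h fun x => ?_
      rw [← b.sum_repr x, map_sum]
      refine Submodule.sum_mem _ fun i _ => ?_
      rw [ofBase_smul]
      exact Submodule.smul_mem _ _ (Submodule.subset_span ⟨i, rfl⟩))
  have hbV : ∀ i, bV i = M.ofBase h (b i) := fun i => Module.Basis.mk_apply _ _ i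
  have hrepr : ∀ x i, bV.coord i (M.ofBase h x) = algebraMap K K' (b.repr x i) := by
    intro x i
    conv_lhs => rw [← b.sum_repr x, map_sum, map_sum]
    rw [Finset.sum_eq_single i]
    · rw [ofBase_smul, ← hbV, map_smul, Module.Basis.coord_apply, Module.Basis.repr_self]
      simp
    · intro j _ hj
      rw [ofBase_smul, ← hbV, map_smul, Module.Basis.coord_apply, Module.Basis.repr_self]
      simp [hj]
    · simp
  obtain ⟨C, hC⟩ := exists_forall_of_mono
    (fun i C => ∀ y : M.baseChange h, v' (bV.coord i y) ≤ C * nrm v' y)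
    (fun i C C' hCC' hi y => (hi y).trans (mul_le_mul_left hCC' _))
    (fun i => functional_bound (bV.coord i))
  refine ⟨C, fun x => Finset.sup_le fun i _ => ?_⟩
  have := hC i (M.ofBase h x)
  rw [hrepr, hv] at this
  exact this

variable [IsometricAut v σ] [IsometricAut v' σ'] {μ : ℚ}

theorem growthGE_baseChange (hv : ∀ a, v' (algebraMap K K' a) = v a) :
    (M.baseChange h).growthGE v' μ = ⊤ ↔ M.growthGE v μ = ⊤ := by
  constructor
  · intro ht
    rw [Submodule.eq_top_iff']
    intro x
    obtain ⟨C, hC⟩ := (Submodule.eq_top_iff'.1 ht) (M.ofBase h x)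
    obtain ⟨D, hD⟩ := M.nrm_le_ofBase h hv
    refine ⟨D * C, fun n => (hD _).trans ?_⟩
    rw [mul_assoc, ← ofBase_Φ_iterate]
    exact mul_le_mul_right (hC n) D
  · intro ht
    exact M.eq_top_of_ofBase_mem h fun x => IsBdd.map (M.isSemi_ofBase h hv)
      (fun x => (M.ofBase_Φ h x).symm) (Submodule.eq_top_iff'.1 ht x)

theorem growthLE_baseChange (hv : ∀ a, v' (algebraMap K K' a) = v a) :
    (M.baseChange h).growthLE v' μ = ⊤ ↔ M.growthLE v μ = ⊤ := by
  constructor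
  · intro ht
    rw [Submodule.eq_top_iff']
    intro x
    obtain ⟨C, hC⟩ := (Submodule.eq_top_iff'.1 ht) (M.ofBase h x)
    obtain ⟨D, hD⟩ := M.nrm_le_ofBase h hv
    refine ⟨D * C, fun n => (hD _).trans ?_⟩
    have : M.ofBase h (M.Φ.symm^[n] x) = (M.baseChange h).Φ.symm^[n] (M.ofBase h x) :=
      Function.Semiconj.iterate_right (f := M.ofBase h) (fun x => (ofBase_Φ_symm M h x).symm) n x
    rw [mul_assoc, this]
    exact mul_le_mul_right (hC n) D
  · intro ht
    exact M.eq_top_of_ofBase_mem h fun x => IsBdd.map (M.isSemi_ofBase h hv)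
      (fun x => (M.ofBase_Φ_symm h x).symm) (Submodule.eq_top_iff'.1 ht x)

end ofBase

end DiffMod

namespace BaseField

theorem sigma_pow (B : BaseField) (q : ℂˣ) (s : ℕ) (a : B.field) :
    B.sigma (q ^ s) a = (B.sigma q)^[s] a := by
  induction s with
  | zero => exact Subtype.ext (by rw [pow_zero]; exact dilationHom_one _)
  | succ s ih =>
    rw [Function.iterate_succ_apply', ← ih]
    refine Subtype.ext ?_
    change dilationHom _ _ = dilationHom q (dilationHom _ _)
    rw [dilationHom_dilationHom, pow_succ']

theorem absVal_monomial (B : BaseField) (k : ℤ) {c : ℂ} (hc : c ≠ 0) :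
    B.absVal (B.monomial k c) = rad k := by
  rw [B.absVal_apply (B.monomial_ne_zero k hc)]
  congr 2
  exact HahnSeries.order_single hc

theorem absValRamified_monomial (B : BaseField) (l : ℕ+) (k : ℤ) {c : ℂ} (hc : c ≠ 0) :
    B.absValRamified l (B.monomialRamified l k c) = rad (k / (l : ℕ)) := by
  rw [B.absValRamified_apply l (B.monomialRamified_ne_zero l k hc)]
  congr 3
  exact HahnSeries.order_single hc

end BaseField

/-! ### The greatest slope and its eigenvectors. -/

namespace DiffMod

open Growth

variable {B : BaseField} {q : ℂˣ}

/-- The largest of the cyclic slopes of basis vectors bounds everything. It cannot be lowered, since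
over a ramified extension it is the slope of an actual eigenvector. -/
theorem exists_greatest_slope (hq : 1 < ‖(q : ℂ)‖) (M : DiffMod.{u} B.field (B.sigma q))
    [Nontrivial M] :
    ∃ lam : ℚ, M.growthLE B.absVal lam = ⊤ ∧ (∀ μ, M.growthLE B.absVal μ = ⊤ → lam ≤ μ) ∧
      ∀ k : ℤ, lam = k → ∃ c : ℂ, c ≠ 0 ∧ ∃ y : M, y ≠ 0 ∧ M.Φ y = B.monomial k c • y := by
  let b := Module.finBasis B.field M
  choose lam h1 h2 h3 using fun i => exists_cyclic_slope B hq M (b.ne_zero i)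
  have : Nonempty (Fin (Module.finrank B.field M)) := ⟨⟨0, Module.finrank_pos⟩⟩
  obtain ⟨j, hj⟩ := Finite.exists_max lam
  refine ⟨lam j, ?_, fun μ hμ => ?_, h2 j⟩
  · rw [← top_le_iff, ← b.span_eq, Submodule.span_le]
    rintro _ ⟨i, rfl⟩
    exact M.growthLE_mono (hj i) (h1 i)
  · let l : ℕ+ := ⟨(lam j).den, (lam j).den_pos⟩
    -- Any `l`-th root of `q` will do here, since only growth is compared.
    obtain ⟨r₀, hr₀⟩ := IsAlgClosed.exists_pow_nat_eq (q : ℂ) l.pos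
    have hr0 : r₀ ≠ 0 := by
      rintro rfl
      rw [zero_pow l.ne_zero] at hr₀
      exact q.ne_zero hr₀.symm
    have hr : (Units.mk0 r₀ hr0) ^ (l : ℕ) = q := Units.ext (by simpa using hr₀)
    obtain ⟨c, hc, y, hy, hΦ⟩ := h3 j l _ hr (lam j).num (Rat.mul_den_eq_num _)
    by_contra hlt
    have hval : B.absValRamified l (B.monomialRamified l (lam j).num c) = rad (lam j) := by
      rw [B.absValRamified_monomial l _ hc]
      exact congrArg rad (Rat.num_div_den _)
    have hLE := (growthLE_baseChange M (B.sigmaRamified_algebraMap l hr)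
      (B.absValRamified_algebraMap l)).2 hμ
    exact hy (eq_zero_of_growth (mem_growthGE_of_eigenvector _ hval hΦ)
      (Submodule.eq_top_iff'.1 hLE y) (not_le.1 hlt))

/-- A nonzero module contains an eigenvector of a power of `Φ` of the greatest slope. -/
theorem exists_eigenvector_iterate (hq : 1 < ‖(q : ℂ)‖) (M : DiffMod.{u} B.field (B.sigma q))
    [Nontrivial M] :
    ∃ (s : ℕ) (d : ℤ) (c : ℂ) (y : M), 0 < s ∧ c ≠ 0 ∧ y ≠ 0 ∧
      M.Φ^[s] y = B.monomial d c • y ∧ y ∈ M.growthGE B.absVal (d / s) ∧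
      M.growthLE B.absVal (d / s) = ⊤ := by
  obtain ⟨lam, h1, h2, -⟩ := M.exists_greatest_slope hq
  -- Φ^s has greatest slope `s * lam`, an integer, so an eigenvector of Φ^s exists over K itself.
  -- Minimality on both sides identifies the two greatest slopes.
  set s := lam.den with hs
  have hs0 : 0 < s := lam.den_pos
  have hs0' : (s : ℚ) ≠ 0 := by exact_mod_cast hs0.ne'
  have hσ := B.sigma_pow q s
  have hqs : 1 < ‖((q ^ s : ℂˣ) : ℂ)‖ := by
    rw [Units.val_pow_eq_pow_val, norm_pow]
    exact one_lt_pow₀ hq hs0.ne'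
  have hnt : Nontrivial (M.iter s hσ) := ‹Nontrivial M›
  obtain ⟨lam', h1', h2', h3'⟩ := (M.iter s hσ).exists_greatest_slope hqs
  have hle : lam' ≤ s * lam := h2' _ (Submodule.eq_top_iff'.2 fun x =>
    (M.mem_growthLE_iter hs0 hσ lam x).2 (Submodule.eq_top_iff'.1 h1 x))
  have hge : lam ≤ lam' / s := h2 _ (Submodule.eq_top_iff'.2 fun x => by
    rw [← M.mem_growthLE_iter hs0 hσ, mul_div_cancel₀ _ hs0']
    exact Submodule.eq_top_iff'.1 h1' x)
  have heq : lam' = lam.num := by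
    rw [← Rat.den_mul_eq_num]
    refine le_antisymm hle ?_
    rw [le_div_iff₀ (by exact_mod_cast hs0)] at hge
    linarith
  have hlam : (lam.num : ℚ) / s = lam := Rat.num_div_den lam
  obtain ⟨c, hc, y, hy, hΦ⟩ := h3' _ heq
  refine ⟨s, lam.num, c, y, hs0, hc, hy, hΦ, ?_, by rwa [hlam]⟩
  refine (M.mem_growthGE_iter hs0 hσ (lam.num / s) y).1 ?_
  rw [mul_div_cancel₀ _ hs0']
  exact mem_growthGE_of_eigenvector _ (B.absVal_monomial _ hc) hΦ

end DiffMod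

end

noncomputable section

open scoped NNReal
open LaurentSeries

namespace DiffMod

open Growth

/-! ### Flags of submodules. -/

section flag

variable {K : Type} [Field K] [Algebra ℂ K] {σ : K ≃ₐ[ℂ] K}

/-- A subspace stable under `Φ` is stable under `Φ⁻¹`. -/
theorem isStable_of_map_mem (M : DiffMod.{u} K σ) {W : Submodule K M}
    (hW : ∀ x ∈ W, M.Φ x ∈ W) : M.IsStable W := by
  refine fun x => ⟨fun hx => ?_, hW x⟩
  -- The preimages of `W` under the powers of Φ increase, hence stabilise; Φ being bijective, they
  -- are then all equal.
  let N : ℕ →o Submodule K M :=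
    { toFun := fun n =>
        { carrier := {x | M.Φ^[n] x ∈ W}
          zero_mem' := by simp [iterate_map_zero]
          add_mem' := fun {x y} hx hy => by
            simp only [Set.mem_ofPred_eq, iterate_map_add] at *
            exact W.add_mem hx hy
          smul_mem' := fun a x hx => by
            simp only [Set.mem_ofPred_eq, Φ_iterate_smul] at *
            exact W.smul_mem _ hx }
      monotone' := monotone_nat_of_le_succ fun n x hx => by
        change M.Φ^[n + 1] x ∈ W
        rw [Function.iterate_succ_apply']
        exact hW _ hx }
  obtain ⟨n, hn⟩ := monotone_stabilizes_iff_noetherian.2 (inferInstance : IsNoetherian K M) N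
  have hinv := (show Function.LeftInverse M.Φ M.Φ.symm from M.Φ.apply_symm_apply).iterate n
  have h1 : M.Φ.symm^[n] x ∈ N (n + 1) := by
    change M.Φ^[n + 1] _ ∈ W
    rw [Function.iterate_succ_apply', hinv]
    exact hx
  rw [← hn (n + 1) (Nat.le_succ n)] at h1
  change M.Φ^[n] _ ∈ W at h1
  rwa [hinv] at h1

/-- Submodules which are successive extensions of submodules of rank at most one. -/
inductive IsFlag (M : DiffMod.{u} K σ) : Submodule K M → Prop
  | bot : IsFlag M ⊥
  | step (W : Submodule K M) (e : M) (a : K) : IsFlag M W → M.Φ e - a • e ∈ W →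
      IsFlag M (W ⊔ Submodule.span K {e})

theorem IsFlag.isStable {M : DiffMod.{u} K σ} {W : Submodule K M} (h : M.IsFlag W) :
    M.IsStable W := by
  refine M.isStable_of_map_mem ?_
  induction h with
  | bot => intro x hx; rw [(Submodule.mem_bot K).1 hx, map_zero]; exact Submodule.zero_mem _
  | step W e a _ he ih =>
    intro x hx
    obtain ⟨w, hw, z, hz, rfl⟩ := Submodule.mem_sup.1 hx
    obtain ⟨b, rfl⟩ := Submodule.mem_span_singleton.1 hz
    rw [map_add, M.Φ_smul]
    refine Submodule.add_mem _ (Submodule.mem_sup_left (ih w hw)) (Submodule.smul_mem _ _ ?_)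
    rw [← sub_add_cancel (M.Φ e) (a • e)]
    exact Submodule.add_mem _ (Submodule.mem_sup_left he)
      (Submodule.smul_mem _ _ (Submodule.mem_sup_right (Submodule.mem_span_singleton_self e)))

theorem IsFlag.exists_family {M : DiffMod.{u} K σ} {W : Submodule K M} (h : M.IsFlag W) :
    ∃ (n : ℕ) (b : Fin n → M), LinearIndependent K b ∧ Submodule.span K (Set.range b) = W ∧
      ∀ j, ∃ a : K, M.Φ (b j) - a • b j ∈ Submodule.span K (b '' {i | i < j}) := by
  induction h with
  | bot =>
    exact ⟨0, Fin.elim0, linearIndependent_empty_type, by simp, fun j => j.elim0⟩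
  | step W e a _ he ih =>
    obtain ⟨n, b, hb, hspan, htri⟩ := ih
    -- A step may add nothing; the basis is then left unchanged.
    by_cases heW : e ∈ W
    · refine ⟨n, b, hb, ?_, htri⟩
      rw [hspan, eq_comm, sup_eq_left, Submodule.span_singleton_le_iff_mem]
      exact heW
    · refine ⟨n + 1, Fin.snoc b e, linearIndependent_finSnoc.2 ⟨hb, by rwa [hspan]⟩, ?_, ?_⟩
      · rw [Fin.range_snoc, Submodule.span_insert, hspan, sup_comm]
      · intro j
        induction j using Fin.lastCases with
        | last =>
          refine ⟨a, ?_⟩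
          rw [Fin.snoc_last]
          rw [← hspan] at he
          refine Submodule.span_mono ?_ he
          rintro _ ⟨i, rfl⟩
          exact ⟨i.castSucc, Fin.castSucc_lt_last i, by rw [Fin.snoc_castSucc]⟩
        | cast j =>
          obtain ⟨a', ha'⟩ := htri j
          refine ⟨a', ?_⟩
          rw [Fin.snoc_castSucc]
          refine Submodule.span_mono ?_ ha'
          rintro _ ⟨i, hi, rfl⟩
          exact ⟨i.castSucc, Fin.castSucc_lt_castSucc_iff.2 hi, by rw [Fin.snoc_castSucc]⟩

theorem IsFlag.exists_basis {M : DiffMod.{u} K σ} (h : M.IsFlag ⊤) :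
    ∃ (n : ℕ) (b : Module.Basis (Fin n) K M), ∀ i j, j < i → b.repr (M.Φ (b j)) i = 0 := by
  obtain ⟨n, b, hb, hspan, htri⟩ := h.exists_family
  let b' := Module.Basis.mk hb hspan.ge
  have hb' : ∀ i, b' i = b i := fun i => Module.Basis.mk_apply _ _ i
  refine ⟨n, b', fun i j hij => ?_⟩
  obtain ⟨a, ha⟩ := htri j
  have himg : b '' {i | i < j} = b' '' {i | i < j} := by
    refine Set.image_congr fun i _ => (hb' i).symm
  rw [himg, Module.Basis.mem_span_image, ← hb' j] at ha
  have h1 : b'.repr (M.Φ (b' j) - a • b' j) i = 0 := by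
    by_contra hne
    exact absurd (ha (Finsupp.mem_support_iff.2 hne)) (not_lt.2 hij.le)
  rw [map_sub, map_smul, Finsupp.sub_apply, Finsupp.smul_apply, b'.repr_self,
    Finsupp.single_eq_of_ne hij.ne'] at h1
  simpa using h1

open Polynomial in
/-- If a power of `T = t Φ` acts on `u` by a constant modulo a flagged submodule, then `u` lies in a
flagged submodule. -/
theorem IsFlag.exists_mem {M : DiffMod.{u} K σ} {W : Submodule K M} (h : M.IsFlag W) {t : K}
    (ht : t ≠ 0) {u : M} {s : ℕ} (hs : 0 < s) (c : ℂ)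
    (hu : (fun x => t • M.Φ x)^[s] u - algebraMap ℂ K c • u ∈ W) :
    ∃ W', M.IsFlag W' ∧ W ≤ W' ∧ u ∈ W' := by
  let _ : Module ℂ M := Module.compHom M (algebraMap ℂ K)
  have hsmul : ∀ (c : ℂ) (x : M), c • x = algebraMap ℂ K c • x := fun _ _ => rfl
  -- `σ` fixes ℂ, so `T` is ℂ-linear and complex polynomials can be evaluated at it.
  let T : Module.End ℂ M :=
    { toFun := fun x => t • M.Φ x
      map_add' := fun x y => by rw [map_add, smul_add]
      map_smul' := fun c x => by
        simp only [hsmul, M.Φ_smul, AlgEquiv.commutes, RingHom.id_apply]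
        rw [smul_comm] }
  -- The linear factors of X^s - c are peeled off one by one: the vector (T - a)u is put in a flag
  -- first, and `u` then extends that flag by one step.
  have key : ∀ (S : Multiset ℂ) (u : M), aeval T (S.map fun a => X - C a).prod u ∈ W →
      ∃ W', M.IsFlag W' ∧ W ≤ W' ∧ u ∈ W' := by
    intro S
    induction S using Multiset.induction_on with
    | empty => intro u hu; exact ⟨W, h, le_rfl, by simpa using hu⟩
    | cons a S ih =>
      intro u hu
      rw [Multiset.map_cons, Multiset.prod_cons, mul_comm, map_mul, Module.End.mul_apply] at hu
      obtain ⟨W', hW', hle, hmem⟩ := ih _ hu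
      have h1 : aeval T (X - C a) u = t • M.Φ u - algebraMap ℂ K a • u := by
        rw [map_sub, aeval_X, aeval_C, LinearMap.sub_apply, Module.algebraMap_end_apply]
        rfl
      rw [h1] at hmem
      refine ⟨_, IsFlag.step W' u (t⁻¹ * algebraMap ℂ K a) hW' ?_, hle.trans le_sup_left,
        Submodule.mem_sup_right (Submodule.mem_span_singleton_self u)⟩
      have := W'.smul_mem t⁻¹ hmem
      rwa [smul_sub, smul_smul, smul_smul, inv_mul_cancel₀ ht, one_smul] at this
  have hmonic : (X ^ s - C c : ℂ[X]).Monic := monic_X_pow_sub_C c hs.ne'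
  refine key (X ^ s - C c : ℂ[X]).roots u ?_
  rw [← (IsAlgClosed.splits (X ^ s - C c : ℂ[X])).eq_prod_roots_of_monic hmonic, map_sub, map_pow,
    aeval_X, aeval_C, LinearMap.sub_apply, Module.algebraMap_end_apply, Module.End.pow_apply]
  exact hu

end flag

/-! ### Triangularisation after ramification. -/

section triangularisation

variable {B : BaseField} {τ : ℂ}

theorem _root_.BaseField.monomialRamified_mul (B : BaseField) (l : ℕ+) (k k' : ℤ) (c c' : ℂ) :
    B.monomialRamified l k c * B.monomialRamified l k' c' =
      B.monomialRamified l (k + k') (c * c') :=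
  Subtype.ext HahnSeries.single_mul_single

theorem _root_.BaseField.sigmaRamified_monomial (B : BaseField) (l : ℕ+) (r : ℂˣ) (k : ℤ) (c : ℂ) :
    B.sigmaRamified l r (B.monomialRamified l k c) =
      B.monomialRamified l k (((r ^ k : ℂˣ) : ℂ) * c) := by
  refine Subtype.ext ?_
  change dilationHom r (HahnSeries.single k c) = HahnSeries.single k (((r ^ k : ℂˣ) : ℂ) * c)
  ext n
  rw [dilationHom_coeff]
  by_cases hn : n = k
  · subst hn; simp
  · rw [HahnSeries.coeff_single_of_ne hn, HahnSeries.coeff_single_of_ne hn, mul_zero]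

theorem _root_.BaseField.monomialRamified_zero (B : BaseField) (l : ℕ+) (c : ℂ) :
    B.monomialRamified l 0 c = algebraMap ℂ (B.Ramified l) c := by
  refine Subtype.ext ?_
  change HahnSeries.single 0 c = algebraMap ℂ ℂ⸨X⸩ c
  ext n
  by_cases hn : n = 0 <;> simp [HahnSeries.algebraMap_apply', hn]

theorem _root_.BaseField.algebraMap_monomial (B : BaseField) (l : ℕ+) (k : ℤ) (c : ℂ) :
    algebraMap B.field (B.Ramified l) (B.monomial k c) = B.monomialRamified l (l * k) c := by
  refine Subtype.ext ?_
  change ramificationHom l (HahnSeries.single k c) = HahnSeries.single (l * k) c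
  ext n
  by_cases hn : (l : ℤ) ∣ n
  · obtain ⟨m, rfl⟩ := hn
    rw [ramificationHom_coeff_mul]
    have hl : (l : ℤ) ≠ 0 := by exact_mod_cast l.ne_zero
    by_cases hm : m = k
    · subst hm; simp
    · rw [HahnSeries.coeff_single_of_ne hm, HahnSeries.coeff_single_of_ne]
      simpa [hl] using hm
  · rw [ramificationHom_coeff_of_not_dvd l _ hn, HahnSeries.coeff_single_of_ne]
    rintro rfl
    exact hn ⟨k, rfl⟩

/-- Moving monomials past Φ produces only constants. Their value `κ` is immaterial, since
`IsFlag.exists_mem` accepts an arbitrary constant. -/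
theorem iterate_monomial_smul_Φ {l : ℕ+} {r : ℂˣ}
    (V : DiffMod.{u} (B.Ramified l) (B.sigmaRamified l r)) (k : ℤ) (n : ℕ) : ∃ κ : ℂ, ∀ u : V,
      (fun x => B.monomialRamified l k 1 • V.Φ x)^[n] u =
        B.monomialRamified l (n * k) κ • V.Φ^[n] u := by
  induction n with
  | zero =>
    refine ⟨1, fun u => ?_⟩
    rw [Nat.cast_zero, zero_mul, B.monomialRamified_zero, map_one, one_smul]
    rfl
  | succ n ih =>
    obtain ⟨κ, hκ⟩ := ih
    refine ⟨((r ^ ((n : ℤ) * k) : ℂˣ) : ℂ) * κ, fun u => ?_⟩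
    rw [Function.iterate_succ_apply', hκ, V.Φ_smul, B.sigmaRamified_monomial, smul_smul,
      B.monomialRamified_mul, Function.iterate_succ_apply', one_mul]
    congr 2
    push_cast; ring

/-- Every `q`-difference module is triangularisable after a ramification. -/
theorem exists_triangular_basis (hq : 1 < ‖(qRoot τ 1 : ℂ)‖) (M : QDiffMod.{u} B τ) :
    ∃ (l : ℕ+) (n : ℕ) (b : Module.Basis (Fin n) (B.Ramified l) (M.ramify l)),
      ∀ i j, j < i → b.repr ((M.ramify l).Φ (b j)) i = 0 := by
  let mk (l : ℕ+) : M →+ M.ramify l := M.ofBase (B.sigmaRamified_algebraMap l (qRoot_pow τ l))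
  have mk_smul : ∀ l a x, mk l (a • x) = algebraMap B.field (B.Ramified l) a • mk l x :=
    fun l => M.ofBase_smul _
  have mk_Φ : ∀ l x, (M.ramify l).Φ (mk l x) = mk l (M.Φ x) := fun l => M.ofBase_Φ _
  -- All multiples of `l₀` are included, so that the ramification can be enlarged when the maximal
  -- `N` is extended.
  let S : Set (Submodule B.field M) := {N | M.IsStable N ∧ ∃ l₀ : ℕ+, ∀ l, l₀ ∣ l →
    ∃ W, (M.ramify l).IsFlag W ∧ ∀ x ∈ N, mk l x ∈ W}
  have hS : S.Nonempty := ⟨⊥, fun x => by simp, 1, fun l _ => ⟨⊥, IsFlag.bot, fun x hx => by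
    rw [(Submodule.mem_bot _).1 hx, map_zero]; exact Submodule.zero_mem _⟩⟩
  obtain ⟨N, ⟨hN, l₀, hl₀⟩, hmax⟩ := set_has_maximal_iff_noetherian.2
    (inferInstance : IsNoetherian B.field M) S hS
  rcases eq_or_ne N ⊤ with rfl | hNtop
  · obtain ⟨W, hW, hmem⟩ := hl₀ l₀ dvd_rfl
    have : W = ⊤ := M.eq_top_of_ofBase_mem (B.sigmaRamified_algebraMap l₀ (qRoot_pow τ l₀))
      fun x => hmem x Submodule.mem_top
    subst this
    exact ⟨l₀, hW.exists_basis⟩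
  exfalso
  have hnt : Nontrivial (M.quot N hN) := Submodule.Quotient.nontrivial_iff.2 hNtop
  obtain ⟨s, d, c, y', hs, hc, hy', hΦ, -, -⟩ := (M.quot N hN).exists_eigenvector_iterate hq
  obtain ⟨y, rfl⟩ := N.mkQ_surjective y'
  have hyN : y ∉ N := fun h => hy' ((Submodule.Quotient.mk_eq_zero N).2 h)
  have hrel : M.Φ^[s] y - B.monomial d c • y ∈ N := by
    rw [← Submodule.Quotient.eq N]
    refine Eq.trans ?_ hΦ
    exact Function.Semiconj.iterate_right (f := N.mkQ) (fun x => (M.quot_Φ_mk N hN x).symm) s y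
  let N' : Submodule B.field M := sInf {P | M.IsStable P ∧ N ≤ P ∧ y ∈ P}
  have hN' : M.IsStable N' := fun x => by
    simp only [N', Submodule.mem_sInf, Set.mem_ofPred_eq]
    exact ⟨fun h P hP => (hP.1 x).1 (h P hP), fun h P hP => (hP.1 x).2 (h P hP)⟩
  have hlt : N < N' := by
    refine lt_of_le_of_ne (le_sInf fun P hP => hP.2.1) fun h => hyN ?_
    rw [h]
    exact Submodule.mem_sInf.2 fun P hP => hP.2.2
  refine hmax N' ⟨hN', ⟨s, hs⟩ * l₀, fun l hl => ?_⟩ hlt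
  obtain ⟨W, hW, hNW⟩ := hl₀ l (dvd_of_mul_left_dvd hl)
  -- Since `s` divides `l`, the monomial of exponent `-k` makes the power `s` of the rescaled Φ act
  -- on `y` by a constant modulo `W`.
  obtain ⟨k, hk⟩ : ∃ k : ℤ, (s : ℤ) * k = l * d := by
    obtain ⟨e, he⟩ := dvd_of_mul_right_dvd hl
    refine ⟨e * d, ?_⟩
    have : (l : ℤ) = s * e := by
      rw [he]; rfl
    rw [this]; ring
  obtain ⟨κ, hκ⟩ := iterate_monomial_smul_Φ (M.ramify l) (-k) s
  have hu : (fun x => B.monomialRamified l (-k) 1 • (M.ramify l).Φ x)^[s] (mk l y) -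
      algebraMap ℂ (B.Ramified l) (κ * c) • mk l y ∈ W := by
    have h1 := W.smul_mem (B.monomialRamified l (s * -k) κ) (hNW _ hrel)
    rw [map_sub, mk_smul, B.algebraMap_monomial, smul_sub, smul_smul, B.monomialRamified_mul,
      ← hk, mul_neg, neg_add_cancel, B.monomialRamified_zero] at h1
    rw [hκ, mul_neg]
    have h2 : (M.ramify l).Φ^[s] (mk l y) = mk l (M.Φ^[s] y) := M.ofBase_Φ_iterate _ y s
    rwa [h2]
  obtain ⟨W', hW', hle, hyW'⟩ := hW.exists_mem
    (B.monomialRamified_ne_zero l (-k) one_ne_zero) hs _ hu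
  refine ⟨W', hW', fun x hx => ?_⟩
  -- Flags are stable, so the preimage of `W'` is a stable subspace of `M` containing `N` and `y`,
  -- hence all of `N'`.
  let P : Submodule B.field M :=
    { carrier := {x | mk l x ∈ W'}
      zero_mem' := by simp
      add_mem' := fun {x y} hx hy => by
        simp only [Set.mem_ofPred_eq, map_add] at *
        exact W'.add_mem hx hy
      smul_mem' := fun a x hx => by
        simp only [Set.mem_ofPred_eq, mk_smul] at *
        exact W'.smul_mem _ hx }
  have hP : M.IsStable P := fun x => by
    change mk l (M.Φ x) ∈ W' ↔ mk l x ∈ W'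
    rw [← mk_Φ]
    exact hW'.isStable _
  exact Submodule.mem_sInf.1 hx P ⟨hP, fun x hx => hle (hNW x hx), hyW'⟩

end triangularisation

/-! ### Slopes expressed by growth. -/

section slopes

variable {B : BaseField} {τ : ℂ} {M : QDiffMod.{u} B τ} {l : ℕ+} {n : ℕ}
  {b : Module.Basis (Fin n) (B.Ramified l) (M.ramify l)}

theorem absVal_diag (ht : ∀ i j, j < i → b.repr ((M.ramify l).Φ (b j)) i = 0) (j : Fin n) :
    B.absValRamified l (b.repr ((M.ramify l).Φ (b j)) j) =
      rad ((b.repr ((M.ramify l).Φ (b j)) j).val / (l : ℕ)) :=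
  B.absValRamified_apply l (left_ne_zero_of_mul_eq_one ((triangular_symm _ b ht).2 j))

theorem absVal_diag_symm (ht : ∀ i j, j < i → b.repr ((M.ramify l).Φ (b j)) i = 0) (j : Fin n) :
    B.absValRamified l (b.repr ((M.ramify l).Φ.symm (b j)) j) =
      rad (-((b.repr ((M.ramify l).Φ (b j)) j).val / (l : ℕ))) := by
  have h := congrArg (B.absValRamified l) ((triangular_symm _ b ht).2 j)
  rw [map_mul, map_one, IsometricAut.map_eq, absVal_diag ht] at h
  rw [rad_neg]
  exact eq_inv_of_mul_eq_one_right h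

theorem growthGE_of_triangular (ht : ∀ i j, j < i → b.repr ((M.ramify l).Φ (b j)) i = 0) {μ : ℚ}
    (h : ∀ j, μ ≤ (b.repr ((M.ramify l).Φ (b j)) j).val / (l : ℕ)) :
    M.growthGE B.absVal μ = ⊤ := by
  refine (growthGE_baseChange M (B.sigmaRamified_algebraMap l (qRoot_pow τ l))
    (B.absValRamified_algebraMap l)).1 (Submodule.eq_top_iff'.2 ?_)
  refine isBdd_of_triangular b (isSemi_Φ _ _) (rad_ne_zero μ) ht fun j => ?_
  rw [absVal_diag ht, rad_le_rad]
  exact h j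

theorem growthLE_of_triangular (ht : ∀ i j, j < i → b.repr ((M.ramify l).Φ (b j)) i = 0) {μ : ℚ}
    (h : ∀ j, (b.repr ((M.ramify l).Φ (b j)) j).val / (l : ℕ) ≤ μ) :
    M.growthLE B.absVal μ = ⊤ := by
  refine (growthLE_baseChange M (B.sigmaRamified_algebraMap l (qRoot_pow τ l))
    (B.absValRamified_algebraMap l)).1 (Submodule.eq_top_iff'.2 ?_)
  refine isBdd_of_triangular b (isSemi_Φ_symm _ _) (rad_ne_zero (-μ)) (triangular_symm _ b ht).1
    fun j => ?_
  rw [absVal_diag_symm ht, rad_le_rad, neg_le_neg_iff]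
  exact h j

theorem le_of_mem_slopes {M : QDiffMod.{u} B τ} {μ ν : ℚ} (h : M.growthGE B.absVal μ = ⊤)
    (hν : ν ∈ M.slopes) : μ ≤ ν := by
  obtain ⟨l, n, b, ht, j, rfl⟩ := hν
  have h1 := (growthGE_baseChange M (B.sigmaRamified_algebraMap l (qRoot_pow τ l))
    (B.absValRamified_algebraMap l)).2 h
  have h2 := le_of_isBdd_triangular b (isSemi_Φ (B.absValRamified l) (M.ramify l))
    (rad_ne_zero μ) ht (Submodule.eq_top_iff'.1 h1 (b j))
  rwa [absVal_diag ht, rad_le_rad] at h2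

theorem ge_of_mem_slopes {M : QDiffMod.{u} B τ} {μ ν : ℚ} (h : M.growthLE B.absVal μ = ⊤)
    (hν : ν ∈ M.slopes) : ν ≤ μ := by
  obtain ⟨l, n, b, ht, j, rfl⟩ := hν
  have h1 := (growthLE_baseChange M (B.sigmaRamified_algebraMap l (qRoot_pow τ l))
    (B.absValRamified_algebraMap l)).2 h
  have h2 := le_of_isBdd_triangular b (isSemi_Φ_symm (B.absValRamified l) (M.ramify l))
    (rad_ne_zero (-μ)) (triangular_symm _ b ht).1 (Submodule.eq_top_iff'.1 h1 (b j))
  rwa [absVal_diag_symm ht, rad_le_rad, neg_le_neg_iff] at h2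

/-- Growth bounds the diagonal of every triangular basis. Conversely one such basis recovers the
growth, and its existence is what keeps the condition on slopes from being vacuous. -/
theorem le_slopes_iff (hq : 1 < ‖(qRoot τ 1 : ℂ)‖) (M : QDiffMod.{u} B τ) {μ : ℚ} :
    (∀ ν ∈ M.slopes, μ ≤ ν) ↔ M.growthGE B.absVal μ = ⊤ := by
  refine ⟨fun h => ?_, fun h ν hν => le_of_mem_slopes h hν⟩
  obtain ⟨l, n, b, ht⟩ := M.exists_triangular_basis hq
  exact growthGE_of_triangular ht fun j => h _ ⟨l, n, b, ht, j, rfl⟩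

theorem lt_slopes_iff (hq : 1 < ‖(qRoot τ 1 : ℂ)‖) (M : QDiffMod.{u} B τ) {μ : ℚ} :
    (∀ ν ∈ M.slopes, μ < ν) ↔ ∃ μ' > μ, M.growthGE B.absVal μ' = ⊤ := by
  refine ⟨fun h => ?_, fun ⟨μ', h1, h2⟩ ν hν => h1.trans_le (le_of_mem_slopes h2 hν)⟩
  obtain ⟨l, n, b, ht⟩ := M.exists_triangular_basis hq
  rcases Nat.eq_zero_or_pos n with rfl | hn
  -- The zero module has no slopes, so any larger number serves.
  · exact ⟨μ + 1, by simp, growthGE_of_triangular ht fun j => j.elim0⟩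
  have : Nonempty (Fin n) := ⟨⟨0, hn⟩⟩
  obtain ⟨j, hj⟩ := Finite.exists_min fun j : Fin n =>
    ((b.repr ((M.ramify l).Φ (b j)) j).val : ℚ) / (l : ℕ)
  exact ⟨_, h _ ⟨l, n, b, ht, j, rfl⟩, growthGE_of_triangular ht hj⟩

theorem isPure_iff (hq : 1 < ‖(qRoot τ 1 : ℂ)‖) (M : QDiffMod.{u} B τ) {μ : ℚ} :
    M.IsPure μ ↔ Nontrivial M ∧ M.growthGE B.absVal μ = ⊤ ∧ M.growthLE B.absVal μ = ⊤ := by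
  obtain ⟨l, n, b, ht⟩ := M.exists_triangular_basis hq
  constructor
  · intro h
    refine ⟨?_, growthGE_of_triangular ht fun j => ?_, growthLE_of_triangular ht fun j => ?_⟩
    · by_contra hM
      rw [not_nontrivial_iff_subsingleton] at hM
      have hbot : ∀ x : M, x = 0 := fun x => Subsingleton.elim x 0
      -- On a zero module every growth condition holds, which would put the slope `μ` above `μ + 1`.
      have h0 : M.growthGE B.absVal (μ + 1) = ⊤ := Submodule.eq_top_iff'.2 fun x => by
        rw [hbot x]; exact Submodule.zero_mem _
      have := le_of_mem_slopes h0 (h ▸ Set.mem_singleton μ : μ ∈ M.slopes)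
      linarith
    · exact (Set.mem_singleton_iff.1 (h ▸ ⟨l, n, b, ht, j, rfl⟩ : _ ∈ ({μ} : Set ℚ))).ge
    · exact (Set.mem_singleton_iff.1 (h ▸ ⟨l, n, b, ht, j, rfl⟩ : _ ∈ ({μ} : Set ℚ))).le
  · rintro ⟨hM, hGE, hLE⟩
    have hmem : ∀ ν ∈ M.slopes, ν = μ := fun ν hν =>
      le_antisymm (ge_of_mem_slopes hLE hν) (le_of_mem_slopes hGE hν)
    refine Set.eq_singleton_iff_nonempty_unique_mem.2 ⟨?_, hmem⟩
    rcases Nat.eq_zero_or_pos n with rfl | hn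
    · exfalso
      obtain ⟨x, hx⟩ := exists_ne (0 : M)
      have hli := M.linearIndependent_ofBase (B.sigmaRamified_algebraMap l (qRoot_pow τ l))
        (LinearIndependent.of_subsingleton (v := fun _ : Unit => x) () hx)
      refine hli.ne_zero () ?_
      have : Subsingleton (M.ramify l) := b.repr.toEquiv.subsingleton
      exact Subsingleton.elim (α := M.ramify l) _ _
    · exact ⟨_, l, n, b, ht, ⟨0, hn⟩, rfl⟩

end slopes

end DiffMod

end

noncomputable section

open scoped NNReal
open LaurentSeries DirectSum

namespace DiffMod

open Growth

/-! ### Identification of the canonical filtration; strictness of surjections. -/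

section quotMap

variable {K : Type} [Field K] [Algebra ℂ K] {σ : K ≃ₐ[ℂ] K} {M N : DiffMod.{u} K σ}

/-- The morphism induced on quotients. -/
def quotMap (f : M ⟶ N) (F : Submodule K M) (H : Submodule K N) (hF : M.IsStable F)
    (hH : N.IsStable H) (h : F ≤ H.comap (Hom.lin f)) : M.quot F hF ⟶ N.quot H hH where
  lin := F.mapQ H (Hom.lin f) h
  comm := by
    intro y
    obtain ⟨x, rfl⟩ := F.mkQ_surjective y
    exact congrArg H.mkQ (f.comm x)

theorem isStable_map (f : M ⟶ N) {F : Submodule K M} (hF : M.IsStable F) :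
    N.IsStable (F.map (Hom.lin f)) := by
  refine N.isStable_of_map_mem ?_
  rintro _ ⟨x, hx, rfl⟩
  exact ⟨M.Φ x, (hF x).2 hx, f.comm x⟩

end quotMap

section filtration

variable {B : BaseField} {τ : ℂ} {M N : QDiffMod.{u} B τ} {μ ν : ℚ}

theorem growthGE_sub_eq_top (P : Submodule B.field M) (h : M.IsStable P) :
    (M.sub P h).growthGE B.absVal μ = ⊤ ↔ P ≤ M.growthGE B.absVal μ := by
  rw [Submodule.eq_top_iff']
  exact ⟨fun h' x hx => (mem_growthGE_sub P h ⟨x, hx⟩).1 (h' ⟨x, hx⟩),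
    fun h' x => (mem_growthGE_sub P h x).2 (h' x.2)⟩

theorem growthLE_sub_eq_top (P : Submodule B.field M) (h : M.IsStable P) :
    (M.sub P h).growthLE B.absVal μ = ⊤ ↔ P ≤ M.growthLE B.absVal μ := by
  rw [Submodule.eq_top_iff']
  exact ⟨fun h' x hx => (mem_growthLE_sub P h ⟨x, hx⟩).1 (h' ⟨x, hx⟩),
    fun h' x => (mem_growthLE_sub P h x).2 (h' x.2)⟩

theorem mem_submodulesGE (hq : 1 < ‖(qRoot τ 1 : ℂ)‖) (P : Submodule B.field M) :
    P ∈ M.submodulesGE μ ↔ M.IsStable P ∧ P ≤ M.growthGE B.absVal μ := by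
  constructor
  · rintro ⟨h, h'⟩
    exact ⟨h, (growthGE_sub_eq_top P h).1 ((le_slopes_iff hq _).1 h')⟩
  · rintro ⟨h, h'⟩
    exact ⟨h, (le_slopes_iff hq _).2 ((growthGE_sub_eq_top P h).2 h')⟩

theorem mem_submodulesGT (hq : 1 < ‖(qRoot τ 1 : ℂ)‖) (P : Submodule B.field M) :
    P ∈ M.submodulesGT μ ↔ M.IsStable P ∧ ∃ μ' > μ, P ≤ M.growthGE B.absVal μ' := by
  constructor
  · rintro ⟨h, h'⟩
    obtain ⟨μ', h1, h2⟩ := (lt_slopes_iff hq _).1 h'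
    exact ⟨h, μ', h1, (growthGE_sub_eq_top P h).1 h2⟩
  · rintro ⟨h, μ', h1, h2⟩
    exact ⟨h, (lt_slopes_iff hq _).2 ⟨μ', h1, (growthGE_sub_eq_top P h).2 h2⟩⟩

theorem isGreatest_growthGE (hq : 1 < ‖(qRoot τ 1 : ℂ)‖) (M : QDiffMod.{u} B τ) (μ : ℚ) :
    IsGreatest (M.submodulesGE μ) (M.growthGE B.absVal μ) :=
  ⟨(mem_submodulesGE hq _).2 ⟨M.isStable_growthGE μ, le_rfl⟩,
    fun P hP => ((mem_submodulesGE hq P).1 hP).2⟩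

theorem filGE_eq (hq : 1 < ‖(qRoot τ 1 : ℂ)‖) (M : QDiffMod.{u} B τ) (μ : ℚ) :
    M.filGE μ = M.growthGE B.absVal μ :=
  (isGreatest_growthGE hq M μ).isLUB.sSup_eq

theorem exists_maximal_growthGE (M : QDiffMod.{u} B τ) (μ : ℚ) :
    ∃ μ₀ > μ, ∀ μ' > μ, M.growthGE B.absVal μ' ≤ M.growthGE B.absVal μ₀ := by
  obtain ⟨_, ⟨μ₀, hμ₀, rfl⟩, hmax⟩ := set_has_maximal_iff_noetherian.2
    (inferInstance : IsNoetherian B.field M) ((M.growthGE B.absVal ·) '' Set.Ioi μ)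
    (Set.nonempty_Ioi.image _)
  refine ⟨μ₀, hμ₀, fun μ' hμ' => ?_⟩
  rcases le_total μ₀ μ' with h | h
  · exact M.growthGE_anti h
  · by_contra hne
    exact hmax _ ⟨μ', hμ', rfl⟩ (lt_of_le_not_ge (M.growthGE_anti h) hne)

theorem isGreatest_filGT (hq : 1 < ‖(qRoot τ 1 : ℂ)‖) (M : QDiffMod.{u} B τ) (μ : ℚ) :
    IsGreatest (M.submodulesGT μ) (M.filGT μ) := by
  obtain ⟨μ₀, h0, hmax⟩ := M.exists_maximal_growthGE μ
  have h : IsGreatest (M.submodulesGT μ) (M.growthGE B.absVal μ₀) := by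
    refine ⟨(mem_submodulesGT hq _).2 ⟨M.isStable_growthGE μ₀, μ₀, h0, le_rfl⟩, fun P hP => ?_⟩
    obtain ⟨_, μ', h1, h2⟩ := (mem_submodulesGT hq P).1 hP
    exact h2.trans (hmax μ' h1)
  rwa [filGT, h.isLUB.sSup_eq]

/-- In a Noetherian module the decreasing filtration is constant just to the right of `μ`, so strict
inequalities on slopes reduce to the non-strict ones that growth describes. -/
theorem exists_filGT_eq (hq : 1 < ‖(qRoot τ 1 : ℂ)‖) (M : QDiffMod.{u} B τ) (μ : ℚ) :
    ∃ μ₀ > μ, ∀ μ' > μ, μ' ≤ μ₀ → M.filGT μ = M.growthGE B.absVal μ' := by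
  obtain ⟨μ₀, h0, hmax⟩ := M.exists_maximal_growthGE μ
  refine ⟨μ₀, h0, fun μ' hμ' hle => ?_⟩
  refine (IsGreatest.isLUB ⟨(mem_submodulesGT hq _).2 ⟨M.isStable_growthGE μ', μ', hμ', le_rfl⟩,
    fun P hP => ?_⟩).sSup_eq
  obtain ⟨_, μ'', h1, h2⟩ := (mem_submodulesGT hq P).1 hP
  exact h2.trans ((hmax μ'' h1).trans (M.growthGE_anti hle))

theorem mem_filGT (hq : 1 < ‖(qRoot τ 1 : ℂ)‖) {x : M} :
    x ∈ M.filGT μ ↔ ∃ μ' > μ, x ∈ M.growthGE B.absVal μ' := by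
  constructor
  · intro hx
    obtain ⟨μ₀, h0, h1⟩ := M.exists_filGT_eq hq μ
    exact ⟨μ₀, h0, by rwa [← h1 μ₀ h0 le_rfl]⟩
  · rintro ⟨μ', h1, h2⟩
    exact (isGreatest_filGT hq M μ).2
      ((mem_submodulesGT hq _).2 ⟨M.isStable_growthGE μ', μ', h1, le_rfl⟩) h2

theorem mem_filGE (hq : 1 < ‖(qRoot τ 1 : ℂ)‖) {x : M} :
    x ∈ M.filGE μ ↔ x ∈ M.growthGE B.absVal μ := by rw [filGE_eq hq]

theorem respectsFiltration (hq : 1 < ‖(qRoot τ 1 : ℂ)‖) : RespectsFiltration.{u} B τ := by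
  refine fun M N f μ => ⟨fun x hx => ?_, fun x hx => ?_⟩
  · rw [mem_filGE hq] at *
    exact Hom.map_growthGE f hx
  · rw [mem_filGT hq] at *
    obtain ⟨μ', h1, h2⟩ := hx
    exact ⟨μ', h1, Hom.map_growthGE f h2⟩

/-- A module without part of slopes `≥ μ` has slopes bounded away from `μ`. -/
theorem exists_growthLE_eq_top (hq : 1 < ‖(qRoot τ 1 : ℂ)‖) (h : M.growthGE B.absVal μ = ⊥) :
    ∃ ν < μ, M.growthLE B.absVal ν = ⊤ := by
  rcases subsingleton_or_nontrivial M with hM | hM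
  · exact ⟨μ - 1, by linarith, Submodule.eq_top_iff'.2 fun x => by
      rw [Subsingleton.elim x 0]; exact Submodule.zero_mem _⟩
  · obtain ⟨s, d, c, y, hs, hc, hy, hΦ, hGE, hLE⟩ := M.exists_eigenvector_iterate hq
    refine ⟨d / s, ?_, hLE⟩
    by_contra hlt
    have := M.growthGE_anti (not_lt.1 hlt) hGE
    rw [h] at this
    exact hy ((Submodule.mem_bot _).1 this)

/-- The eigenvector carrying the greatest slope is nonzero, so by hypothesis that slope does not
exceed `μ`. -/
theorem growthLE_eq_top (hq : 1 < ‖(qRoot τ 1 : ℂ)‖)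
    (h : ∀ μ' > μ, M.growthGE B.absVal μ' = ⊥) : M.growthLE B.absVal μ = ⊤ := by
  rcases subsingleton_or_nontrivial M with hM | hM
  · exact Submodule.eq_top_iff'.2 fun x => by
      rw [Subsingleton.elim x 0]; exact Submodule.zero_mem _
  · obtain ⟨s, d, c, y, hs, hc, hy, hΦ, hGE, hLE⟩ := M.exists_eigenvector_iterate hq
    rcases le_or_gt ((d : ℚ) / s) μ with hle | hlt
    · exact top_le_iff.1 (hLE ▸ M.growthLE_mono hle)
    · rw [h _ hlt] at hGE
      exact absurd ((Submodule.mem_bot _).1 hGE) hy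

/-- Surjective morphisms are strict for the filtration. -/
theorem Hom.exists_mem_growthGE (hq : 1 < ‖(qRoot τ 1 : ℂ)‖) (f : M ⟶ N)
    (hf : Function.Surjective (Hom.lin f)) {y : N} (hy : y ∈ N.growthGE B.absVal μ) :
    ∃ x ∈ M.growthGE B.absVal μ, Hom.lin f x = y := by
  have hF := M.isStable_growthGE (v := B.absVal) μ
  have hbot : (M.quot _ hF).growthGE B.absVal μ = ⊥ := M.growthGE_quot (v := B.absVal) μ
  obtain ⟨ν, hν, hLE⟩ := exists_growthLE_eq_top hq hbot
  -- N modulo the image of F^{≥μ}(M) is a quotient of M / F^{≥μ}(M), so its slopes are at most ν <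
  -- μ. The class of `y` also has slopes ≥ μ and is therefore zero.
  have hH := isStable_map f hF
  generalize M.growthGE B.absVal μ = F at hF hLE hH ⊢
  obtain ⟨x, rfl⟩ := hf y
  have h1 := Hom.map_growthLE (quotMap f F _ hF hH (Submodule.le_comap_map _ _))
    (Submodule.eq_top_iff'.1 hLE (F.mkQ x))
  have h2 := Hom.map_growthGE (N.quotHom _ hH) hy
  exact (Submodule.Quotient.mk_eq_zero _).1 (eq_zero_of_growth h2 h1 hν)

end filtration

/-! ### Exactness of gr. -/

section exactness

variable {B : BaseField} {τ : ℂ}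

theorem grPiece_mkQ_eq_zero {M : QDiffMod.{u} B τ} {μ : ℚ} (x : M.filGE μ) :
    (((M.filGT μ).submoduleOf (M.filGE μ)).mkQ x : M.grPiece μ) = 0 ↔ x.1 ∈ M.filGT μ :=
  Submodule.Quotient.mk_eq_zero _

/-- Strictness is used twice. A lift of a class killed by `g` is first corrected by an element of
F^{>μ}(N) so as to lie in ker g, then lifted through M → ker g without leaving F^{≥μ}. -/
theorem grPieceMap_exact (hq : 1 < ‖(qRoot τ 1 : ℂ)‖) (hF : RespectsFiltration.{u} B τ)
    {M N P : QDiffMod.{u} B τ} (f : M ⟶ N) (g : N ⟶ P)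
    (hfg : Function.Exact (Hom.lin f) (Hom.lin g)) (μ : ℚ) :
    Function.Exact (grPieceMap hF f μ) (grPieceMap hF g μ) := by
  intro z
  obtain ⟨y, rfl⟩ := Submodule.mkQ_surjective _ z
  constructor
  · intro hz
    have hgy : Hom.lin g y.1 ∈ P.filGT μ :=
      (grPiece_mkQ_eq_zero (M := P) ((Hom.lin g).restrict (hF N P g μ).1 y)).1 hz
    let I := LinearMap.ker (Hom.lin g)
    have hI : N.IsStable I := N.isStable_of_map_mem fun x hx => by
      rw [LinearMap.mem_ker, g.comm, LinearMap.mem_ker.1 hx, map_zero]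
    let gbar : N.quot I hI ⟶ P :=
      { lin := I.liftQ (Hom.lin g) le_rfl
        comm := by rintro ⟨x⟩; exact g.comm x }
    have hinj : Function.Injective (Hom.lin gbar) := by
      rw [← LinearMap.ker_eq_bot]
      exact Submodule.ker_liftQ_eq_bot' I (Hom.lin g) rfl
    let fbar : M ⟶ N.sub I hI :=
      { lin := (Hom.lin f).codRestrict I fun x => hfg.apply_apply_eq_zero x
        comm := fun x => Subtype.ext (f.comm x) }
    have hsurj : Function.Surjective (Hom.lin fbar) := by
      rintro ⟨x, hx⟩
      obtain ⟨w, hw⟩ := (hfg x).1 hx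
      exact ⟨w, Subtype.ext hw⟩
    obtain ⟨μ', hμ', hgy'⟩ := (mem_filGT hq).1 hgy
    -- N / ker g embeds in P, so the class of `y` there has slopes ≥ μ' > μ; strictness lifts it to
    -- the correction `y'`.
    obtain ⟨y', hy', hyy'⟩ := Hom.exists_mem_growthGE hq (N.quotHom I hI)
      (Submodule.mkQ_surjective _) (y := I.mkQ y.1) (Hom.mem_growthGE_of_injective gbar hinj hgy')
    have hmem : y.1 - y' ∈ I := by
      rw [← Submodule.Quotient.eq I]
      exact hyy'.symm
    have hmem' : y.1 - y' ∈ N.growthGE B.absVal μ :=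
      Submodule.sub_mem _ ((mem_filGE hq).1 y.2) (N.growthGE_anti hμ'.le hy')
    obtain ⟨x, hx, hfx⟩ := Hom.exists_mem_growthGE hq fbar hsurj (y := ⟨y.1 - y', hmem⟩)
      ((mem_growthGE_sub I hI ⟨y.1 - y', hmem⟩).2 hmem')
    have hfx : Hom.lin f x = y.1 - y' := congrArg Subtype.val hfx
    refine ⟨((M.filGT μ).submoduleOf (M.filGE μ)).mkQ ⟨x, (mem_filGE hq).2 hx⟩, ?_⟩
    refine (Submodule.Quotient.eq _).2 ?_
    change Hom.lin f x - y.1 ∈ N.filGT μ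
    rw [hfx, sub_sub_cancel_left]
    exact Submodule.neg_mem _ ((mem_filGT hq).2 ⟨μ', hμ', hy'⟩)
  · rintro ⟨w, hw⟩
    obtain ⟨x, rfl⟩ := Submodule.mkQ_surjective _ w
    rw [← hw]
    refine (grPiece_mkQ_eq_zero (M := P) _).2 ?_
    change Hom.lin g (Hom.lin f x.1) ∈ P.filGT μ
    rw [hfg.apply_apply_eq_zero]
    exact Submodule.zero_mem _

theorem grFunctor_exact (hq : 1 < ‖(qRoot τ 1 : ℂ)‖) (hF : RespectsFiltration.{u} B τ)
    {M N P : QDiffMod.{u} B τ} (f : M ⟶ N) (g : N ⟶ P)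
    (hfg : Function.Exact (Hom.lin f) (Hom.lin g)) :
    Function.Exact (Hom.lin ((grFunctor hF).map f)) (Hom.lin ((grFunctor hF).map g)) := by
  have hpiece := grPieceMap_exact hq hF f g hfg
  change Function.Exact (DirectSum.lmap fun μ => grPieceMap hF f μ)
    (DirectSum.lmap fun μ => grPieceMap hF g μ)
  rw [LinearMap.exact_iff, DirectSum.ker_lmap, DirectSum.range_lmap]
  have hker : (fun μ => LinearMap.ker (grPieceMap hF g μ)) =
      fun μ => LinearMap.range (grPieceMap hF f μ) :=
    funext fun μ => LinearMap.exact_iff.1 (hpiece μ)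
  exact congrArg (fun p => (Submodule.pi Set.univ p).comap _) hker

end exactness

end DiffMod

end

noncomputable section

open scoped NNReal
open LaurentSeries DirectSum

namespace DiffMod

open Growth

/-! ### Slope parts and moderate irregularity. -/

section slopePart

variable {B : BaseField} {τ : ℂ} {M N : QDiffMod.{u} B τ} {μ ν : ℚ}

/-- The largest subspace of `M` which is pure of slope `μ` or zero. -/
def slopePart (M : QDiffMod.{u} B τ) (μ : ℚ) : Submodule B.field M :=
  M.growthGE B.absVal μ ⊓ M.growthLE B.absVal μ

theorem isStable_slopePart (M : QDiffMod.{u} B τ) (μ : ℚ) : M.IsStable (M.slopePart μ) :=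
  fun x => and_congr (M.isStable_growthGE μ x) (M.isStable_growthLE μ x)

theorem Hom.map_slopePart (f : M ⟶ N) {x : M} (hx : x ∈ M.slopePart μ) :
    Hom.lin f x ∈ N.slopePart μ :=
  ⟨Hom.map_growthGE f hx.1, Hom.map_growthLE f hx.2⟩

/-- The term of smallest slope is minus the sum of the others, hence has only larger slopes as well,
and vanishes by separation. -/
theorem eq_zero_of_sum_slopePart (s : Finset ℚ) (x : ℚ → M)
    (hx : ∀ μ ∈ s, x μ ∈ M.slopePart μ) (h : ∑ μ ∈ s, x μ = 0) : ∀ μ ∈ s, x μ = 0 := by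
  induction s using Finset.induction_on_min with
  | empty => simp
  | insert μ s hμ ih =>
    have hnot : μ ∉ s := fun h' => lt_irrefl _ (hμ μ h')
    rw [Finset.sum_insert hnot] at h
    have h0 : x μ = 0 := by
      rcases s.eq_empty_or_nonempty with rfl | hne
      · simpa using h
      · have hmem : x μ ∈ M.growthGE B.absVal (s.min' hne) := by
          rw [eq_neg_of_add_eq_zero_left h]
          refine Submodule.neg_mem _ (Submodule.sum_mem _ fun ν hν => ?_)
          exact M.growthGE_anti (s.min'_le ν hν) (hx ν (Finset.mem_insert_of_mem hν)).1
        exact eq_zero_of_growth hmem (hx μ (Finset.mem_insert_self _ _)).2 (hμ _ (s.min'_mem hne))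
    rw [h0, zero_add] at h
    intro ν hν
    rcases Finset.mem_insert.1 hν with rfl | hν
    · exact h0
    · exact ih (fun κ hκ => hx κ (Finset.mem_insert_of_mem hκ)) h ν hν

theorem iSupIndep_slopePart (M : QDiffMod.{u} B τ) : iSupIndep M.slopePart := by
  classical
  refine iSupIndep_of_dfinsupp_lsum_injective _ ?_
  rw [injective_iff_map_eq_zero]
  intro m hm
  refine DFinsupp.ext fun μ => ?_
  by_cases hμ : μ ∈ m.support
  · refine Subtype.ext (eq_zero_of_sum_slopePart m.support (fun ν => (m ν : M))
      (fun ν _ => (m ν).2) ?_ μ hμ)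
    rw [DFinsupp.lsum_apply_apply, DFinsupp.sumAddHom_apply] at hm
    exact hm
  · simpa using hμ

/-- Every pure summand lies in the part of its slope, several summands possibly in the same one.
Conversely the nonzero parts are independent, hence finite in number, and form a canonical
decomposition. -/
theorem isModeratelyIrregular_iff (hq : 1 < ‖(qRoot τ 1 : ℂ)‖) (M : QDiffMod.{u} B τ) :
    IsModeratelyIrregular M ↔ ⨆ μ, M.slopePart μ = ⊤ := by
  constructor
  · rintro ⟨n, P, hP, hpure⟩
    rw [← top_le_iff, ← hP.submodule_iSup_eq_top]
    refine iSup_le fun i => ?_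
    obtain ⟨h, μ, hμ⟩ := hpure i
    obtain ⟨-, hGE, hLE⟩ := (isPure_iff hq _).1 hμ
    exact (le_inf ((growthGE_sub_eq_top _ h).1 hGE) ((growthLE_sub_eq_top _ h).1 hLE)).trans
      (le_iSup M.slopePart μ)
  · intro htop
    have hind := M.iSupIndep_slopePart
    have hfin : Finite {μ | M.slopePart μ ≠ ⊥} := WellFoundedGT.finite_ne_bot_of_iSupIndep hind
    let e := (Finite.equivFin {μ | M.slopePart μ ≠ ⊥}).symm
    refine ⟨_, fun i => M.slopePart (e i), ?_, fun i => ⟨M.isStable_slopePart _, e i, ?_⟩⟩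
    · refine DirectSum.isInternal_submodule_of_iSupIndep_of_iSup_eq_top
        (hind.comp (Subtype.val_injective.comp e.injective)) ?_
      rw [← top_le_iff, ← htop]
      refine iSup_le fun μ => ?_
      by_cases hμ : M.slopePart μ = ⊥
      · simp [hμ]
      · exact le_iSup_of_le (e.symm ⟨μ, hμ⟩) (by rw [e.apply_symm_apply])
    · refine (isPure_iff hq _).2 ⟨?_, (growthGE_sub_eq_top _ _).2 inf_le_left,
        (growthLE_sub_eq_top _ _).2 inf_le_right⟩
      exact Submodule.nontrivial_iff_ne_bot.2 (e i).2

end slopePart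

/-! ### The graded module and its comparison with a moderately irregular module. -/

section gr

variable {B : BaseField} {τ : ℂ} {M N : QDiffMod.{u} B τ} {μ ν : ℚ}

theorem growthGE_grPiece (hq : 1 < ‖(qRoot τ 1 : ℂ)‖) (M : QDiffMod.{u} B τ) (μ : ℚ) :
    (M.grPiece μ).growthGE B.absVal μ = ⊤ := by
  refine Submodule.eq_top_iff'.2 fun z => ?_
  obtain ⟨y, rfl⟩ := Submodule.mkQ_surjective _ z
  exact Hom.map_growthGE (quotHom _ _ _)
    ((mem_growthGE_sub _ (M.isStable_filGE μ) y).2 ((mem_filGE hq).1 y.2))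

/-- A class of slopes ≥ μ' > μ has a representative whose slopes are ≥ κ for some κ slightly above
`μ`, because F^{>μ}, the kernel of the projection, is itself described by growth at κ. The
representative then lies in F^{>μ}, and the class is zero. -/
theorem growthLE_grPiece (hq : 1 < ‖(qRoot τ 1 : ℂ)‖) (M : QDiffMod.{u} B τ) (μ : ℚ) :
    (M.grPiece μ).growthLE B.absVal μ = ⊤ := by
  refine growthLE_eq_top hq fun μ' hμ' => ?_
  obtain ⟨μ₀, h0, h1⟩ := M.exists_filGT_eq hq μ
  have hκ := h1 (min μ' μ₀) (lt_min hμ' h0) (min_le_right _ _)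
  rw [Submodule.eq_bot_iff]
  intro z hz
  replace hz := (M.grPiece μ).growthGE_anti (min_le_left μ' μ₀) hz
  obtain ⟨y, rfl⟩ := Submodule.mkQ_surjective _ z
  refine (grPiece_mkQ_eq_zero y).2 ?_
  rw [hκ]
  refine (mem_growthGE_sub _ (M.isStable_filGE μ) y).1 ?_
  refine Hom.mem_growthGE_of_ker_le (quotHom _ _ _) (Submodule.mkQ_surjective _) ?_ hz
  intro x hx
  have hx := (grPiece_mkQ_eq_zero x).1 hx
  rw [hκ] at hx
  exact (mem_growthGE_sub _ (M.isStable_filGE μ) x).2 hx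

/-- The inclusion of a graded piece. -/
def grOf (M : QDiffMod.{u} B τ) (μ : ℚ) : M.grPiece μ ⟶ M.gr where
  lin := DirectSum.lof B.field ℚ (fun μ => M.grPiece μ) μ
  comm x := (DFinsupp.mapRange_single (f := fun μ => (M.grPiece μ).Φ)
    (hf := fun μ => map_zero (M.grPiece μ).Φ) (i := μ) (b := x)).symm

theorem isModeratelyIrregular_gr (hq : 1 < ‖(qRoot τ 1 : ℂ)‖) (M : QDiffMod.{u} B τ) :
    IsModeratelyIrregular M.gr := by
  rw [isModeratelyIrregular_iff hq, Submodule.eq_top_iff']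
  intro x
  change (⨁ μ : ℚ, M.grPiece μ) at x
  induction x using DirectSum.induction_on with
  | zero => exact Submodule.zero_mem _
  | of μ z =>
    refine Submodule.mem_iSup_of_mem μ (Hom.map_slopePart (M.grOf μ) ⟨?_, ?_⟩)
    · rw [growthGE_grPiece hq]; trivial
    · rw [growthLE_grPiece hq]; trivial
  | add x y hx hy => exact Submodule.add_mem _ hx hy

/-- The projection of the part of slope `μ` to the graded piece. -/
def slopePartToGr (hq : 1 < ‖(qRoot τ 1 : ℂ)‖) (M : QDiffMod.{u} B τ) (μ : ℚ) :
    M.slopePart μ →ₗ[B.field] M.grPiece μ :=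
  ((M.filGT μ).submoduleOf (M.filGE μ)).mkQ ∘ₗ
    Submodule.inclusion (fun _ hx => (mem_filGE hq).2 hx.1)

theorem slopePartToGr_injective (hq : 1 < ‖(qRoot τ 1 : ℂ)‖) (M : QDiffMod.{u} B τ) (μ : ℚ) :
    Function.Injective (slopePartToGr hq M μ) := by
  rw [injective_iff_map_eq_zero]
  intro x hx
  obtain ⟨μ', h1, h2⟩ := (mem_filGT hq).1 ((grPiece_mkQ_eq_zero _).1 hx)
  exact Subtype.ext (eq_zero_of_growth h2 x.2.2 h1)

/-- A vector splits into components of slopes below, equal to and above `μ`. If it lies in F^{≥μ},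
the first component vanishes by separation, and the third dies in the graded piece. -/
theorem slopePartToGr_surjective (hq : 1 < ‖(qRoot τ 1 : ℂ)‖) {M : QDiffMod.{u} B τ}
    (hM : IsModeratelyIrregular M) (μ : ℚ) : Function.Surjective (slopePartToGr hq M μ) := by
  have key : ∀ x : M, ∃ a, (∃ ν < μ, a ∈ M.growthLE B.absVal ν) ∧ ∃ b ∈ M.slopePart μ,
      ∃ c ∈ M.filGT μ, x = a + b + c := by
    intro x
    have hx : x ∈ ⨆ μ, M.slopePart μ := (isModeratelyIrregular_iff hq M).1 hM ▸ Submodule.mem_top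
    have hz : ∃ ν < μ, (0 : M) ∈ M.growthLE B.absVal ν :=
      ⟨μ - 1, by linarith, Submodule.zero_mem _⟩
    induction hx using Submodule.iSup_induction' with
    | mem κ x hx =>
      rcases lt_trichotomy κ μ with h | rfl | h
      · exact ⟨x, ⟨κ, h, hx.2⟩, 0, Submodule.zero_mem _, 0, Submodule.zero_mem _, by simp⟩
      · exact ⟨0, hz, x, hx, 0, Submodule.zero_mem _, by simp⟩
      · exact ⟨0, hz, 0, Submodule.zero_mem _, x, (mem_filGT hq).2 ⟨κ, h, hx.1⟩, by simp⟩
    | zero => exact ⟨0, hz, 0, Submodule.zero_mem _, 0, Submodule.zero_mem _, by simp⟩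
    | add x y _ _ hx hy =>
      obtain ⟨a, ⟨ν, hν, ha⟩, b, hb, c, hc, rfl⟩ := hx
      obtain ⟨a', ⟨ν', hν', ha'⟩, b', hb', c', hc', rfl⟩ := hy
      refine ⟨a + a', ⟨max ν ν', max_lt hν hν', Submodule.add_mem _
        (M.growthLE_mono (le_max_left _ _) ha) (M.growthLE_mono (le_max_right _ _) ha')⟩,
        b + b', Submodule.add_mem _ hb hb', c + c', Submodule.add_mem _ hc hc', by abel⟩
  intro z
  obtain ⟨x, rfl⟩ := Submodule.mkQ_surjective _ z
  obtain ⟨a, ⟨ν, hν, ha⟩, b, hb, c, hc, hx⟩ := key x.1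
  have hx : x.1 = a + b + c := hx
  have ha0 : a = 0 := by
    refine eq_zero_of_growth (μ := μ) ?_ ha hν
    have : a = x.1 - b - c := by rw [hx]; abel
    rw [this]
    exact Submodule.sub_mem _ (Submodule.sub_mem _ ((mem_filGE hq).1 x.2) hb.1)
      ((mem_filGE hq).1 (M.filGT_le_filGE μ hc))
  refine ⟨⟨b, hb⟩, (Submodule.Quotient.eq _).2 ?_⟩
  change b - x.1 ∈ M.filGT μ
  rw [hx, ha0, zero_add, sub_add_cancel_left]
  exact Submodule.neg_mem _ hc

theorem coeLinearMap_slopePart_bijective (hq : 1 < ‖(qRoot τ 1 : ℂ)‖) {M : QDiffMod.{u} B τ}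
    (hM : IsModeratelyIrregular M) :
    Function.Bijective (DirectSum.coeLinearMap M.slopePart) :=
  DirectSum.isInternal_submodule_of_iSupIndep_of_iSup_eq_top M.iSupIndep_slopePart
    ((isModeratelyIrregular_iff hq M).1 hM)

/-- A moderately irregular module is isomorphic to its graded module, as a vector space. -/
def linGr (hq : 1 < ‖(qRoot τ 1 : ℂ)‖) {M : QDiffMod.{u} B τ}
    (hM : IsModeratelyIrregular M) : M ≃ₗ[B.field] M.gr :=
  (LinearEquiv.ofBijective (DirectSum.coeLinearMap M.slopePart)
      (coeLinearMap_slopePart_bijective hq hM)).symm ≪≫ₗ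
    LinearEquiv.ofBijective (DirectSum.lmap (slopePartToGr hq M))
      ⟨(DirectSum.lmap_injective _).2 (slopePartToGr_injective hq M),
        (DirectSum.lmap_surjective _).2 (slopePartToGr_surjective hq hM)⟩

theorem linGr_apply (hq : 1 < ‖(qRoot τ 1 : ℂ)‖) {M : QDiffMod.{u} B τ}
    (hM : IsModeratelyIrregular M) {x : M} (hx : x ∈ M.slopePart μ) :
    linGr hq hM x = Hom.lin (M.grOf μ) (slopePartToGr hq M μ ⟨x, hx⟩) := by
  have h : (LinearEquiv.ofBijective (DirectSum.coeLinearMap M.slopePart)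
      (coeLinearMap_slopePart_bijective hq hM)).symm x =
      DirectSum.lof B.field ℚ (fun μ => M.slopePart μ) μ ⟨x, hx⟩ :=
    (LinearEquiv.symm_apply_eq _).2 (DirectSum.coeLinearMap_lof M.slopePart μ ⟨x, hx⟩).symm
  exact (congrArg (DirectSum.lmap (slopePartToGr hq M)) h).trans (DirectSum.lmap_lof _ _ _)

/-- Morphisms out of a moderately irregular module are determined on the parts of given slope. -/
theorem induction_slopePart (hq : 1 < ‖(qRoot τ 1 : ℂ)‖) {M : QDiffMod.{u} B τ}
    (hM : IsModeratelyIrregular M) {A : Type*} [AddCommGroup A] (f g : M →+ A)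
    (h : ∀ μ, ∀ x ∈ M.slopePart μ, f x = g x) : f = g := by
  refine AddMonoidHom.ext fun x => ?_
  have hx : x ∈ ⨆ μ, M.slopePart μ := (isModeratelyIrregular_iff hq M).1 hM ▸ Submodule.mem_top
  exact Submodule.iSup_induction _ (motive := fun x => f x = g x) hx h (by simp)
    fun x y hx hy => by rw [map_add, map_add, hx, hy]

theorem linGr_comm (hq : 1 < ‖(qRoot τ 1 : ℂ)‖) {M : QDiffMod.{u} B τ}
    (hM : IsModeratelyIrregular M) (x : M) : linGr hq hM (M.Φ x) = M.gr.Φ (linGr hq hM x) := by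
  refine DFunLike.congr_fun (induction_slopePart hq hM
    ((linGr hq hM).toLinearMap.toAddMonoidHom.comp M.Φ.toAddMonoidHom)
    (M.gr.Φ.toAddMonoidHom.comp (linGr hq hM).toLinearMap.toAddMonoidHom) fun μ x hx => ?_) x
  change linGr hq hM (M.Φ x) = M.gr.Φ (linGr hq hM x)
  rw [linGr_apply hq hM hx, linGr_apply hq hM ((M.isStable_slopePart μ x).2 hx), ← Hom.comm]
  rfl

/-- Morphisms preserve slope parts, and on each part the comparison is just the projection to the
graded piece, which is compatible with induced maps. -/
theorem linGr_naturality (hq : 1 < ‖(qRoot τ 1 : ℂ)‖) (hF : RespectsFiltration.{u} B τ)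
    {M N : QDiffMod.{u} B τ} (hM : IsModeratelyIrregular M) (hN : IsModeratelyIrregular N)
    (f : M ⟶ N) (x : M) :
    linGr hq hN (Hom.lin f x) = Hom.lin ((grFunctor hF).map f) (linGr hq hM x) := by
  refine DFunLike.congr_fun (induction_slopePart hq hM
    ((linGr hq hN).toLinearMap ∘ₗ Hom.lin f).toAddMonoidHom
    (Hom.lin ((grFunctor hF).map f) ∘ₗ (linGr hq hM).toLinearMap).toAddMonoidHom
    fun μ x hx => ?_) x
  change linGr hq hN (Hom.lin f x) = Hom.lin ((grFunctor hF).map f) (linGr hq hM x)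
  rw [linGr_apply hq hM hx, linGr_apply hq hN (Hom.map_slopePart f hx)]
  exact (DirectSum.lmap_lof (fun μ => grPieceMap hF f μ) μ
    (slopePartToGr hq M μ ⟨x, hx⟩)).symm

/-- An equivariant linear equivalence is an isomorphism of `q`-difference modules. -/
def isoOfLinearEquiv (e : M ≃ₗ[B.field] N) (h : ∀ x, e (M.Φ x) = N.Φ (e x)) : M ≅ N where
  hom := ⟨e.toLinearMap, h⟩
  inv := ⟨e.symm.toLinearMap, fun x => e.injective (by
    change e (e.symm (N.Φ x)) = e (M.Φ (e.symm x))
    rw [h, e.apply_symm_apply, e.apply_symm_apply])⟩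
  hom_inv_id := hom_ext (LinearMap.ext e.symm_apply_apply)
  inv_hom_id := hom_ext (LinearMap.ext e.apply_symm_apply)

theorem grFunctor_additive (hF : RespectsFiltration.{u} B τ) : (grFunctor hF).Additive where
  map_add {M N f g} := by
    refine hom_ext (LinearMap.ext fun x => DFinsupp.ext fun μ => ?_)
    change DFinsupp (fun μ => M.grPiece μ) at x
    change grPieceMap hF (f + g) μ (x μ) = grPieceMap hF f μ (x μ) + grPieceMap hF g μ (x μ)
    obtain ⟨y, hy⟩ := Submodule.mkQ_surjective _ (x μ)
    rw [← hy]
    rfl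

theorem grFunctor_linear (hF : RespectsFiltration.{u} B τ) : (grFunctor hF).Linear ℂ where
  map_smul {M N} f c := by
    refine hom_ext (LinearMap.ext fun x => DFinsupp.ext fun μ => ?_)
    change DFinsupp (fun μ => M.grPiece μ) at x
    change grPieceMap hF (c • f) μ (x μ) = algebraMap ℂ B.field c • grPieceMap hF f μ (x μ)
    obtain ⟨y, hy⟩ := Submodule.mkQ_surjective _ (x μ)
    rw [← hy]
    rfl

/-- The isomorphism of a moderately irregular module with its graded module. -/
def grIsoApp (hq : 1 < ‖(qRoot τ 1 : ℂ)‖) (hF : RespectsFiltration.{u} B τ)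
    (hgr : ∀ M : QDiffMod.{u} B τ, IsModeratelyIrregular ((grFunctor hF).obj M))
    (M : (IsModeratelyIrregular.{u} (B := B) (τ := τ)).FullSubcategory) :
    M ≅ (IsModeratelyIrregular.lift (grFunctor hF) hgr).obj M.obj :=
  ObjectProperty.isoMk _ (isoOfLinearEquiv (linGr hq M.property) (linGr_comm hq M.property))

/-- On moderately irregular modules, `gr` is isomorphic to the identity. -/
def grIso (hq : 1 < ‖(qRoot τ 1 : ℂ)‖) (hF : RespectsFiltration.{u} B τ)
    (hgr : ∀ M : QDiffMod.{u} B τ, IsModeratelyIrregular ((grFunctor hF).obj M)) :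
    IsModeratelyIrregular.ι ⋙ IsModeratelyIrregular.lift (grFunctor hF) hgr ≅
      𝟭 (IsModeratelyIrregular.{u} (B := B) (τ := τ)).FullSubcategory :=
  (NatIso.ofComponents (fun M => grIsoApp hq hF hgr M) fun {M N} f => by
    refine ObjectProperty.hom_ext _ (hom_ext (LinearMap.ext fun x => ?_))
    exact linGr_naturality hq hF M.property N.property f.hom x).symm

end gr

end DiffMod

end

theorem mainTheorem7 (B : BaseField) (τ : ℂ) (hq : 1 < ‖(qRoot τ 1 : ℂ)‖) :
    (∀ (M : DiffMod.QDiffMod.{u} B τ) (μ : ℚ),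
      IsGreatest (M.submodulesGE μ) (M.filGE μ) ∧ IsGreatest (M.submodulesGT μ) (M.filGT μ)) ∧
    ∃ (hF : DiffMod.RespectsFiltration.{u} B τ)
      (hgr : ∀ M : DiffMod.QDiffMod.{u} B τ,
        DiffMod.IsModeratelyIrregular ((DiffMod.grFunctor hF).obj M)),
      let G := DiffMod.IsModeratelyIrregular.lift (DiffMod.grFunctor hF) hgr
      G.Additive ∧ G.Linear ℂ ∧
      (∀ (M N P : DiffMod.QDiffMod.{u} B τ) (f : M ⟶ N) (g : N ⟶ P),
        Function.Exact (DiffMod.Hom.lin f) (DiffMod.Hom.lin g) →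
          Function.Exact (DiffMod.Hom.lin (G.map f).hom) (DiffMod.Hom.lin (G.map g).hom)) ∧
      Nonempty (DiffMod.IsModeratelyIrregular.ι ⋙ G ≅
        𝟭 (DiffMod.IsModeratelyIrregular.{u} (B := B) (τ := τ)).FullSubcategory) := by
  refine ⟨fun M μ => ⟨?_, DiffMod.isGreatest_filGT hq M μ⟩, DiffMod.respectsFiltration hq,
    DiffMod.isModeratelyIrregular_gr hq, ?_, ?_, ?_, ?_⟩
  · rw [DiffMod.filGE_eq hq]
    exact DiffMod.isGreatest_growthGE hq M μ
  · have := DiffMod.grFunctor_additive (DiffMod.respectsFiltration.{u} (B := B) hq)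
    exact ⟨ObjectProperty.hom_ext _ (Functor.map_add (DiffMod.grFunctor _))⟩
  · have := DiffMod.grFunctor_linear (DiffMod.respectsFiltration.{u} (B := B) hq)
    exact ⟨fun f r => ObjectProperty.hom_ext _ (Functor.map_smul (DiffMod.grFunctor _) r f)⟩
  · exact fun M N P f g hfg => DiffMod.grFunctor_exact hq _ f g hfg
  · exact ⟨DiffMod.grIso hq _ _⟩
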